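/- Let $n\ge 1$, let $\mu=(\mu_1\ge\dots\ge\mu_n\ge 0)$ be a partition with at most $n$ parts, and let $S$ be a semistandard Young tableau of shape $\mu$ with entries in $[n]=\{1,\dots,n\}$ (English convention: rows weakly increasing to the right, columns strictly increasing downward). Let $\mathfrak S_n$ act on functions $f:[n]\to\mathbb Z_{\ge 0}$ by $(wf)(i)=f(w^{-1}i)$ and let $S_\mu$ be the stabiliser of $i\mapsto\mu_i$. **The permutation $\varphi$.** Let $p$ be the number of non-zero parts of $\mu$. One produces configurations $S_1,\dots,S_p$ (fillings of boxes in which some boxes may be empty), each with an exposed entry of value $\varphi_i$. Put $S_1=S$, with exposed entry the rightmost entry of the first row. For $1<i\le p$, start with $S_{i-1}$ and let the temporarily exposed entry $e$ be the rightmost entry of row $i$. Repeat: if $e$ is not in the first row and the row just above $e$ contains entries of value at least that of $e$, let $c$ be the leftmost of these, push $c$ and all entries to its right in its row one step down, and let the new temporarily exposed entry be the entry that was immediately to the left of $c$ in its row (ignoring empty boxes); otherwise stop, let $S_i$ be the present configuration and let $\varphi_i$ be the value of $e$. Finally $\varphi_{p+1},\dots,\varphi_n$ are the elements of $[n]\setminus\{\varphi_1,\dots,\varphi_p\}$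 in increasing order. **Keys.** A permutation $\sigma$ determines a key tableau of shape $\mu$: the entries of a column with $m$ boxes are $\sigma_1,\dots,\sigma_m$ in increasing order. The *right key* of $S$ is the semistandard tableau of shape $\mu$ defined as follows. Let $b(1),\dots,b(c)$ be the lengths of the columns of $S$. For each $j$, apply jeu de taquin slides (inward or outward) to $S$ to reach a semistandard tableau of a skew shape with $c$ columns, whose successive column lengths are any rearrangement of $b(1),\dots,b(c)$ with last term $b(j)$; its last column is column $j$ of the right key. (Such skew tableaux exist and the result is independent of all choices; this is part of the claim that the right key is what is stated below.) **Theorem.** The word $\varphi_1\varphi_2\cdots\varphi_n$ is the one-line notation of a permutation $\varphi\in\mathfrak S_n$, and: 1. the right key of $S$ is the coset $\varphi S_\mu$; that is, the right key of $S$ is a key tableau, and the permutations that determine it are exactly the elements of $\varphi S_\mu$; 2. $\varphi$ is the unique minimal element of the coset $\varphi S_\mu$ in the Bruhat order on $\mathfrak S_n$; indeed $\varphi\le\sigma$ for all $\sigma\in\varphi S_\mu$. -/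

import Mathlib

open scoped Pointwise

namespace RightKey

/-! Conventions: rows, columns, positions and values are all numbered from `0`, so that
`[n] = {1, …, n}` becomes `{0, …, n - 1}`, i.e. `Fin n`, and the one-line notation of a permutation
`σ` is `σ 0, σ 1, …, σ (n - 1)`.  Cells are pairs `(row, column)`, in the English convention. -/

/-! ### Skew tableaux and jeu de taquin -/

/-- A semistandard tableau of skew shape `outer / inner`. The filling is required to vanish outside
the skew shape, so that tableaux with the same entries are equal. -/
@[ext]
structure SkewTableau where
  inner : YoungDiagram
  outer : YoungDiagram
  inner_le_outer : inner ≤ outer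
  entry : ℕ → ℕ → ℕ
  row_weak : ∀ {i j₁ j₂ : ℕ}, j₁ < j₂ → (i, j₁) ∉ inner → (i, j₂) ∈ outer →
    entry i j₁ ≤ entry i j₂
  col_strict : ∀ {i₁ i₂ j : ℕ}, i₁ < i₂ → (i₁, j) ∉ inner → (i₂, j) ∈ outer →
    entry i₁ j < entry i₂ j
  zeros : ∀ {i j : ℕ}, (i, j) ∈ inner ∨ (i, j) ∉ outer → entry i j = 0

/-- An ordinary (straight shape) semistandard tableau, as a skew tableau. -/
def SkewTableau.ofStraight {μ : YoungDiagram} (S : SemistandardYoungTableau μ) : SkewTableau where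
  inner := ⊥
  outer := μ
  inner_le_outer := bot_le
  entry := S
  row_weak := fun h _ h₂ => S.row_weak h h₂
  col_strict := fun h _ h₂ => S.col_strict h h₂
  zeros := fun h => S.zeros (h.resolve_left (YoungDiagram.notMem_bot _))

/-- The number of boxes in column `j` of a skew tableau. -/
def SkewTableau.colLen (T : SkewTableau) (j : ℕ) : ℕ :=
  T.outer.colLen j - T.inner.colLen j

/-- Move the entry of the cell `b` into the (empty) cell `a`; the cell `b` becomes empty. -/
def moveEntry (f : ℕ → ℕ → ℕ) (a b : ℕ × ℕ) : ℕ → ℕ → ℕ := fun i j =>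
  if (i, j) = a then f b.1 b.2 else if (i, j) = b then 0 else f i j

/-- One step of a jeu de taquin slide. The state consists of a filling and the position of the hole.
The smaller of the entries below and to the right of the hole moves into the hole
(the one below in case of equality). -/
inductive HoleMove (outer : YoungDiagram) :
    (ℕ → ℕ → ℕ) × (ℕ × ℕ) → (ℕ → ℕ → ℕ) × (ℕ × ℕ) → Prop
  | below (f : ℕ → ℕ → ℕ) (i j : ℕ) (mem : (i + 1, j) ∈ outer)
      (le : (i, j + 1) ∈ outer → f (i + 1) j ≤ f i (j + 1)) :
      HoleMove outer (f, (i, j)) (moveEntry f (i, j) (i + 1, j), (i + 1, j))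
  | right (f : ℕ → ℕ → ℕ) (i j : ℕ) (mem : (i, j + 1) ∈ outer)
      (lt : (i + 1, j) ∈ outer → f i (j + 1) < f (i + 1) j) :
      HoleMove outer (f, (i, j)) (moveEntry f (i, j) (i, j + 1), (i, j + 1))

/-- `T'` is obtained from `T` by one (inward) jeu de taquin slide: a corner `a` of the inner shape
is taken as the hole, the hole is moved as long as there is an entry below it or to the right of it,
and its final position `b` is removed from the outer shape. -/
def Slide (T T' : SkewTableau) : Prop :=
  ∃ a b : ℕ × ℕ,
    a ∈ T.inner ∧ (a.1 + 1, a.2) ∉ T.inner ∧ (a.1, a.2 + 1) ∉ T.inner ∧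
    Relation.ReflTransGen (HoleMove T.outer) (T.entry, a) (T'.entry, b) ∧
    (b.1 + 1, b.2) ∉ T.outer ∧ (b.1, b.2 + 1) ∉ T.outer ∧
    T'.inner.cells = T.inner.cells.erase a ∧
    T'.outer.cells = T.outer.cells.erase b

/-- `T'` is obtained from `T` by the jeu de taquin process: a finite sequence of inward slides and
of outward slides (the inverses of inward slides). -/
def JeuDeTaquin : SkewTableau → SkewTableau → Prop :=
  Relation.EqvGen Slide

/-! ### The right key (Lascoux and Schützenberger) -/

/-- `T` is one of the skew tableaux that serve to compute column `j` of the right key of `S`: it is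
obtained from `S` by jeu de taquin, and the lengths of its successive columns are those of the
columns of `S` in some order in which the length of column `j` comes last. -/
structure IsFrank {μ : YoungDiagram} (S : SemistandardYoungTableau μ) (j : Fin (μ.rowLen 0))
    (T : SkewTableau) : Prop where
  jdt : JeuDeTaquin (SkewTableau.ofStraight S) T
  perm : ∃ π : Equiv.Perm (Fin (μ.rowLen 0)), ∀ k : Fin (μ.rowLen 0),
    T.colLen k = μ.colLen (π k)
  empty : ∀ k, μ.rowLen 0 ≤ k → T.colLen k = 0
  last : T.colLen (μ.rowLen 0 - 1) = μ.colLen j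

/-- `K` is the right key of `S`: it is a semistandard tableau of the same shape, and its column `j`
is the last column of any skew tableau `T` as in `IsFrank S j T`. That there is such a `T`, and that
the result is the same for all of them, is part of the condition. -/
def IsRightKey {μ : YoungDiagram} (S K : SemistandardYoungTableau μ) : Prop :=
  ∀ j : Fin (μ.rowLen 0), (∃ T, IsFrank S j T) ∧
    ∀ T, IsFrank S j T → ∀ i < μ.colLen j,
      K i j = T.entry (T.inner.colLen (μ.rowLen 0 - 1) + i) (μ.rowLen 0 - 1)

/-- There is at most one right key. -/
theorem IsRightKey.eq {μ : YoungDiagram} {S K K' : SemistandardYoungTableau μ}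
    (h : IsRightKey S K) (h' : IsRightKey S K') : K = K' := by
  ext i j
  by_cases hij : (i, j) ∈ μ
  · have hj : j < μ.rowLen 0 :=
      YoungDiagram.mem_iff_lt_rowLen.1 (μ.up_left_mem (Nat.zero_le i) le_rfl hij)
    have hi : i < μ.colLen j := YoungDiagram.mem_iff_lt_colLen.1 hij
    obtain ⟨⟨T, hT⟩, hK⟩ := h ⟨j, hj⟩
    exact (hK T hT i hi).trans (((h' ⟨j, hj⟩).2 T hT i hi).symm)
  · rw [K.zeros hij, K'.zeros hij]

/-! ### Key tableaux as cosets, and the Bruhat order -/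

/-- `K` is the key tableau of shape `μ` determined by the permutation `σ`: the entries of a column
with `m` boxes are the first `m` values of `σ` (in increasing order, as `K` is semistandard). -/
def IsKeyTableauOf {n : ℕ} {μ : YoungDiagram} (σ : Equiv.Perm (Fin n))
    (K : SemistandardYoungTableau μ) : Prop :=
  ∀ j < μ.rowLen 0, ∀ x : ℕ,
    (∃ i < μ.colLen j, K i j = x) ↔ ∃ k : Fin n, (k : ℕ) < μ.colLen j ∧ (σ k : ℕ) = x

/-- The stabiliser `S_μ` of the composition `i ↦ μ_i`, for the action `(w f) i = f (w⁻¹ i)` of the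
symmetric group on compositions. -/
def partitionStabilizer (n : ℕ) (μ : YoungDiagram) : Subgroup (Equiv.Perm (Fin n)) :=
  letI : MulAction (Equiv.Perm (Fin n)) (Fin n → ℕ) := arrowAction
  MulAction.stabilizer (Equiv.Perm (Fin n)) (fun i : Fin n => μ.rowLen i)

/-- The Bruhat order on the symmetric group: the reflexive and transitive closure of `u < u t` for
transpositions `t = (a b)` such that `u t` has more inversions than `u`, which means that `u a < u b`
when `a < b`. -/
def BruhatLE {n : ℕ} : Equiv.Perm (Fin n) → Equiv.Perm (Fin n) → Prop :=
  Relation.ReflTransGen fun u v => ∃ a b : Fin n, a < b ∧ u a < u b ∧ v = u * Equiv.swap a b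

/-! ### Pushing down and exposing entries -/

/-- A configuration: a partial filling of the cells (row, column); `none` is an empty box. -/
abbrev Config := ℕ → ℕ → Option ℕ

/-- A tableau as a configuration. -/
def initialConfig {μ : YoungDiagram} (S : SemistandardYoungTableau μ) : Config := fun i j =>
  if (i, j) ∈ μ then some (S i j) else none

/-- The column of the nearest entry to the left of column `j` in row `r`. -/
def entryLeftOf (F : Config) (r j : ℕ) : ℕ :=
  Nat.findGreatest (fun k => k < j ∧ (F r k).isSome = true) j

/-- The column of the leftmost entry in row `r` whose value is at least `e`, if there is one; `c` is
the number of columns. -/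
def leftmostGE (c : ℕ) (F : Config) (r e : ℕ) : Option ℕ :=
  (List.range c).find? fun j => (F r j).any fun x => decide (e ≤ x)

/-- Push the entries of row `r` in the columns `j, j + 1, …` one step down. -/
def pushDown (F : Config) (r j : ℕ) : Config := fun a b =>
  if a = r ∧ j ≤ b then none
  else if a = r + 1 ∧ j ≤ b then (F r b).or (F (r + 1) b)
  else F a b

/-- The recursive subroutine: given the position (row and column) of the temporarily exposed entry in
a configuration with `c` columns, it returns the final configuration and the value of the exposed
entry. -/
def expose (c : ℕ) : (row col : ℕ) → Config → Config × ℕ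
  | 0, k, F => (F, (F 0 k).getD 0)
  | r + 1, k, F =>
    match leftmostGE c F r ((F (r + 1) k).getD 0) with
    | none => (F, (F (r + 1) k).getD 0)
    | some j => expose c r (entryLeftOf F r j) (pushDown F r j)

/-- The `i`-th configuration and the value of its exposed entry. In step `i > 0` the first
temporarily exposed entry is the rightmost one in row `i` of the previous configuration. -/
def stage {μ : YoungDiagram} (S : SemistandardYoungTableau μ) : ℕ → Config × ℕ
  | 0 => (initialConfig S, S 0 (μ.rowLen 0 - 1))
  | i + 1 =>
    expose (μ.rowLen 0) (i + 1) (entryLeftOf (stage S i).1 (i + 1) (μ.rowLen 0)) (stage S i).1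

/-- The values of the exposed entries of the successive configurations, one for each row of `S`. -/
def exposedValues {μ : YoungDiagram} (S : SemistandardYoungTableau μ) : List ℕ :=
  (List.range (μ.colLen 0)).map fun i => (stage S i).2

/-- The one-line notation produced by the procedure: the exposed values, followed by the remaining
numbers in increasing order. -/
def procedureWord (n : ℕ) {μ : YoungDiagram} (S : SemistandardYoungTableau μ) : List ℕ :=
  exposedValues S ++ (List.range n).filter fun x => decide (x ∉ exposedValues S)

end RightKey

/-!
The proof compares jeu de taquin with the pushing procedure by means of Knuth equivalence.

*Words.* A skew tableau is read column by column, from left to right, each column from the bottom to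
the top. Slides replace the reading word by a Knuth equivalent one (`JeuDeTaquin.knuth`): vertical
moves of the hole do not change the word, and horizontal moves are instances of
`Knuth.move_between`, which describes when a letter may pass from one column to the adjacent one.
Following Greene, the maximal size of a union of `k` weakly increasing subsequences depends only on
the Knuth class (`Knuth.chains`). Hence a straight tableau is determined by the Knuth class of its
word (`IsStraight.eq`), and since every skew tableau can be rectified, a skew tableau with a word
Knuth equivalent to that of `S` is obtained from `S` by jeu de taquin (`JeuDeTaquin.of_knuth`).

*Uniqueness.* Let `w` be the word of a skew tableau as in the definition of the right key, with last
column `v` of length `m`. The maximal size of a union of `m` weakly increasing subsequences of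
`w (x - 1) ⋯ 1 0` is the sum of a number that depends on `μ` and `m` only and of the number of entries
of `v` that are less than `x` (`IsFrank.isGreatest`). As it depends only on the Knuth class of `w`, so
does `v`.

*Existence.* After the first `m` rows have been treated, the procedure has moved the entries within
their columns to places in these rows such that the following holds (`IsSettled`): if the box below an
entry `x` is empty, then some entry to the left of this box is greater than `x`. It follows that for
each `k` the rightmost entries of the `m` rows in the columns before `k` increase from the top to the
bottom (`IsSettled.lastBefore_lt`), and `Knuth.exchange_columns` applies: a column formed by these
entries can be exchanged with column `k`. Those of them in rows that are empty in column `k` join the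
entries of column `k` on the right, which gives the rightmost entries before column `k + 1`, and the
others remain on the left as a column of the same length as column `k`. So a column of length `m` of
`S` can be moved to the end, where it becomes the column of the row ends of the configuration. The
resulting columns form a skew tableau if each is placed below the next one (`skewTableauOfColumns`).

*The permutation.* In each step the exposed value is inserted into the increasing sequence of the row
ends (`stageEnd_succ`), so the row ends after `m` steps are the first `m` exposed values, which are
distinct, and the key tableau of the procedure is the right key (`isRightKey_procedureKey`). For
adjacent rows of equal length the exposed values increase (`stage_snd_lt`); therefore the permutation
is the one element of its coset that is increasing on each set of rows of the same length. The other
elements are sorted into it by transpositions that go down in the Bruhat order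
(`bruhatLE_of_mem_coset`).
-/

namespace RightKey

/-! ### Knuth equivalence and families of increasing subsequences -/

/-- Knuth (plactic) equivalence of words. -/
inductive Knuth : List ℕ → List ℕ → Prop
  | refl (w : List ℕ) : Knuth w w
  | symm {w w' : List ℕ} : Knuth w w' → Knuth w' w
  | trans {w w' w'' : List ℕ} : Knuth w w' → Knuth w' w'' → Knuth w w''
  | swap_after (p q : List ℕ) {x y z : ℕ} : x < y → y ≤ z →
      Knuth (p ++ y :: x :: z :: q) (p ++ y :: z :: x :: q)
  | swap_before (p q : List ℕ) {x y z : ℕ} : x ≤ y → y < z →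
      Knuth (p ++ x :: z :: y :: q) (p ++ z :: x :: y :: q)

theorem Knuth.append_left {w w' : List ℕ} (h : Knuth w w') (u : List ℕ) :
    Knuth (u ++ w) (u ++ w') := by
  induction h with
  | refl w => exact .refl _
  | symm _ ih => exact ih.symm
  | trans _ _ ih ih' => exact ih.trans ih'
  | swap_after p q h h' => simpa using Knuth.swap_after (u ++ p) q h h'
  | swap_before p q h h' => simpa using Knuth.swap_before (u ++ p) q h h'

theorem Knuth.append_right {w w' : List ℕ} (h : Knuth w w') (u : List ℕ) :
    Knuth (w ++ u) (w' ++ u) := by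
  induction h with
  | refl w => exact .refl _
  | symm _ ih => exact ih.symm
  | trans _ _ ih ih' => exact ih.trans ih'
  | swap_after p q h h' => simpa using Knuth.swap_after p (q ++ u) h h'
  | swap_before p q h h' => simpa using Knuth.swap_before p (q ++ u) h h'

theorem Knuth.cons {w w' : List ℕ} (h : Knuth w w') (a : ℕ) : Knuth (a :: w) (a :: w') :=
  h.append_left [a]

theorem Knuth.of_eq {w w' : List ℕ} (h : w = w') : Knuth w w' := h ▸ .refl w

theorem Knuth.filter_lt {w w' : List ℕ} (h : Knuth w w') (t : ℕ) :
    Knuth (w.filter (· < t)) (w'.filter (· < t)) := by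
  induction h with
  | refl w => exact .refl _
  | symm _ ih => exact ih.symm
  | trans _ _ ih ih' => exact ih.trans ih'
  | @swap_after p q x y z h h' =>
    by_cases hz : z < t
    · have hy : y < t := by omega
      have hx : x < t := by omega
      simpa [hx, hy, hz] using Knuth.swap_after _ _ h h'
    · refine .of_eq ?_
      simp [List.filter_cons, hz]
  | @swap_before p q x y z h h' =>
    by_cases hz : z < t
    · have hy : y < t := by omega
      have hx : x < t := by omega
      simpa [hx, hy, hz] using Knuth.swap_before _ _ h h'
    · refine .of_eq ?_
      simp [List.filter_cons, hz]

/-- `Chains w s t N`: one can select `N` letters of the word `w` and distribute them among `k`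
weakly increasing subsequences, the `i`-th of which continues a sequence with last value `s i`;
the last values afterwards are given by `t`. -/
inductive Chains {k : ℕ} : List ℕ → (Fin k → ℕ) → (Fin k → ℕ) → ℕ → Prop
  | nil (s : Fin k → ℕ) : Chains [] s s 0
  | skip {w : List ℕ} {s t : Fin k → ℕ} {N : ℕ} (a : ℕ) : Chains w s t N → Chains (a :: w) s t N
  | take {w : List ℕ} {s t : Fin k → ℕ} {N : ℕ} (a : ℕ) (i : Fin k) : s i ≤ a →
      Chains w (Function.update s i a) t N → Chains (a :: w) s t (N + 1)

theorem Chains.append {k : ℕ} {u v : List ℕ} {s m t : Fin k → ℕ} {N₁ N₂ : ℕ}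
    (h : Chains u s m N₁) (h' : Chains v m t N₂) : Chains (u ++ v) s t (N₁ + N₂) := by
  induction h with
  | nil s => simpa using h'
  | skip a _ ih => exact .skip a (ih h')
  | take a i hi _ ih =>
    have := Chains.take a i hi (ih h')
    rwa [Nat.add_right_comm] at this

theorem Chains.exists_of_append {k : ℕ} {u v : List ℕ} {s t : Fin k → ℕ} {N : ℕ}
    (h : Chains (u ++ v) s t N) :
    ∃ m N₁ N₂, Chains u s m N₁ ∧ Chains v m t N₂ ∧ N = N₁ + N₂ := by
  induction u generalizing s N with
  | nil => exact ⟨s, 0, N, .nil s, h, by simp⟩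
  | cons a u ih =>
    cases h with
    | skip _ h =>
      obtain ⟨m, N₁, N₂, h₁, h₂, e⟩ := ih h
      exact ⟨m, N₁, N₂, .skip a h₁, h₂, e⟩
    | take _ i hi h =>
      obtain ⟨m, N₁, N₂, h₁, h₂, e⟩ := ih h
      exact ⟨m, N₁ + 1, N₂, .take a i hi h₁, h₂, by omega⟩

theorem Chains.comp_perm {k : ℕ} {w : List ℕ} {s t : Fin k → ℕ} {N : ℕ} (h : Chains w s t N)
    (σ : Equiv.Perm (Fin k)) : Chains w (s ∘ σ) (t ∘ σ) N := by
  induction h with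
  | nil s => exact .nil _
  | skip a _ ih => exact .skip a ih
  | take a i hi _ ih =>
    refine .take a (σ.symm i) (by simpa using hi) ?_
    rwa [Function.update_comp_equiv] at ih

/-- Smaller last values leave more freedom. -/
theorem Chains.mono {k : ℕ} {w : List ℕ} {s t s' : Fin k → ℕ} {N : ℕ} (h : Chains w s t N)
    (hs : s' ≤ s) : ∃ t', Chains w s' t' N := by
  induction h generalizing s' with
  | nil s => exact ⟨s', .nil _⟩
  | skip a _ ih =>
    obtain ⟨t', h⟩ := ih hs
    exact ⟨t', .skip a h⟩
  | take a i hi _ ih =>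
    obtain ⟨t', h⟩ := ih (s' := Function.update s' i a) (update_le_update_iff.2
      ⟨le_rfl, fun j _ => hs j⟩)
    exact ⟨t', .take a i ((hs i).trans hi) h⟩

/-- Two adjacent letters that do not go to the same subsequence may be exchanged. -/
theorem Chains.exchange {k : ℕ} {q : List ℕ} {s t : Fin k → ℕ} {N a b : ℕ}
    (h : Chains (a :: b :: q) s t N) :
    Chains (b :: a :: q) s t N ∨ (a ≤ b ∧ ∃ (i : Fin k) (M : ℕ), s i ≤ a ∧ N = M + 2 ∧
      Chains q (Function.update s i b) t M) := by
  cases h with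
  | skip _ h =>
    cases h with
    | skip _ h => exact .inl (.skip _ (.skip _ h))
    | take _ i hi h => exact .inl (.take _ i hi (.skip _ h))
  | take _ i hi h =>
    cases h with
    | skip _ h => exact .inl (.skip _ (.take _ i hi h))
    | take _ j hj h =>
      by_cases hij : j = i
      · subst hij
        simp only [Function.update_self, Function.update_idem] at hj h
        exact .inr ⟨hj, j, _, hi, rfl, h⟩
      · rw [Function.update_of_ne hij] at hj
        refine .inl (.take _ j hj (.take _ i ?_ ?_))
        · rwa [Function.update_of_ne (Ne.symm hij)]
        · rwa [Function.update_comm hij]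

theorem Chains.swap_after {k : ℕ} {q : List ℕ} {s t : Fin k → ℕ} {N x y z : ℕ}
    (hxy : x < y) (hyz : y ≤ z) (h : Chains (y :: x :: z :: q) s t N) :
    ∃ t', Chains (y :: z :: x :: q) s t' N := by
  cases h with
  | skip _ h =>
    rcases h.exchange with h' | ⟨-, i, M, hi, rfl, h'⟩
    · exact ⟨t, .skip _ h'⟩
    · -- `x` and `z` in the same subsequence, `y` not used: use `y` instead of `x`
      refine ⟨t, .take _ i (by omega) (.take _ i (by simpa using hyz) (.skip _ ?_))⟩
      simpa using h'
  | take _ j hj h =>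
    rcases h.exchange with h₁ | ⟨-, i, M, hi, rfl, h₁⟩
    · exact ⟨t, .take _ j hj h₁⟩
    · have hij : i ≠ j := by
        rintro rfl
        simp at hi
        omega
      rw [Function.update_of_ne hij] at hi
      -- exchange the continuations of the subsequences that contain `y` and `x, z`
      obtain ⟨t', h'⟩ := (h₁.comp_perm (Equiv.swap i j)).mono
        (s' := Function.update (Function.update s j z) i x) (by
          intro a
          rcases eq_or_ne a i with rfl | hai
          · simp [hij.symm, hxy.le]
          · rcases eq_or_ne a j with rfl | haj
            · simp [hai]
            · simp [hai, haj, Equiv.swap_apply_of_ne_of_ne])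
      refine ⟨t', .take _ j hj (.take _ j (by simpa using hyz) (.take _ i ?_ ?_))⟩
      · simpa [hij] using hi
      · simpa using h'

theorem Chains.swap_before {k : ℕ} {q : List ℕ} {s t : Fin k → ℕ} {N x y z : ℕ}
    (hxy : x ≤ y) (hyz : y < z) (h : Chains (x :: z :: y :: q) s t N) :
    ∃ t', Chains (z :: x :: y :: q) s t' N := by
  rcases h.exchange with h₁ | ⟨-, i, M, hi, rfl, h₁⟩
  · exact ⟨t, h₁⟩
  · cases h₁ with
    | skip _ h₂ =>
      -- `x` and `z` in the same subsequence, `y` not used: use `y` instead of `z`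
      obtain ⟨t', h'⟩ := h₂.mono (s' := Function.update s i y)
        (update_le_update_iff.2 ⟨hyz.le, fun _ _ => le_rfl⟩)
      refine ⟨t', .skip _ (.take _ i hi (.take _ i (by simpa using hxy) ?_))⟩
      simpa using h'
    | take _ j hj h₂ =>
      have hij : j ≠ i := by
        rintro rfl
        simp at hj
        omega
      rw [Function.update_of_ne hij] at hj
      refine ⟨t ∘ Equiv.swap i j, .take _ j (by omega) (.take _ i ?_ (.take _ i (by simpa using hxy)
        ?_))⟩
      · simpa [hij.symm] using hi
      · have := h₂.comp_perm (Equiv.swap i j)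
        convert this using 1
        ext a
        rcases eq_or_ne a i with rfl | hai
        · simp
        · rcases eq_or_ne a j with rfl | haj
          · simp [hai, hij.symm]
          · simp [hai, haj, Equiv.swap_apply_of_ne_of_ne]

/-- Greene: the sizes of unions of `k` weakly increasing subsequences depend only on the Knuth
class. -/
theorem Knuth.chains {w w' : List ℕ} (h : Knuth w w') {k : ℕ} (s : Fin k → ℕ) (N : ℕ) :
    (∃ t, Chains w s t N) ↔ ∃ t, Chains w' s t N := by
  induction h with
  | refl w => rfl
  | symm _ ih => exact ih.symm
  | trans _ _ ih ih' => exact ih.trans ih'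
  | swap_after p q hxy hyz =>
    constructor
    · rintro ⟨t, h⟩
      obtain ⟨m, N₁, N₂, h₁, h₂, rfl⟩ := h.exists_of_append
      obtain ⟨t', h'⟩ := h₂.swap_after hxy hyz
      exact ⟨t', h₁.append h'⟩
    · rintro ⟨t, h⟩
      obtain ⟨m, N₁, N₂, h₁, h₂, rfl⟩ := h.exists_of_append
      refine ⟨t, h₁.append ?_⟩
      cases h₂ with
      | skip _ h₂ => exact .skip _ (h₂.exchange.resolve_right (by rintro ⟨h, -⟩; omega))
      | take _ i hi h₂ => exact .take _ i hi (h₂.exchange.resolve_right (by rintro ⟨h, -⟩; omega))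
  | swap_before p q hxy hyz =>
    constructor
    · rintro ⟨t, h⟩
      obtain ⟨m, N₁, N₂, h₁, h₂, rfl⟩ := h.exists_of_append
      obtain ⟨t', h'⟩ := h₂.swap_before hxy hyz
      exact ⟨t', h₁.append h'⟩
    · rintro ⟨t, h⟩
      obtain ⟨m, N₁, N₂, h₁, h₂, rfl⟩ := h.exists_of_append
      exact ⟨t, h₁.append (h₂.exchange.resolve_right (by rintro ⟨h, -⟩; omega))⟩

/-- Each subsequence takes at most one letter of a strictly decreasing word. -/
theorem Chains.exists_finset {k : ℕ} {w : List ℕ} {s t : Fin k → ℕ} {N : ℕ} (h : Chains w s t N)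
    (hw : w.Pairwise (· > ·)) : ∃ I : Finset (Fin k), I.card = N ∧ (∀ i ∉ I, t i = s i) ∧
      (∀ i ∈ I, s i ≤ t i ∧ t i ∈ w) ∧ Set.InjOn t I := by
  induction h with
  | nil s => exact ⟨∅, by simp⟩
  | skip a _ ih =>
    obtain ⟨I, h₁, h₂, h₃, h₄⟩ := ih hw.of_cons
    exact ⟨I, h₁, h₂, fun i hi => ⟨(h₃ i hi).1, .tail _ (h₃ i hi).2⟩, h₄⟩
  | @take w s t N a i hi _ ih =>
    obtain ⟨I, h₁, h₂, h₃, h₄⟩ := ih hw.of_cons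
    have hlt : ∀ b ∈ w, b < a := fun b hb => List.rel_of_pairwise_cons hw hb
    have hiI : i ∉ I := fun hmem => by
      have h := h₃ i hmem
      have := hlt _ h.2
      simp at h
      omega
    have hti : t i = a := by simpa using h₂ i hiI
    refine ⟨insert i I, by rw [Finset.card_insert_of_notMem hiI, h₁], ?_, ?_, ?_⟩
    · intro j hj
      rw [Finset.mem_insert, not_or] at hj
      rw [h₂ j hj.2, Function.update_of_ne hj.1]
    · intro j hj
      rcases Finset.mem_insert.1 hj with rfl | hj
      · exact ⟨hti ▸ hi, hti ▸ .head _⟩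
      · have hji : j ≠ i := fun h => hiI (h ▸ hj)
        have := h₃ j hj
        rw [Function.update_of_ne hji] at this
        exact ⟨this.1, .tail _ this.2⟩
    · rw [Finset.coe_insert, Set.injOn_insert (by simpa using hiI)]
      refine ⟨h₄, ?_⟩
      rintro ⟨j, hj, hji⟩
      have := hlt _ (h₃ j hj).2
      omega

/-! ### Moving letters between two adjacent columns -/

theorem Knuth.move_left {a b : ℕ} {D : List ℕ} (hD : (a :: D).Pairwise (· > ·)) (hab : a ≤ b) :
    Knuth (a :: (D ++ [b])) (a :: b :: D) := by
  induction D generalizing a with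
  | nil => exact .refl _
  | cons d D ih =>
    have hd : d < a := List.rel_of_pairwise_cons hD (.head _)
    exact ((ih hD.of_cons (by omega)).cons a).trans (.swap_after [] D hd hab)

theorem Knuth.move_right {a b : ℕ} {D : List ℕ} (hD : (D ++ [b]).Pairwise (· > ·)) (hab : a ≤ b) :
    Knuth (a :: (D ++ [b])) (D ++ [a, b]) := by
  induction D with
  | nil => exact .refl _
  | cons d D ih =>
    refine .trans ?_ ((ih hD.of_cons).cons d)
    have hlt : ∀ e ∈ D ++ [b], e < d := fun e he => List.rel_of_pairwise_cons hD he
    have hpw := hD.of_cons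
    cases D with
    | nil => exact .swap_before [] [] hab (hlt b (by simp))
    | cons e D =>
      have hbe : b < e := List.rel_of_pairwise_cons (l := D ++ [b]) hpw (by simp)
      exact .swap_before [] (D ++ [b]) (by omega) (hlt e (by simp))

/-- Here `L` lists the rows of a pair of columns, from the bottom to the top. If each entry of the
right column has a left neighbour, the right column can be read before a word `Y` that continues the
left column. -/
theorem Knuth.columns_append {L : List (Option ℕ × Option ℕ)} {Y : List ℕ}
    (hL : ∀ p ∈ L, ∀ b ∈ p.2, ∃ a ∈ p.1, a ≤ b)
    (hY : (L.filterMap Prod.fst ++ Y).Pairwise (· > ·)) :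
    Knuth (L.filterMap Prod.fst ++ Y ++ L.filterMap Prod.snd)
      (L.filterMap Prod.fst ++ L.filterMap Prod.snd ++ Y) := by
  induction L with
  | nil => simpa using Knuth.refl Y
  | cons p L ih =>
    have hL' : ∀ p ∈ L, ∀ b ∈ p.2, ∃ a ∈ p.1, a ≤ b := fun q hq => hL q (.tail _ hq)
    have hp := hL p (.head _)
    obtain ⟨oa, ob⟩ := p
    rcases ob with _ | b
    · rcases oa with _ | a
      · exact ih hL' hY
      · exact (ih hL' (List.Pairwise.of_cons (by simpa using hY))).cons a
    · obtain ⟨a, rfl, hab⟩ := hp b rfl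
      have hY' : (a :: (L.filterMap Prod.fst ++ Y)).Pairwise (· > ·) := by simpa using hY
      have h₁ := (Knuth.move_left hY' hab).append_right (L.filterMap Prod.snd)
      have h₂ := ((ih hL' hY'.of_cons).cons b).cons a
      have hA : (a :: L.filterMap Prod.fst).Pairwise (· > ·) :=
        hY'.sublist ((List.sublist_append_left _ _).cons_cons a)
      have h₃ := (Knuth.move_left hA hab).symm.append_right (L.filterMap Prod.snd ++ Y)
      simpa using h₁.trans ((by simpa using h₂ : Knuth _ _).trans (by simpa using h₃))

/-- The dual statement: if each entry of the left column has a right neighbour, a larger letter in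
front of the left column may be moved to the front of the right column. -/
theorem Knuth.cons_columns {L : List (Option ℕ × Option ℕ)} {y : ℕ}
    (hL : ∀ p ∈ L, ∀ a ∈ p.1, ∃ b ∈ p.2, a ≤ b)
    (hy : (y :: L.filterMap Prod.snd).Pairwise (· > ·)) :
    Knuth (y :: (L.filterMap Prod.fst ++ L.filterMap Prod.snd))
      (L.filterMap Prod.fst ++ y :: L.filterMap Prod.snd) := by
  induction L using List.reverseRecOn with
  | nil => exact .refl _
  | append_singleton L p ih =>
    have hL' : ∀ p ∈ L, ∀ a ∈ p.1, ∃ b ∈ p.2, a ≤ b := fun q hq => hL q (by simp [hq])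
    have hp := hL p (by simp)
    have hy' : (y :: L.filterMap Prod.snd).Pairwise (· > ·) := by
      refine hy.sublist (List.Sublist.cons_cons _ ?_)
      rw [List.filterMap_append]
      exact List.sublist_append_left _ _
    obtain ⟨oa, ob⟩ := p
    rcases oa with _ | a
    · rcases ob with _ | b
      · simpa using ih hL' hy'
      · simpa using (ih hL' hy').append_right [b]
    · obtain ⟨b, rfl, hab⟩ := hp a rfl
      have hD : (y :: L.filterMap Prod.snd ++ [b]).Pairwise (· > ·) := by simpa using hy
      have h₁ := (Knuth.move_right hD.of_cons hab).append_left (y :: L.filterMap Prod.fst)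
      have h₂ := (ih hL' hy').append_right [a, b]
      have h₃ := (Knuth.move_right hD hab).symm.append_left (L.filterMap Prod.fst)
      simp only [List.cons_append, List.append_assoc, List.filterMap_append] at h₁ h₂ h₃ ⊢
      exact h₁.trans (h₂.trans h₃)

/-- A pair of columns, of which `L₁` lists the rows below a certain one, and `L₂` the rows above it,
from the bottom to the top. The letter `y` in the row in between can be moved from the left column
to the right one. -/
theorem Knuth.move_between {L₁ L₂ : List (Option ℕ × Option ℕ)} {y : ℕ}
    (h₁ : ∀ p ∈ L₁, ∀ b ∈ p.2, ∃ a ∈ p.1, a ≤ b)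
    (h₂ : ∀ p ∈ L₂, ∀ a ∈ p.1, ∃ b ∈ p.2, a ≤ b)
    (hA : (L₁.filterMap Prod.fst ++ y :: L₂.filterMap Prod.fst).Pairwise (· > ·))
    (hB : (y :: L₂.filterMap Prod.snd).Pairwise (· > ·)) :
    Knuth (L₁.filterMap Prod.fst ++ y :: L₂.filterMap Prod.fst ++
        (L₁.filterMap Prod.snd ++ L₂.filterMap Prod.snd))
      (L₁.filterMap Prod.fst ++ L₂.filterMap Prod.fst ++
        (L₁.filterMap Prod.snd ++ y :: L₂.filterMap Prod.snd)) := by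
  have e₁ := (Knuth.columns_append h₁ hA).append_right (L₂.filterMap Prod.snd)
  have e₂ := (Knuth.cons_columns h₂ hB).append_left
    (L₁.filterMap Prod.fst ++ L₁.filterMap Prod.snd)
  have e₃ := (Knuth.columns_append h₁ (hA.sublist
    ((List.sublist_cons_self _ _).append_left _))).symm.append_right (y :: L₂.filterMap Prod.snd)
  simp only [List.cons_append, List.append_assoc] at e₁ e₂ e₃ ⊢
  exact e₁.trans (e₂.trans e₃)

/-- Exchanging the lengths of two columns. The rows in `l`, listed from the bottom to the top, have
the entries `a r` in a left column and, for some of them, the entries `b r` in a right column. The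
letters `a r` in the rows without an entry in the right column are moved to that column. -/
theorem Knuth.exchange_columns (l : List ℕ) (a : ℕ → ℕ) (b : ℕ → Option ℕ)
    (ha : (l.map a).Pairwise (· > ·)) (hb : (l.map fun r => (b r).getD (a r)).Pairwise (· > ·))
    (hab : ∀ r ∈ l, ∀ x ∈ b r, a r ≤ x) :
    Knuth (l.map a ++ l.filterMap b)
      (l.filterMap (fun r => (b r).map fun _ => a r) ++ l.map fun r => (b r).getD (a r)) := by
  suffices H : ∀ l₁ l₂ : List ℕ, l = l₁ ++ l₂ →
      Knuth (l₁.map a ++ l₂.filterMap (fun r => (b r).map fun _ => a r) ++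
        (l₁.filterMap b ++ l₂.map fun r => (b r).getD (a r)))
      (l.filterMap (fun r => (b r).map fun _ => a r) ++ l.map fun r => (b r).getD (a r)) by
    simpa using H l [] (by simp)
  intro l₁
  induction l₁ using List.reverseRecOn with
  | nil =>
    rintro l₂ rfl
    exact .of_eq (by simp)
  | append_singleton l₁ t ih =>
    intro l₂ hl
    have IH := ih (t :: l₂) (by simpa using hl)
    refine .trans ?_ IH
    rcases hbt : b t with _ | x
    · have key := Knuth.move_between (L₁ := l₁.map fun r => (some (a r), b r))
        (L₂ := l₂.map fun r => ((b r).map fun _ => a r, some ((b r).getD (a r)))) (y := a t)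
        (by
          simp only [List.mem_map]
          rintro _ ⟨r, hr, rfl⟩ x hx
          exact ⟨a r, rfl, hab r (by simp [hl, hr]) x hx⟩)
        (by
          simp only [List.mem_map]
          rintro _ ⟨r, hr, rfl⟩ x hx
          simp only [Option.mem_def, Option.map_eq_some_iff] at hx
          obtain ⟨z, hz, rfl⟩ := hx
          exact ⟨z, by simp [hz], hab r (by simp [hl, hr]) z hz⟩)
        (by
          refine ha.sublist ?_
          rw [hl]
          simp only [List.filterMap_map, List.map_append, List.append_assoc, List.map_cons,
            Function.comp_def, List.singleton_append]
          refine List.Sublist.append ?_ (List.Sublist.cons_cons _ ?_)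
          · rw [← List.filterMap_eq_map]
            exact List.Sublist.refl _
          · rw [← List.filterMap_eq_map]
            clear IH hl
            induction l₂ with
            | nil => simp
            | cons r l₂ ih' =>
              rcases hr : b r with _ | z
              · simpa [hr] using ih'.cons _
              · simpa [hr] using ih')
        (by
          refine hb.sublist ?_
          rw [hl]
          simp only [List.filterMap_map, List.map_append, List.append_assoc, List.map_cons,
            Function.comp_def, List.singleton_append, hbt, Option.getD_none]
          refine List.sublist_append_of_sublist_right (List.Sublist.cons_cons _ ?_)
          rw [← List.filterMap_eq_map]
          exact List.Sublist.refl _)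
      simp only [List.filterMap_map, Function.comp_def] at key
      rw [show (fun x => some (a x)) = some ∘ a from rfl, List.filterMap_eq_map,
        show (fun r => some ((b r).getD (a r))) = some ∘ fun r => (b r).getD (a r) from rfl,
        List.filterMap_eq_map] at key
      simpa [hbt] using key
    · exact .of_eq (by simp [hbt])

/-! ### Reading words of configurations -/

/-- The entries of column `j` in the rows `0, …, R - 1`, read from the bottom to the top. -/
def colWord (R : ℕ) (F : Config) (j : ℕ) : List ℕ :=
  (List.range R).reverse.filterMap fun r => F r j

/-- The column reading word of the rows `0, …, R - 1` and the columns `0, …, C - 1`: the columns are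
read from left to right, each from the bottom to the top. -/
def readingWord (R C : ℕ) (F : Config) : List ℕ :=
  (List.range C).flatMap (colWord R F)

theorem range_reverse_split {R i : ℕ} (h : i < R) : (List.range R).reverse =
    ((List.range (R - (i + 1))).map (i + 1 + ·)).reverse ++ i :: (List.range i).reverse := by
  obtain ⟨d, rfl⟩ : ∃ d, R = i + 1 + d := ⟨R - (i + 1), by omega⟩
  rw [List.range_add, List.reverse_append, List.range_succ, List.reverse_append,
    Nat.add_sub_cancel_left]
  rfl

/-- The rows below row `i`, from the bottom to the top. -/
def rowsBelow (R i : ℕ) : List ℕ := ((List.range (R - (i + 1))).map (i + 1 + ·)).reverse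

theorem mem_rowsBelow {R i r : ℕ} (h : r ∈ rowsBelow R i) : i < r ∧ r < R := by
  simp only [rowsBelow, List.mem_reverse, List.mem_map, List.mem_range] at h
  omega

theorem colWord_split {R i : ℕ} (h : i < R) (F : Config) (j : ℕ) :
    colWord R F j = (rowsBelow R i).filterMap (fun r => F r j) ++ (F i j).toList ++
      (List.range i).reverse.filterMap fun r => F r j := by
  rw [colWord, range_reverse_split h, rowsBelow]
  rcases hF : F i j with _ | x <;> simp [hF]

theorem colWord_congr {R : ℕ} {F G : Config} {j : ℕ} (h : ∀ r < R, F r j = G r j) :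
    colWord R F j = colWord R G j :=
  List.filterMap_congr fun r hr => h r (by simpa using hr)

theorem colWord_of_le {R R' : ℕ} (hR : R ≤ R') {F : Config} {j : ℕ}
    (h : ∀ r, R ≤ r → F r j = none) : colWord R' F j = colWord R F j := by
  obtain ⟨d, rfl⟩ := Nat.exists_eq_add_of_le hR
  rw [colWord, List.range_add, List.reverse_append, List.filterMap_append, colWord]
  have : List.filterMap (fun r => F r j) ((List.range d).map (R + ·)).reverse = [] := by
    rw [List.filterMap_eq_nil_iff]
    simp only [List.mem_reverse, List.mem_map]
    rintro _ ⟨a, -, rfl⟩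
    exact h _ (by omega)
  rw [this, List.nil_append]

theorem colWord_eq_nil {R : ℕ} {F : Config} {j : ℕ} (h : ∀ r < R, F r j = none) :
    colWord R F j = [] := by
  rw [colWord, List.filterMap_eq_nil_iff]
  exact fun r hr => h r (by simpa using hr)

theorem mem_colWord {R : ℕ} {F : Config} {j x : ℕ} :
    x ∈ colWord R F j ↔ ∃ r < R, F r j = some x := by
  simp [colWord]

theorem readingWord_of_le {R R' C C' : ℕ} (hR : R ≤ R') (hC : C ≤ C') {F : Config}
    (h : ∀ r j, R ≤ r → F r j = none) (h' : ∀ r j, C ≤ j → F r j = none) :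
    readingWord R' C' F = readingWord R C F := by
  obtain ⟨d, rfl⟩ := Nat.exists_eq_add_of_le hC
  rw [readingWord, List.range_add, List.flatMap_append, readingWord]
  have : List.flatMap (colWord R' F) ((List.range d).map (C + ·)) = [] := by
    rw [List.flatMap_eq_nil_iff]
    simp only [List.mem_map]
    rintro _ ⟨a, -, rfl⟩
    exact colWord_eq_nil fun r _ => h' _ _ (by omega)
  rw [this, List.append_nil]
  exact List.flatMap_congr fun j _ => colWord_of_le hR fun r hr => h r j hr

theorem readingWord_congr_column {R C j : ℕ} {F G : Config}
    (h : colWord R F j = colWord R G j) (h' : ∀ r k, k ≠ j → F r k = G r k) :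
    readingWord R C F = readingWord R C G := by
  refine List.flatMap_congr fun k _ => ?_
  rcases eq_or_ne k j with rfl | hk
  · exact h
  · exact colWord_congr fun r _ => h' r k hk

theorem flatMap_range_split {C j : ℕ} (hj : j + 1 < C) (u : ℕ → List ℕ) :
    (List.range C).flatMap u = (List.range j).flatMap u ++ (u j ++ u (j + 1)) ++
      ((List.range (C - (j + 2))).map (j + 2 + ·)).flatMap u := by
  obtain ⟨d, rfl⟩ : ∃ d, C = j + 2 + d := ⟨C - (j + 2), by omega⟩
  rw [List.range_add, List.range_succ, List.range_succ, Nat.add_sub_cancel_left]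
  simp

/-- Two adjacent columns of a word that is a product of columns may be replaced by Knuth equivalent
ones. -/
theorem Knuth.flatMap_of_adjacent {C j : ℕ} (hj : j + 1 < C) {u v : ℕ → List ℕ}
    (h : Knuth (u j ++ u (j + 1)) (v j ++ v (j + 1)))
    (h' : ∀ k, k ≠ j → k ≠ j + 1 → u k = v k) :
    Knuth ((List.range C).flatMap u) ((List.range C).flatMap v) := by
  rw [flatMap_range_split hj, flatMap_range_split hj]
  have e₁ : (List.range j).flatMap u = (List.range j).flatMap v := by
    refine List.flatMap_congr fun k hk => h' k ?_ ?_ <;>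
    · have := List.mem_range.1 hk
      omega
  have e₂ : ((List.range (C - (j + 2))).map (j + 2 + ·)).flatMap u =
      ((List.range (C - (j + 2))).map (j + 2 + ·)).flatMap v := by
    refine List.flatMap_congr fun k hk => h' k ?_ ?_ <;>
    · obtain ⟨a, -, rfl⟩ := List.mem_map.1 hk
      omega
  rw [e₁, e₂]
  exact (h.append_left _).append_right _

/-- A column with entries strictly increasing from the top to the bottom is a decreasing word. -/
theorem colWord_pairwise {R : ℕ} {F : Config} {j : ℕ}
    (h : ∀ {r r' x y}, r < r' → F r j = some x → F r' j = some y → x < y) :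
    (colWord R F j).Pairwise (· > ·) := by
  rw [colWord, List.pairwise_filterMap, List.pairwise_reverse]
  exact (List.pairwise_lt_range).imp fun {a b} hab x hx y hy => h hab hy hx

/-! ### Jeu de taquin slides and Knuth equivalence -/

/-- The configuration with the entries of `f` in the cells of `outer` that belong neither to `inner`
nor are equal to the hole `h`. -/
def holeConfig (inner outer : Finset (ℕ × ℕ)) (f : ℕ → ℕ → ℕ) (h : ℕ × ℕ) : Config := fun i j =>
  if (i, j) ∈ outer ∧ (i, j) ∉ inner ∧ (i, j) ≠ h then some (f i j) else none

/-- Rows increase weakly and columns increase strictly. Empty boxes are ignored. -/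
structure IsOrdered (F : Config) : Prop where
  row : ∀ {r a b x y}, a < b → F r a = some x → F r b = some y → x ≤ y
  col : ∀ {r r' a x y}, r < r' → F r a = some x → F r' a = some y → x < y

/-- A tableau of skew shape `outer / inner` with a hole, during a jeu de taquin slide. The diagrams
`inner` and `outer` are sets of cells, as the cell in which the slide starts has to be removed from
`inner` beforehand. -/
structure IsHoleTableau (inner outer : Finset (ℕ × ℕ)) (f : ℕ → ℕ → ℕ) (h : ℕ × ℕ) : Prop where
  lower_inner : IsLowerSet (inner : Set (ℕ × ℕ))
  lower_outer : IsLowerSet (outer : Set (ℕ × ℕ))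
  hole_mem : h ∈ outer
  hole_notMem : h ∉ inner
  ordered : IsOrdered (holeConfig inner outer f h)
  zero : ∀ {i j}, (i, j) ∈ inner ∨ (i, j) ∉ outer ∨ (i, j) = h → f i j = 0

theorem holeConfig_eq_some {inner outer : Finset (ℕ × ℕ)} {f : ℕ → ℕ → ℕ} {h : ℕ × ℕ}
    {i j x : ℕ} : holeConfig inner outer f h i j = some x ↔
      ((i, j) ∈ outer ∧ (i, j) ∉ inner ∧ (i, j) ≠ h) ∧ f i j = x := by
  simp [holeConfig]

theorem mem_of_le {s : Finset (ℕ × ℕ)} (hs : IsLowerSet (s : Set (ℕ × ℕ)))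
    {i j i' j' : ℕ} (h : (i', j') ∈ s) (hi : i ≤ i') (hj : j ≤ j') : (i, j) ∈ s :=
  hs (show ((i, j) : ℕ × ℕ) ≤ (i', j') from ⟨hi, hj⟩) h

theorem holeConfig_moveEntry {inner outer : Finset (ℕ × ℕ)} {f : ℕ → ℕ → ℕ} {p q : ℕ × ℕ}
    (hp : p ∈ outer) (hp' : p ∉ inner) (hpq : p ≠ q) (r c : ℕ) :
    holeConfig inner outer (moveEntry f p q) q r c =
      if (r, c) = p then some (f q.1 q.2) else if (r, c) = q then none
      else holeConfig inner outer f p r c := by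
  simp only [holeConfig, moveEntry]
  by_cases h₁ : (r, c) = p
  · subst h₁
    simp [hp, hp', hpq]
  · by_cases h₂ : (r, c) = q
    · simp [h₂, hpq.symm]
    · simp [h₁, h₂]

theorem rowsBelow_eq {R i : ℕ} (h : i + 1 < R) :
    rowsBelow R i = rowsBelow R (i + 1) ++ [i + 1] := by
  obtain ⟨d, rfl⟩ : ∃ d, R = i + 2 + d := ⟨R - (i + 2), by omega⟩
  rw [rowsBelow, rowsBelow, show i + 2 + d - (i + 1) = d + 1 by omega,
    show i + 2 + d - (i + 1 + 1) = d by omega, List.range_succ_eq_map]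
  simp only [List.map_cons, List.map_map, List.reverse_cons, add_zero]
  congr 3
  ext a
  simp only [Function.comp_apply]
  omega

section HoleMove

variable {inner outer : Finset (ℕ × ℕ)} {f : ℕ → ℕ → ℕ} {i j : ℕ}

theorem IsHoleTableau.move_below (h : IsHoleTableau inner outer f (i, j))
    (mem : (i + 1, j) ∈ outer) (le : (i, j + 1) ∈ outer → f (i + 1) j ≤ f i (j + 1)) :
    IsHoleTableau inner outer (moveEntry f (i, j) (i + 1, j)) (i + 1, j) := by
  have hin : ∀ {r c}, i ≤ r → j ≤ c → (r, c) ∉ inner := fun hr hc hmem =>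
    h.hole_notMem (mem_of_le h.lower_inner hmem hr hc)
  have hz : holeConfig inner outer f (i, j) (i + 1) j = some (f (i + 1) j) :=
    holeConfig_eq_some.2 ⟨⟨mem, hin (by omega) le_rfl, by simp⟩, rfl⟩
  have hG := holeConfig_moveEntry (f := f) (q := (i + 1, j)) h.hole_mem h.hole_notMem (by simp)
  refine ⟨h.lower_inner, h.lower_outer, mem, hin (by omega) le_rfl, ⟨?_, ?_⟩, ?_⟩
  · intro r a b x y hab hx hy
    rw [hG] at hx hy
    split_ifs at hx hy with h₁ h₂ h₃ h₄ h₅ h₆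
    · simp_all
    · simp only [Prod.mk.injEq] at h₁
      obtain ⟨rfl, rfl⟩ := h₁
      simp only [Option.some.injEq] at hx
      obtain ⟨⟨hb, -⟩, -⟩ := holeConfig_eq_some.1 hy
      have hmem : (r, a + 1) ∈ outer := mem_of_le h.lower_outer hb le_rfl hab
      have hw : holeConfig inner outer f (r, a) r (a + 1) = some (f r (a + 1)) :=
        holeConfig_eq_some.2 ⟨⟨hmem, hin le_rfl (by omega), by simp⟩, rfl⟩
      have hle := le hmem
      rcases (Nat.succ_le_of_lt hab).eq_or_lt with rfl | hlt
      · rw [Nat.succ_eq_add_one] at hy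
        rw [hw] at hy
        simp at hy
        omega
      · have := h.ordered.row hlt hw hy
        omega
    · simp only [Prod.mk.injEq] at h₅
      obtain ⟨rfl, rfl⟩ := h₅
      simp only [Option.some.injEq] at hy
      obtain ⟨⟨hb, hb', -⟩, -⟩ := holeConfig_eq_some.1 hx
      have hw : holeConfig inner outer f (r, b) (r + 1) a = some (f (r + 1) a) :=
        holeConfig_eq_some.2 ⟨⟨mem_of_le h.lower_outer mem le_rfl hab.le,
          fun hm => hb' (mem_of_le h.lower_inner hm (by omega) le_rfl), by simp⟩, rfl⟩
      have h₁ := h.ordered.col (Nat.lt_succ_self r) hx hw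
      have h₂ := h.ordered.row hab hw hz
      omega
    · exact h.ordered.row hab hx hy
  · intro r r' a x y hr hx hy
    rw [hG] at hx hy
    split_ifs at hx hy with h₁ h₂ h₃ h₄ h₅ h₆
    · simp_all
    · simp only [Prod.mk.injEq] at h₁ h₃
      obtain ⟨rfl, rfl⟩ := h₁
      simp only [Option.some.injEq] at hx
      have := h.ordered.col (r := r + 1) (by omega) hz hy
      omega
    · simp only [Prod.mk.injEq] at h₅
      obtain ⟨rfl, rfl⟩ := h₅
      simp only [Option.some.injEq] at hy
      have := h.ordered.col (by omega) hx hz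
      omega
    · exact h.ordered.col hr hx hy
  · intro r c hrc
    simp only [moveEntry]
    split_ifs with h₁ h₂
    · rw [h₁] at hrc
      simp [h.hole_mem, h.hole_notMem] at hrc
    · rfl
    · rcases hrc with hrc | hrc | hrc
      · exact h.zero (.inl hrc)
      · exact h.zero (.inr (.inl hrc))
      · exact absurd hrc h₂

theorem IsHoleTableau.move_right (h : IsHoleTableau inner outer f (i, j))
    (mem : (i, j + 1) ∈ outer) (lt : (i + 1, j) ∈ outer → f i (j + 1) < f (i + 1) j) :
    IsHoleTableau inner outer (moveEntry f (i, j) (i, j + 1)) (i, j + 1) := by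
  have hin : ∀ {r c}, i ≤ r → j ≤ c → (r, c) ∉ inner := fun hr hc hmem =>
    h.hole_notMem (mem_of_le h.lower_inner hmem hr hc)
  have hz : holeConfig inner outer f (i, j) i (j + 1) = some (f i (j + 1)) :=
    holeConfig_eq_some.2 ⟨⟨mem, hin le_rfl (by omega), by simp⟩, rfl⟩
  have hG := holeConfig_moveEntry (f := f) (q := (i, j + 1)) h.hole_mem h.hole_notMem (by simp)
  refine ⟨h.lower_inner, h.lower_outer, mem, hin le_rfl (by omega), ⟨?_, ?_⟩, ?_⟩
  · intro r a b x y hab hx hy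
    rw [hG] at hx hy
    split_ifs at hx hy with h₁ h₂ h₃ h₄ h₅ h₆
    · simp_all
    · simp only [Prod.mk.injEq] at h₁ h₃
      obtain ⟨rfl, rfl⟩ := h₁
      simp only [Option.some.injEq] at hx
      have := h.ordered.row (a := a + 1) (by omega) hz hy
      omega
    · simp only [Prod.mk.injEq] at h₅
      obtain ⟨rfl, rfl⟩ := h₅
      simp only [Option.some.injEq] at hy
      have := h.ordered.row (by omega) hx hz
      omega
    · exact h.ordered.row hab hx hy
  · intro r r' a x y hr hx hy
    rw [hG] at hx hy
    split_ifs at hx hy with h₁ h₂ h₃ h₄ h₅ h₆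
    · simp_all
    · simp only [Prod.mk.injEq] at h₁
      obtain ⟨rfl, rfl⟩ := h₁
      simp only [Option.some.injEq] at hx
      obtain ⟨⟨hb, -⟩, -⟩ := holeConfig_eq_some.1 hy
      have hmem : (r + 1, a) ∈ outer := mem_of_le h.lower_outer hb hr le_rfl
      have hw : holeConfig inner outer f (r, a) (r + 1) a = some (f (r + 1) a) :=
        holeConfig_eq_some.2 ⟨⟨hmem, hin (by omega) le_rfl, by simp⟩, rfl⟩
      have hlt := lt hmem
      rcases (Nat.succ_le_of_lt hr).eq_or_lt with rfl | hlt'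
      · rw [Nat.succ_eq_add_one] at hy
        rw [hw] at hy
        simp at hy
        omega
      · have := h.ordered.col hlt' hw hy
        omega
    · simp only [Prod.mk.injEq] at h₅
      obtain ⟨rfl, rfl⟩ := h₅
      simp only [Option.some.injEq] at hy
      obtain ⟨⟨hb, hb', -⟩, -⟩ := holeConfig_eq_some.1 hx
      have hw : holeConfig inner outer f (r', a) r (a + 1) = some (f r (a + 1)) :=
        holeConfig_eq_some.2 ⟨⟨mem_of_le h.lower_outer mem hr.le le_rfl,
          fun hm => hb' (mem_of_le h.lower_inner hm le_rfl (by omega)), by simp⟩, rfl⟩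
      have h₁ := h.ordered.row (Nat.lt_succ_self a) hx hw
      have h₂ := h.ordered.col hr hw hz
      omega
    · exact h.ordered.col hr hx hy
  · intro r c hrc
    simp only [moveEntry]
    split_ifs with h₁ h₂
    · rw [h₁] at hrc
      simp [h.hole_mem, h.hole_notMem] at hrc
    · rfl
    · rcases hrc with hrc | hrc | hrc
      · exact h.zero (.inl hrc)
      · exact h.zero (.inr (.inl hrc))
      · exact absurd hrc h₂

/-- A vertical move does not change the reading word. -/
theorem IsHoleTableau.readingWord_below (h : IsHoleTableau inner outer f (i, j)) {R C : ℕ}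
    (hR : i + 1 < R) (mem : (i + 1, j) ∈ outer) :
    readingWord R C (holeConfig inner outer f (i, j)) =
      readingWord R C (holeConfig inner outer (moveEntry f (i, j) (i + 1, j)) (i + 1, j)) := by
  have hin : ∀ {r c}, i ≤ r → j ≤ c → (r, c) ∉ inner := fun hr hc hmem =>
    h.hole_notMem (mem_of_le h.lower_inner hmem hr hc)
  have hz : holeConfig inner outer f (i, j) (i + 1) j = some (f (i + 1) j) :=
    holeConfig_eq_some.2 ⟨⟨mem, hin (by omega) le_rfl, by simp⟩, rfl⟩
  have h₀ : holeConfig inner outer f (i, j) i j = none := by simp [holeConfig]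
  have hG := holeConfig_moveEntry (f := f) (q := (i + 1, j)) h.hole_mem h.hole_notMem (by simp)
  refine readingWord_congr_column (j := j) ?_ ?_
  · rw [colWord_split (show i < R by omega), colWord_split (show i < R by omega), rowsBelow_eq hR,
      List.filterMap_append, List.filterMap_append]
    have e₁ : (rowsBelow R (i + 1)).filterMap (fun r => holeConfig inner outer f (i, j) r j) =
        (rowsBelow R (i + 1)).filterMap (fun r =>
          holeConfig inner outer (moveEntry f (i, j) (i + 1, j)) (i + 1, j) r j) := by
      refine List.filterMap_congr fun r hr => ?_
      have := mem_rowsBelow hr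
      rw [hG, if_neg (by simp; omega), if_neg (by simp; omega)]
    have e₂ : (List.range i).reverse.filterMap (fun r => holeConfig inner outer f (i, j) r j) =
        (List.range i).reverse.filterMap (fun r =>
          holeConfig inner outer (moveEntry f (i, j) (i + 1, j)) (i + 1, j) r j) := by
      refine List.filterMap_congr fun r hr => ?_
      have : r < i := by simpa using hr
      rw [hG, if_neg (by simp; omega), if_neg (by simp; omega)]
    rw [e₁, e₂]
    have e₃ := hG i j
    have e₄ := hG (i + 1) j
    simp only [if_true] at e₃
    rw [if_neg (by simp), if_pos rfl] at e₄
    simp [hz, h₀, e₃, e₄]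
  · intro r k hk
    rw [hG, if_neg (by simp [hk]), if_neg (by simp [hk])]

/-- A horizontal move replaces the reading word by a Knuth equivalent one. -/
theorem IsHoleTableau.readingWord_right (h : IsHoleTableau inner outer f (i, j)) {R C : ℕ}
    (hR : i < R) (hC : j + 1 < C) (mem : (i, j + 1) ∈ outer)
    (lt : (i + 1, j) ∈ outer → f i (j + 1) < f (i + 1) j) :
    Knuth (readingWord R C (holeConfig inner outer f (i, j)))
      (readingWord R C (holeConfig inner outer (moveEntry f (i, j) (i, j + 1)) (i, j + 1))) := by
  have hin : ∀ {r c}, i ≤ r → j ≤ c → (r, c) ∉ inner := fun hr hc hmem =>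
    h.hole_notMem (mem_of_le h.lower_inner hmem hr hc)
  have hz : holeConfig inner outer f (i, j) i (j + 1) = some (f i (j + 1)) :=
    holeConfig_eq_some.2 ⟨⟨mem, hin le_rfl (by omega), by simp⟩, rfl⟩
  have h₀ : holeConfig inner outer f (i, j) i j = none := by simp [holeConfig]
  have hG := holeConfig_moveEntry (f := f) (q := (i, j + 1)) h.hole_mem h.hole_notMem (by simp)
  have hG' := h.move_right mem lt
  set F := holeConfig inner outer f (i, j) with hF
  set G := holeConfig inner outer (moveEntry f (i, j) (i, j + 1)) (i, j + 1) with hGdef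
  have hGi : G i j = some (f i (j + 1)) := by simp [hG]
  have hGi' : G i (j + 1) = none := by simp [hG]
  have hne : ∀ r, r ≠ i → ∀ c, G r c = F r c := fun r hr c => by
    rw [hG, if_neg (by simp [hr]), if_neg (by simp [hr])]
  refine Knuth.flatMap_of_adjacent hC ?_ ?_
  · have key := Knuth.move_between (L₁ := (rowsBelow R i).map fun r => (F r j, F r (j + 1)))
      (L₂ := (List.range i).reverse.map fun r => (F r j, F r (j + 1))) (y := f i (j + 1))
      (by
        simp only [List.mem_map]
        rintro _ ⟨r, hr, rfl⟩ b hb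
        have hri := (mem_rowsBelow hr).1
        obtain ⟨⟨hmem, -⟩, -⟩ := holeConfig_eq_some.1 hb
        have ha : F r j = some (f r j) := holeConfig_eq_some.2
          ⟨⟨mem_of_le h.lower_outer hmem le_rfl (by omega), hin hri.le le_rfl,
            by simp; omega⟩, rfl⟩
        exact ⟨_, ha, h.ordered.row (Nat.lt_succ_self j) ha hb⟩)
      (by
        simp only [List.mem_map]
        rintro _ ⟨r, hr, rfl⟩ a ha
        have hri : r < i := by simpa using hr
        obtain ⟨⟨-, hmem, -⟩, -⟩ := holeConfig_eq_some.1 ha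
        have hb : F r (j + 1) = some (f r (j + 1)) := holeConfig_eq_some.2
          ⟨⟨mem_of_le h.lower_outer mem hri.le le_rfl,
            fun hm => hmem (mem_of_le h.lower_inner hm le_rfl (by omega)), by simp⟩, rfl⟩
        exact ⟨_, hb, h.ordered.row (Nat.lt_succ_self j) ha hb⟩)
      (by
        have := colWord_pairwise (R := R) (F := G) (j := j) hG'.ordered.col
        rw [colWord_split hR, hGi] at this
        convert this using 1
        simp only [List.filterMap_map, Option.toList_some, List.append_assoc,
          List.singleton_append]
        congr 1
        · exact List.filterMap_congr fun r hr => (hne r (mem_rowsBelow hr).1.ne' j).symm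
        · congr 1
          exact List.filterMap_congr fun r hr => (hne r (by simp at hr; omega) j).symm)
      (by
        have := colWord_pairwise (R := R) (F := F) (j := j + 1) h.ordered.col
        rw [colWord_split hR, hz] at this
        simp only [List.filterMap_map, Option.toList_some, List.append_assoc,
          List.singleton_append] at this ⊢
        exact (List.pairwise_append.1 this).2.1)
    rw [colWord_split hR F, colWord_split hR F, colWord_split hR G, colWord_split hR G, hGi, hGi',
      h₀, hz]
    have e : ∀ c, (rowsBelow R i).filterMap (fun r => G r c) =
        (rowsBelow R i).filterMap (fun r => F r c) := fun c =>
      List.filterMap_congr fun r hr => hne r (mem_rowsBelow hr).1.ne' c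
    have e' : ∀ c, (List.range i).reverse.filterMap (fun r => G r c) =
        (List.range i).reverse.filterMap (fun r => F r c) := fun c =>
      List.filterMap_congr fun r hr => hne r (by simp at hr; omega) c
    rw [e, e, e', e']
    simpa [List.filterMap_map, Function.comp_def] using key.symm
  · intro k hk hk'
    exact colWord_congr fun r _ => by rw [hG, if_neg (by simp [hk]), if_neg (by simp [hk'])]

end HoleMove

/-- The configuration formed by the entries of a skew tableau. -/
def SkewTableau.config (T : SkewTableau) : Config := fun i j =>
  if (i, j) ∈ T.outer ∧ (i, j) ∉ T.inner then some (T.entry i j) else none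

/-- The column reading word of a skew tableau. -/
def SkewTableau.word (T : SkewTableau) : List ℕ :=
  readingWord (T.outer.colLen 0) (T.outer.rowLen 0) T.config

theorem SkewTableau.config_eq_some {T : SkewTableau} {i j x : ℕ} :
    T.config i j = some x ↔ ((i, j) ∈ T.outer ∧ (i, j) ∉ T.inner) ∧ T.entry i j = x := by
  simp [config]

theorem SkewTableau.isOrdered_config (T : SkewTableau) : IsOrdered T.config := by
  constructor
  · intro r a b x y hab hx hy
    obtain ⟨⟨-, h₁⟩, rfl⟩ := config_eq_some.1 hx
    obtain ⟨⟨h₂, -⟩, rfl⟩ := config_eq_some.1 hy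
    exact T.row_weak hab h₁ h₂
  · intro r r' a x y hr hx hy
    obtain ⟨⟨-, h₁⟩, rfl⟩ := config_eq_some.1 hx
    obtain ⟨⟨h₂, -⟩, rfl⟩ := config_eq_some.1 hy
    exact T.col_strict hr h₁ h₂

theorem lt_colLen_zero_of_mem {μ : YoungDiagram} {i j : ℕ} (h : (i, j) ∈ μ) : i < μ.colLen 0 :=
  YoungDiagram.mem_iff_lt_colLen.1 (μ.up_left_mem le_rfl (Nat.zero_le j) h)

theorem lt_rowLen_zero_of_mem {μ : YoungDiagram} {i j : ℕ} (h : (i, j) ∈ μ) : j < μ.rowLen 0 :=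
  YoungDiagram.mem_iff_lt_rowLen.1 (μ.up_left_mem (Nat.zero_le i) le_rfl h)

theorem SkewTableau.word_eq (T : SkewTableau) {R C : ℕ} (hR : T.outer.colLen 0 ≤ R)
    (hC : T.outer.rowLen 0 ≤ C) : T.word = readingWord R C T.config := by
  refine (readingWord_of_le hR hC ?_ ?_).symm
  · intro r j hr
    refine if_neg fun h => ?_
    have := lt_colLen_zero_of_mem h.1
    omega
  · intro r j hr
    refine if_neg fun h => ?_
    have := lt_rowLen_zero_of_mem h.1
    omega

theorem isLowerSet_erase {D : YoungDiagram} {a : ℕ × ℕ} (h₁ : (a.1 + 1, a.2) ∉ D)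
    (h₂ : (a.1, a.2 + 1) ∉ D) : IsLowerSet (D.cells.erase a : Set (ℕ × ℕ)) := by
  intro x y hyx hx
  simp only [Finset.coe_erase, Set.mem_sdiff, Finset.mem_coe, Set.mem_singleton_iff] at hx ⊢
  refine ⟨D.isLowerSet hyx hx.1, ?_⟩
  rintro rfl
  obtain ⟨x₁, x₂⟩ := x
  obtain ⟨h, h'⟩ := hyx
  simp only at h h'
  rcases h.lt_or_eq with hlt | heq
  · exact h₁ (D.up_left_mem hlt h' hx.1)
  · rcases h'.lt_or_eq with hlt' | heq'
    · exact h₂ (D.up_left_mem h hlt' hx.1)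
    · exact hx.2 (Prod.ext heq.symm heq'.symm)

theorem SkewTableau.isHoleTableau (T : SkewTableau) {a : ℕ × ℕ} (ha : a ∈ T.inner)
    (h₁ : (a.1 + 1, a.2) ∉ T.inner) (h₂ : (a.1, a.2 + 1) ∉ T.inner) :
    holeConfig (T.inner.cells.erase a) T.outer.cells T.entry a = T.config ∧
      IsHoleTableau (T.inner.cells.erase a) T.outer.cells T.entry a := by
  have hc : holeConfig (T.inner.cells.erase a) T.outer.cells T.entry a = T.config := by
    ext i j : 2
    have : ((i, j) ∈ T.outer.cells ∧ (i, j) ∉ T.inner.cells.erase a ∧ (i, j) ≠ a) ↔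
        ((i, j) ∈ T.outer ∧ (i, j) ∉ T.inner) := by
      simp only [Finset.mem_erase, YoungDiagram.mem_cells]
      by_cases h : (i, j) = a
      · simp [h, ha]
      · simp [h]
    simp only [holeConfig, config, this]
  refine ⟨hc, isLowerSet_erase h₁ h₂, T.outer.isLowerSet, T.inner_le_outer ha,
    Finset.notMem_erase _ _, hc ▸ T.isOrdered_config, ?_⟩
  intro i j h
  refine T.zeros ?_
  rcases h with h | h | h
  · exact .inl (Finset.mem_of_mem_erase h)
  · exact .inr h
  · exact .inl (h ▸ ha)

theorem IsHoleTableau.move {inner : Finset (ℕ × ℕ)} {outer : YoungDiagram}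
    {s t : (ℕ → ℕ → ℕ) × (ℕ × ℕ)} (h : IsHoleTableau inner outer.cells s.1 s.2)
    (hm : HoleMove outer s t) :
    IsHoleTableau inner outer.cells t.1 t.2 ∧
      Knuth (readingWord (outer.colLen 0) (outer.rowLen 0) (holeConfig inner outer.cells s.1 s.2))
        (readingWord (outer.colLen 0) (outer.rowLen 0)
          (holeConfig inner outer.cells t.1 t.2)) := by
  cases hm with
  | below f i j mem le =>
    exact ⟨h.move_below mem le, .of_eq (h.readingWord_below (lt_colLen_zero_of_mem mem) mem)⟩
  | right f i j mem lt =>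
    exact ⟨h.move_right mem lt, h.readingWord_right (lt_colLen_zero_of_mem mem)
      (lt_rowLen_zero_of_mem mem) mem lt⟩

theorem IsHoleTableau.moves {inner : Finset (ℕ × ℕ)} {outer : YoungDiagram}
    {s t : (ℕ → ℕ → ℕ) × (ℕ × ℕ)} (h : IsHoleTableau inner outer.cells s.1 s.2)
    (hm : Relation.ReflTransGen (HoleMove outer) s t) :
    IsHoleTableau inner outer.cells t.1 t.2 ∧
      Knuth (readingWord (outer.colLen 0) (outer.rowLen 0) (holeConfig inner outer.cells s.1 s.2))
        (readingWord (outer.colLen 0) (outer.rowLen 0)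
          (holeConfig inner outer.cells t.1 t.2)) := by
  induction hm with
  | refl => exact ⟨h, .refl _⟩
  | tail _ hst ih =>
    have := ih.1.move hst
    exact ⟨this.1, ih.2.trans this.2⟩

theorem colLen_zero_mono {μ ν : YoungDiagram} (h : μ ≤ ν) : μ.colLen 0 ≤ ν.colLen 0 := by
  by_contra! hlt
  exact lt_irrefl _ (YoungDiagram.mem_iff_lt_colLen.1 (h (YoungDiagram.mem_iff_lt_colLen.2 hlt)))

theorem rowLen_zero_mono {μ ν : YoungDiagram} (h : μ ≤ ν) : μ.rowLen 0 ≤ ν.rowLen 0 := by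
  by_contra! hlt
  exact lt_irrefl _ (YoungDiagram.mem_iff_lt_rowLen.1 (h (YoungDiagram.mem_iff_lt_rowLen.2 hlt)))

/-- A jeu de taquin slide replaces the reading word by a Knuth equivalent one. -/
theorem Slide.knuth {T T' : SkewTableau} (h : Slide T T') : Knuth T.word T'.word := by
  obtain ⟨a, b, ha, ha₁, ha₂, hm, hb₁, hb₂, hi, ho⟩ := h
  obtain ⟨hc, hT⟩ := T.isHoleTableau ha ha₁ ha₂
  obtain ⟨-, hk⟩ := IsHoleTableau.moves (s := (T.entry, a)) hT hm
  have hle : T'.outer ≤ T.outer := fun c hc => by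
    have : c ∈ T'.outer.cells := hc
    rw [ho] at this
    exact Finset.mem_of_mem_erase this
  rw [T'.word_eq (colLen_zero_mono hle) (rowLen_zero_mono hle)]
  convert hk using 2
  · rw [hc]
    rfl
  · ext i j : 2
    simp only [holeConfig, SkewTableau.config, ← YoungDiagram.mem_cells, ho, hi]
    simp only [Finset.mem_erase, and_comm, and_left_comm, and_assoc]

theorem JeuDeTaquin.knuth {T T' : SkewTableau} (h : JeuDeTaquin T T') :
    Knuth T.word T'.word := by
  induction h with
  | rel _ _ h => exact h.knuth
  | refl _ => exact .refl _
  | symm _ _ _ ih => exact ih.symm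
  | trans _ _ _ _ _ ih ih' => exact ih.trans ih'

/-! ### Rectification -/

theorem exists_final_hole {outer : YoungDiagram} (f : ℕ → ℕ → ℕ) (p : ℕ × ℕ) (hp : p ∈ outer) :
    ∃ t : (ℕ → ℕ → ℕ) × (ℕ × ℕ), Relation.ReflTransGen (HoleMove outer) (f, p) t ∧
      (t.2.1 + 1, t.2.2) ∉ outer ∧ (t.2.1, t.2.2 + 1) ∉ outer := by
  induction hn : outer.colLen 0 + outer.rowLen 0 - (p.1 + p.2) using Nat.strong_induction_on
    generalizing f p with
  | _ n ih =>
    obtain ⟨i, j⟩ := p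
    have step : ∀ (g : ℕ → ℕ → ℕ) (q : ℕ × ℕ), q ∈ outer → q.1 + q.2 = i + j + 1 →
        HoleMove outer (f, (i, j)) (g, q) →
        ∃ t : (ℕ → ℕ → ℕ) × (ℕ × ℕ), Relation.ReflTransGen (HoleMove outer) (f, (i, j)) t ∧
          (t.2.1 + 1, t.2.2) ∉ outer ∧ (t.2.1, t.2.2 + 1) ∉ outer := by
      intro g q hq hlt hm
      have h₁ := lt_colLen_zero_of_mem hq
      have h₂ := lt_rowLen_zero_of_mem hq
      simp only at hn
      obtain ⟨t, ht, ht'⟩ := ih _ (by omega) g q hq rfl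
      exact ⟨t, .head hm ht, ht'⟩
    by_cases h₁ : (i + 1, j) ∈ outer
    · by_cases h₂ : (i, j + 1) ∈ outer → f (i + 1) j ≤ f i (j + 1)
      · exact step _ _ h₁ (by simp only; omega) (.below f i j h₁ h₂)
      · push Not at h₂
        exact step _ _ h₂.1 (by simp only; omega) (.right f i j h₂.1 fun _ => h₂.2)
    · by_cases h₂ : (i, j + 1) ∈ outer
      · exact step _ _ h₂ (by simp only; omega) (.right f i j h₂ fun h => absurd h h₁)
      · exact ⟨_, .refl, h₁, h₂⟩

theorem SkewTableau.exists_slide (T : SkewTableau) (h : T.inner.cells.Nonempty) :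
    ∃ T', Slide T T' ∧ T'.inner.cells.card < T.inner.cells.card := by
  obtain ⟨a, ha, hmax⟩ := Finset.exists_max_image T.inner.cells (fun p => p.1 + p.2) h
  have ha₁ : (a.1 + 1, a.2) ∉ T.inner := fun h => by
    have := hmax _ h
    simp only at this
    omega
  have ha₂ : (a.1, a.2 + 1) ∉ T.inner := fun h => by
    have := hmax _ h
    simp only at this
    omega
  obtain ⟨-, hT⟩ := T.isHoleTableau ha ha₁ ha₂
  obtain ⟨⟨g, b⟩, hm, hb₁, hb₂⟩ := exists_final_hole T.entry a (T.inner_le_outer ha)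
  obtain ⟨hg, -⟩ := IsHoleTableau.moves (s := (T.entry, a)) hT hm
  simp only at hg hb₁ hb₂
  refine ⟨⟨⟨T.inner.cells.erase a, isLowerSet_erase ha₁ ha₂⟩,
    ⟨T.outer.cells.erase b, isLowerSet_erase hb₁ hb₂⟩, ?_, g, ?_, ?_, ?_⟩,
    ⟨a, b, ha, ha₁, ha₂, hm, hb₁, hb₂, rfl, rfl⟩, Finset.card_erase_lt_of_mem ha⟩
  · intro c hc
    exact Finset.mem_erase.2 ⟨fun h => hg.hole_notMem (h ▸ hc),
      T.inner_le_outer (Finset.mem_of_mem_erase hc)⟩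
  · intro i j₁ j₂ hj h₁ h₂
    have h₂' := Finset.mem_erase.1 h₂
    rcases eq_or_ne (i, j₁) b with hb | hb
    · rw [hg.zero (.inr (.inr hb))]
      exact Nat.zero_le _
    · exact hg.ordered.row hj
        (holeConfig_eq_some.2 ⟨⟨T.outer.up_left_mem le_rfl hj.le h₂'.2, h₁, hb⟩, rfl⟩)
        (holeConfig_eq_some.2 ⟨⟨h₂'.2, fun hm => h₁ (mem_of_le hg.lower_inner hm le_rfl hj.le),
          h₂'.1⟩, rfl⟩)
  · intro i₁ i₂ j hi h₁ h₂
    have h₂' := Finset.mem_erase.1 h₂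
    rcases eq_or_ne (i₁, j) b with rfl | hb
    · exact absurd (T.outer.up_left_mem hi le_rfl h₂'.2) hb₁
    · exact hg.ordered.col hi
        (holeConfig_eq_some.2 ⟨⟨T.outer.up_left_mem hi.le le_rfl h₂'.2, h₁, hb⟩, rfl⟩)
        (holeConfig_eq_some.2 ⟨⟨h₂'.2, fun hm => h₁ (mem_of_le hg.lower_inner hm hi.le le_rfl),
          h₂'.1⟩, rfl⟩)
  · intro i j h
    refine hg.zero ?_
    rcases h with h | h
    · exact .inl h
    · by_cases hb : (i, j) = b
      · exact .inr (.inr hb)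
      · exact .inr (.inl fun hm => h (Finset.mem_erase.2 ⟨hb, hm⟩))

theorem SkewTableau.exists_rectification (T : SkewTableau) :
    ∃ T', JeuDeTaquin T T' ∧ T'.inner = ⊥ := by
  induction hn : T.inner.cells.card using Nat.strong_induction_on generalizing T with
  | _ n ih =>
    rcases T.inner.cells.eq_empty_or_nonempty with h | h
    · exact ⟨T, .refl _, YoungDiagram.ext h⟩
    · obtain ⟨T', hs, hlt⟩ := T.exists_slide h
      obtain ⟨T'', hj, hi⟩ := ih _ (hn ▸ hlt) T' rfl
      exact ⟨T'', .trans _ _ _ (.rel _ _ hs) hj, hi⟩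

/-! ### Straight tableaux are determined by their Knuth class -/

theorem Chains.le_min_length {k : ℕ} {w : List ℕ} {s t : Fin k → ℕ} {N : ℕ} (h : Chains w s t N)
    (hw : w.Pairwise (· > ·)) : N ≤ min k w.length := by
  obtain ⟨I, rfl, -, h₃, h₄⟩ := h.exists_finset hw
  refine le_min ?_ ?_
  · simpa using I.card_le_univ
  · rw [← Finset.card_image_of_injOn h₄]
    refine (Finset.card_le_card (t := w.toFinset) ?_).trans w.toFinset_card_le
    intro x hx
    obtain ⟨i, hi, rfl⟩ := Finset.mem_image.1 hx
    exact List.mem_toFinset.2 (h₃ i hi).2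

theorem Chains.le_sum {k R C : ℕ} {F : Config} {s t : Fin k → ℕ} {N : ℕ} (hF : IsOrdered F)
    (h : Chains (readingWord R C F) s t N) :
    N ≤ ∑ j ∈ Finset.range C, min k (colWord R F j).length := by
  induction C generalizing t N with
  | zero =>
    cases h
    simp
  | succ C ih =>
    rw [readingWord, List.range_succ, List.flatMap_append] at h
    obtain ⟨m, N₁, N₂, h₁, h₂, rfl⟩ := h.exists_of_append
    rw [Finset.sum_range_succ]
    refine Nat.add_le_add (ih h₁) ?_
    simp only [List.flatMap_cons, List.flatMap_nil, List.append_nil] at h₂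
    exact h₂.le_min_length (colWord_pairwise hF.col)

/-- In reading a column, its entry in row `r` can be added to the `r`-th subsequence. -/
theorem Chains.column {k : ℕ} (u : ℕ → Option ℕ) (R : ℕ) (s : Fin k → ℕ)
    (h : ∀ r : Fin k, ∀ x ∈ u r, s r ≤ x) :
    Chains ((List.range R).reverse.filterMap u) s
      (fun r => if (r : ℕ) < R then (u r).getD (s r) else s r)
      ((Finset.range R).filter fun r => r < k ∧ (u r).isSome).card := by
  induction R generalizing s with
  | zero => simpa using Chains.nil s
  | succ R ih =>
    rw [List.range_succ, List.reverse_append, List.filterMap_append, Finset.range_add_one,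
      Finset.filter_insert]
    rcases huR : u R with _ | x
    · have hs := ih s h
      simp only [List.reverse_cons, List.reverse_nil, List.nil_append, huR, List.filterMap_cons,
        List.filterMap_nil, Option.isSome_none, Bool.false_eq_true, and_false, if_false]
      have e : (fun r : Fin k => if (r : ℕ) < R + 1 then (u r).getD (s r) else s r) =
          fun r : Fin k => if (r : ℕ) < R then (u r).getD (s r) else s r := by
        funext r
        rcases eq_or_ne (r : ℕ) R with hr | hr
        · simp [hr, huR]
        · simp [hr, Nat.le_iff_lt_or_eq]
      rw [e]
      exact hs
    · by_cases hk : R < k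
      · have hs := ih (Function.update s ⟨R, hk⟩ x) (by
          intro r y hy
          rcases eq_or_ne r ⟨R, hk⟩ with rfl | hr
          · simp only [huR, Option.mem_def, Option.some.injEq] at hy
            simp [hy]
          · simpa [hr] using h r y hy)
        simp only [List.reverse_cons, List.reverse_nil, List.nil_append, huR, List.filterMap_cons,
          List.filterMap_nil, Option.isSome_some, and_true, hk, if_true]
        rw [Finset.card_insert_of_notMem (by simp)]
        refine .take x ⟨R, hk⟩ (h ⟨R, hk⟩ x (by simp [huR])) ?_
        have e : (fun r : Fin k => if (r : ℕ) < R + 1 then (u r).getD (s r) else s r) =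
            fun r : Fin k => if (r : ℕ) < R then (u r).getD (Function.update s ⟨R, hk⟩ x r)
              else Function.update s ⟨R, hk⟩ x r := by
          funext r
          rcases eq_or_ne r ⟨R, hk⟩ with rfl | hr
          · simp [huR]
          · have : (r : ℕ) ≠ R := fun h => hr (Fin.ext h)
            simp [hr, Nat.le_iff_lt_or_eq, this]
        rw [e]
        exact hs
      · have hs := ih s h
        simp only [List.reverse_cons, List.reverse_nil, List.nil_append, huR, List.filterMap_cons,
          List.filterMap_nil, hk, false_and, if_false]
        refine .skip x ?_
        have e : (fun r : Fin k => if (r : ℕ) < R + 1 then (u r).getD (s r) else s r) =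
            fun r : Fin k => if (r : ℕ) < R then (u r).getD (s r) else s r := by
          funext r
          have : (r : ℕ) < R := lt_of_lt_of_le r.2 (by omega)
          simp [this, this.trans (Nat.lt_succ_self R)]
        rw [e]
        exact hs

/-- The configuration `F` is a semistandard filling of the straight shape `ν`. -/
structure IsStraight (ν : YoungDiagram) (F : Config) : Prop where
  ordered : IsOrdered F
  isSome_iff : ∀ i j, (F i j).isSome ↔ (i, j) ∈ ν

theorem IsStraight.colWord_length {ν : YoungDiagram} {F : Config} (h : IsStraight ν F) {R : ℕ}
    (hR : ν.colLen 0 ≤ R) (j : ℕ) : (colWord R F j).length = ν.colLen j := by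
  have hj : ν.colLen j ≤ R := (ν.colLen_anti 0 j (Nat.zero_le j)).trans hR
  have hs : ∀ r, (F r j).isSome ↔ r < ν.colLen j := fun r => by
    rw [h.isSome_iff, YoungDiagram.mem_iff_lt_colLen]
  have h₀ : ∀ r, ν.colLen j ≤ r → F r j = none := fun r hr => by
    rw [← Option.not_isSome_iff_eq_none, hs]
    omega
  rw [colWord, List.filterMap_reverse, List.length_reverse]
  clear hR
  obtain ⟨d, rfl⟩ := Nat.exists_eq_add_of_le hj
  rw [List.range_add, List.filterMap_append, List.length_append]
  have e₁ : List.filterMap (fun r => F r j) ((List.range d).map (ν.colLen j + ·)) = [] := by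
    rw [List.filterMap_eq_nil_iff]
    simp only [List.mem_map]
    rintro _ ⟨a, -, rfl⟩
    exact h₀ _ (by omega)
  have e₂ : List.filterMap (fun r => F r j) (List.range (ν.colLen j)) =
      (List.range (ν.colLen j)).map fun r => (F r j).getD 0 := by
    rw [← List.filterMap_eq_map]
    refine List.filterMap_congr fun r hr => ?_
    obtain ⟨x, hx⟩ := Option.isSome_iff_exists.1 ((hs r).2 (List.mem_range.1 hr))
    simp [hx]
  rw [e₁, e₂]
  simp

theorem IsStraight.chains {ν : YoungDiagram} {F : Config} (h : IsStraight ν F) {R : ℕ}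
    (hR : ν.colLen 0 ≤ R) (C k : ℕ) : ∃ t : Fin k → ℕ, Chains (readingWord R C F) 0 t
      (∑ j ∈ Finset.range C, min k (ν.colLen j)) ∧
      ∀ (r : Fin k) (j x : ℕ), C ≤ j → F r j = some x → t r ≤ x := by
  induction C with
  | zero => exact ⟨0, .nil _, by simp⟩
  | succ C ih =>
    obtain ⟨t, ht, htF⟩ := ih
    refine ⟨fun r => if (r : ℕ) < R then (F r C).getD (t r) else t r, ?_, ?_⟩
    · rw [readingWord, List.range_succ, List.flatMap_append, Finset.sum_range_succ]
      refine ht.append ?_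
      simp only [List.flatMap_cons, List.flatMap_nil, List.append_nil]
      have key := Chains.column (fun r => F r C) R t (fun r x hx => htF r C x le_rfl hx)
      have : (Finset.range R).filter (fun r => r < k ∧ (F r C).isSome) =
          Finset.range (min k (ν.colLen C)) := by
        ext r
        have := ν.colLen_anti 0 C (Nat.zero_le C)
        simp only [Finset.mem_filter, Finset.mem_range, h.isSome_iff,
          YoungDiagram.mem_iff_lt_colLen, lt_min_iff]
        omega
      rw [this, Finset.card_range] at key
      exact key
    · intro r j x hj hx
      have := htF r j x (by omega) hx
      beta_reduce
      split_ifs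
      · rcases hF : F r C with _ | y
        · simpa using this
        · simpa using h.ordered.row (by omega) hF hx
      · exact this

theorem sum_min_succ (ν : YoungDiagram) {C : ℕ} (hC : ν.rowLen 0 ≤ C) (k : ℕ) :
    ∑ j ∈ Finset.range C, min (k + 1) (ν.colLen j) =
      ∑ j ∈ Finset.range C, min k (ν.colLen j) + ν.rowLen k := by
  have : ν.rowLen k = ∑ j ∈ Finset.range C, if k < ν.colLen j then 1 else 0 := by
    rw [← Finset.card_filter, ← Finset.card_range (ν.rowLen k)]
    congr 1
    ext j
    have := ν.rowLen_anti 0 k (Nat.zero_le k)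
    simp only [Finset.mem_filter, Finset.mem_range, ← YoungDiagram.mem_iff_lt_colLen]
    rw [YoungDiagram.mem_iff_lt_rowLen]
    omega
  rw [this, ← Finset.sum_add_distrib]
  refine Finset.sum_congr rfl fun j _ => ?_
  split_ifs <;> omega

/-- The shape of a straight tableau is determined by the Knuth class of its reading word. -/
theorem IsStraight.shape_eq {ν ν' : YoungDiagram} {F F' : Config} (h : IsStraight ν F)
    (h' : IsStraight ν' F') {R C : ℕ} (hR : ν.colLen 0 ≤ R) (hR' : ν'.colLen 0 ≤ R)
    (hC : ν.rowLen 0 ≤ C) (hC' : ν'.rowLen 0 ≤ C)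
    (hk : Knuth (readingWord R C F) (readingWord R C F')) : ν = ν' := by
  have key : ∀ {ν ν' : YoungDiagram} {F F' : Config}, IsStraight ν F → IsStraight ν' F' →
      ν.colLen 0 ≤ R → ν'.colLen 0 ≤ R →
      Knuth (readingWord R C F) (readingWord R C F') → ∀ k,
      ∑ j ∈ Finset.range C, min k (ν.colLen j) ≤ ∑ j ∈ Finset.range C, min k (ν'.colLen j) := by
    intro ν ν' F F' h h' hR hR' hk k
    obtain ⟨t, ht, -⟩ := h.chains hR C k
    obtain ⟨t', ht'⟩ := (hk.chains 0 _).1 ⟨t, ht⟩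
    refine (ht'.le_sum h'.ordered).trans_eq (Finset.sum_congr rfl fun j _ => ?_)
    rw [h'.colWord_length hR']
  have heq : ∀ k, ∑ j ∈ Finset.range C, min k (ν.colLen j) =
      ∑ j ∈ Finset.range C, min k (ν'.colLen j) := fun k =>
    (key h h' hR hR' hk k).antisymm (key h' h hR' hR hk.symm k)
  have hrow : ∀ k, ν.rowLen k = ν'.rowLen k := fun k => by
    have h₁ := sum_min_succ ν hC k
    have h₂ := sum_min_succ ν' hC' k
    have h₃ := heq k
    have h₄ := heq (k + 1)
    omega
  ext ⟨i, j⟩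
  simp only [YoungDiagram.mem_cells]
  rw [YoungDiagram.mem_iff_lt_rowLen, YoungDiagram.mem_iff_lt_rowLen, hrow]

theorem readingWord_filter (R C : ℕ) (F : Config) (t : ℕ) :
    (readingWord R C F).filter (· < t) =
      readingWord R C fun i j => (F i j).filter (· < t) := by
  rw [readingWord, List.filter_flatMap, readingWord]
  refine List.flatMap_congr fun j _ => ?_
  rw [colWord, List.filter_filterMap]
  rfl

/-- The cells with entries less than `t` form a straight tableau again. -/
theorem IsStraight.filter {ν : YoungDiagram} {F : Config} (h : IsStraight ν F) (t : ℕ) :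
    ∃ ν' ≤ ν, IsStraight ν' fun i j => (F i j).filter (· < t) := by
  classical
  have hle : ∀ {i j i' j' x}, i ≤ i' → j ≤ j' → F i' j' = some x → ∃ y ≤ x, F i j = some y := by
    intro i j i' j' x hi hj hx
    have hmem : (i', j') ∈ ν := (h.isSome_iff _ _).1 (by simp [hx])
    obtain ⟨y, hy⟩ := Option.isSome_iff_exists.1
      ((h.isSome_iff i j).2 (ν.up_left_mem hi hj hmem))
    obtain ⟨z, hz⟩ := Option.isSome_iff_exists.1
      ((h.isSome_iff i j').2 (ν.up_left_mem hi le_rfl hmem))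
    have h₁ : y ≤ z := by
      rcases hj.eq_or_lt with rfl | hj
      · simp_all
      · exact h.ordered.row hj hy hz
    have h₂ : z ≤ x := by
      rcases hi.eq_or_lt with rfl | hi
      · simp_all
      · exact (h.ordered.col hi hz hx).le
    exact ⟨y, h₁.trans h₂, hy⟩
  refine ⟨⟨ν.cells.filter fun p => ∃ x < t, F p.1 p.2 = some x, ?_⟩, ?_, ?_, ?_⟩
  · rintro ⟨i', j'⟩ ⟨i, j⟩ ⟨hi, hj⟩ hm
    simp only [Finset.coe_filter, Set.mem_ofPred_eq, YoungDiagram.mem_cells] at hm ⊢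
    obtain ⟨hm, x, hx, hF⟩ := hm
    obtain ⟨y, hy, hF'⟩ := hle hi hj hF
    exact ⟨ν.up_left_mem hi hj hm, y, by omega, hF'⟩
  · exact fun p hp => (Finset.mem_filter.1 hp).1
  · constructor
    · intro r a b x y hab hx hy
      exact h.ordered.row hab (Option.filter_eq_some_iff.1 hx).1 (Option.filter_eq_some_iff.1 hy).1
    · intro r r' a x y hab hx hy
      exact h.ordered.col hab (Option.filter_eq_some_iff.1 hx).1 (Option.filter_eq_some_iff.1 hy).1
  · intro i j
    rw [← YoungDiagram.mem_cells]
    simp only [Finset.mem_filter, YoungDiagram.mem_cells, ← h.isSome_iff]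
    rcases hF : F i j with _ | x
    · simp
    · by_cases hx : x < t <;> simp [hx]

/-- A straight tableau is determined by the Knuth class of its reading word. -/
theorem IsStraight.eq {ν ν' : YoungDiagram} {F F' : Config} (h : IsStraight ν F)
    (h' : IsStraight ν' F') {R C : ℕ} (hR : ν.colLen 0 ≤ R) (hR' : ν'.colLen 0 ≤ R)
    (hC : ν.rowLen 0 ≤ C) (hC' : ν'.rowLen 0 ≤ C)
    (hk : Knuth (readingWord R C F) (readingWord R C F')) : F = F' := by
  have key : ∀ t i j, ((F i j).filter (· < t)).isSome ↔ ((F' i j).filter (· < t)).isSome := by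
    intro t i j
    obtain ⟨κ, hκ, hs⟩ := h.filter t
    obtain ⟨κ', hκ', hs'⟩ := h'.filter t
    have : κ = κ' := hs.shape_eq hs' ((colLen_zero_mono hκ).trans hR)
      ((colLen_zero_mono hκ').trans hR') ((rowLen_zero_mono hκ).trans hC)
      ((rowLen_zero_mono hκ').trans hC') (by
        rw [← readingWord_filter, ← readingWord_filter]
        exact hk.filter_lt t)
    rw [hs.isSome_iff, hs'.isSome_iff, this]
  ext i j x : 3
  have h₁ := key x i j
  have h₂ := key (x + 1) i j
  rcases hF : F i j with _ | y <;> rcases hF' : F' i j with _ | z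
  · simp
  · have := key (z + 1) i j
    simp [hF, hF'] at this
  · have := key (y + 1) i j
    simp [hF, hF'] at this
  · simp only [hF, hF', Option.isSome_filter, Option.any_some, decide_eq_true_eq] at h₁ h₂
    simp only [Option.some.injEq]
    omega

theorem SkewTableau.isStraight {T : SkewTableau} (h : T.inner = ⊥) :
    IsStraight T.outer T.config :=
  ⟨T.isOrdered_config, fun i j => by simp [config, h]⟩

theorem SkewTableau.eq_of_config {T T' : SkewTableau} (h : T.inner = ⊥) (h' : T'.inner = ⊥)
    (hc : T.config = T'.config) : T = T' := by
  have ho : T.outer = T'.outer := by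
    ext ⟨i, j⟩
    simp only [YoungDiagram.mem_cells]
    rw [← (isStraight h).isSome_iff, ← (isStraight h').isSome_iff, hc]
  ext i j
  · rw [h, h']
  · rw [ho]
  · by_cases hm : (i, j) ∈ T.outer
    · have : T.config i j = some (T.entry i j) := by simp [config, h, hm]
      rw [hc, config_eq_some] at this
      rw [this.2]
    · rw [T.zeros (.inr hm), T'.zeros (.inr (ho ▸ hm))]

/-- A skew tableau whose reading word is Knuth equivalent to that of a straight tableau is obtained
from it by jeu de taquin. -/
theorem JeuDeTaquin.of_knuth {T T' : SkewTableau} (h : T.inner = ⊥) (hk : Knuth T.word T'.word) :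
    JeuDeTaquin T T' := by
  obtain ⟨T₀, hj, hi⟩ := T'.exists_rectification
  suffices T = T₀ by
    rw [this]
    exact .symm _ _ hj
  refine SkewTableau.eq_of_config h hi ((SkewTableau.isStraight h).eq (SkewTableau.isStraight hi)
    (le_max_left _ _) (le_max_right _ _) (le_max_left _ _) (le_max_right _ _) ?_)
  rw [← T.word_eq (le_max_left _ _) (le_max_left _ _),
    ← T₀.word_eq (le_max_right _ _) (le_max_right _ _)]
  exact hk.trans hj.knuth

/-! ### The last column is determined by the Knuth class -/

theorem Chains.self_range {k : ℕ} (s : Fin k → ℕ) (hs : Function.Injective s) (x : ℕ) :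
    Chains (List.range x).reverse s s (Finset.univ.filter fun i => s i < x).card := by
  induction x with
  | zero => simpa using Chains.nil s
  | succ x ih =>
    rw [List.range_succ, List.reverse_append]
    simp only [List.reverse_cons, List.reverse_nil, List.nil_append, List.singleton_append]
    by_cases hx : ∃ i, s i = x
    · obtain ⟨i, rfl⟩ := hx
      have : (Finset.univ.filter fun j => s j < s i + 1) =
          insert i (Finset.univ.filter fun j => s j < s i) := by
        ext j
        simp only [Finset.mem_filter, Finset.mem_univ, true_and, Finset.mem_insert,
          Nat.lt_succ_iff, Nat.le_iff_lt_or_eq, hs.eq_iff]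
        tauto
      rw [this, Finset.card_insert_of_notMem (by simp)]
      exact .take _ i le_rfl (by simpa using ih)
    · push Not at hx
      have : (Finset.univ.filter fun j => s j < x + 1) = Finset.univ.filter fun j => s j < x := by
        ext j
        have := hx j
        simp only [Finset.mem_filter, Finset.mem_univ, true_and]
        omega
      rw [this]
      exact .skip x ih

/-- If `v` is a strictly decreasing word, the word `v (x - 1) ⋯ 1 0` has at most
`m + #{y ∈ v | y < x}` letters in the union of `m` weakly increasing subsequences. -/
theorem Chains.le_of_append_range {m : ℕ} {v : List ℕ} (hv : v.Pairwise (· > ·)) {x : ℕ}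
    {s t : Fin m → ℕ} {N : ℕ} (h : Chains (v ++ (List.range x).reverse) s t N) :
    N ≤ m + (v.toFinset.filter (· < x)).card := by
  obtain ⟨s', N₁, N₂, h₁, h₂, rfl⟩ := h.exists_of_append
  obtain ⟨I, rfl, -, hI, hinj⟩ := h₁.exists_finset hv
  obtain ⟨J, rfl, -, hJ, -⟩ := h₂.exists_finset
    (by rw [List.pairwise_reverse]; exact List.pairwise_lt_range)
  have hJx : ∀ i ∈ J, s' i < x := fun i hi => by
    have h := hJ i hi
    have : t i < x := by simpa using h.2
    omega
  have h₃ : (J ∩ I).card ≤ (v.toFinset.filter (· < x)).card := by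
    rw [← Finset.card_image_of_injOn (hinj.mono (Finset.coe_subset.2 (Finset.inter_subset_right : J ∩ I ⊆ I)))]
    refine Finset.card_le_card fun y hy => ?_
    obtain ⟨i, hi, rfl⟩ := Finset.mem_image.1 hy
    rw [Finset.mem_inter] at hi
    simp [(hI i hi.2).2, hJx i hi.1]
  have h₄ : I.card + (J \ I).card ≤ m := by
    rw [← Finset.card_union_of_disjoint Finset.disjoint_sdiff]
    simpa using (I ∪ (J \ I)).card_le_univ
  have h₅ := Finset.card_inter_add_card_sdiff J I
  omega

/-- If `m` weakly increasing subsequences use all the `m` letters of a strictly decreasing word `v`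
at their ends, then each of those less than `x` may be followed by one of the letters
`x - 1, …, 1, 0`. -/
theorem Chains.append_range {m : ℕ} {v : List ℕ} (hv : v.Pairwise (· > ·)) (hm : v.length = m)
    {s t : Fin m → ℕ} (h : Chains v s t m) (x : ℕ) :
    Chains (v ++ (List.range x).reverse) s t (m + (v.toFinset.filter (· < x)).card) := by
  obtain ⟨I, hIc, -, hI, hinj⟩ := h.exists_finset hv
  have hIu : I = Finset.univ := by rw [← Finset.card_eq_iff_eq_univ, hIc, Fintype.card_fin]
  subst hIu
  have hinj' : Function.Injective t := by simpa using hinj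
  have hnd : v.Nodup := hv.imp fun h => h.ne'
  have himg : Finset.univ.image t = v.toFinset := by
    refine Finset.eq_of_subset_of_card_le (fun y hy => ?_) ?_
    · obtain ⟨i, hi, rfl⟩ := Finset.mem_image.1 hy
      exact List.mem_toFinset.2 (hI i hi).2
    · rw [Finset.card_image_of_injective _ hinj', List.toFinset_card_of_nodup hnd, hm]
      simp
  have hcard : (v.toFinset.filter (· < x)).card =
      (Finset.univ.filter fun i => t i < x).card := by
    rw [← himg, Finset.filter_image, Finset.card_image_of_injective _ hinj']
  rw [hcard]
  exact h.append (.self_range t hinj' x)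

theorem eq_of_card_filter_lt {A B : Finset ℕ}
    (h : ∀ x, (A.filter (· < x)).card = (B.filter (· < x)).card) : A = B := by
  have key : ∀ (A : Finset ℕ) (x : ℕ), (A.filter (· < x + 1)).card =
      (A.filter (· < x)).card + if x ∈ A then 1 else 0 := by
    intro A x
    split_ifs with hx
    · have : A.filter (· < x + 1) = insert x (A.filter (· < x)) := by
        ext y
        simp only [Finset.mem_filter, Finset.mem_insert]
        constructor
        · rintro ⟨h₁, h₂⟩
          by_cases hy : y = x
          · exact .inl hy
          · exact .inr ⟨h₁, by omega⟩
        · rintro (rfl | ⟨h₁, h₂⟩)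
          · exact ⟨hx, by omega⟩
          · exact ⟨h₁, by omega⟩
      rw [this, Finset.card_insert_of_notMem (by simp)]
    · have : A.filter (· < x + 1) = A.filter (· < x) := by
        refine Finset.filter_congr fun y hy => ?_
        have : y ≠ x := fun h => hx (h ▸ hy)
        omega
      rw [this, add_zero]
  ext x
  have h₁ := key A x
  have h₂ := key B x
  have h₃ := h x
  have h₄ := h (x + 1)
  by_cases hA : x ∈ A <;> by_cases hB : x ∈ B <;> simp_all

/-- The column `j` of a skew tableau, read from the bottom to the top. -/
theorem SkewTableau.colWord_config (T : SkewTableau) {R : ℕ} (hR : T.outer.colLen 0 ≤ R) (j : ℕ) :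
    colWord R T.config j = ((List.range (T.colLen j)).map fun i =>
      T.entry (T.inner.colLen j + i) j).reverse := by
  have hle : T.inner.colLen j ≤ T.outer.colLen j := by
    by_contra! hlt
    exact lt_irrefl _ (YoungDiagram.mem_iff_lt_colLen.1
      (T.inner_le_outer (YoungDiagram.mem_iff_lt_colLen.2 hlt)))
  have hR' : T.outer.colLen j ≤ R := (T.outer.colLen_anti 0 j (Nat.zero_le j)).trans hR
  have hmem : ∀ r, ((r, j) ∈ T.outer ∧ (r, j) ∉ T.inner) ↔
      T.inner.colLen j ≤ r ∧ r < T.outer.colLen j := fun r => by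
    rw [YoungDiagram.mem_iff_lt_colLen, YoungDiagram.mem_iff_lt_colLen]
    omega
  rw [colWord_of_le hR', colWord, List.filterMap_reverse]
  · congr 1
    rw [SkewTableau.colLen]
    obtain ⟨l, hl⟩ := Nat.exists_eq_add_of_le hle
    have e₁ : (List.range (T.inner.colLen j)).filterMap (fun r => T.config r j) = [] := by
      rw [List.filterMap_eq_nil_iff]
      intro r hr
      rw [List.mem_range] at hr
      simp only [config, hmem]
      exact if_neg (by omega)
    rw [hl, List.range_add, List.filterMap_append, e₁, List.nil_append, List.filterMap_map,
      Nat.add_sub_cancel_left, ← List.filterMap_eq_map]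
    refine List.filterMap_congr fun r hr => ?_
    rw [List.mem_range] at hr
    simp only [config, hmem, Function.comp_apply]
    exact if_pos (by omega)
  · intro r hr
    simp only [config, hmem]
    exact if_neg (by omega)

theorem SkewTableau.length_colWord (T : SkewTableau) {R : ℕ} (hR : T.outer.colLen 0 ≤ R) (j : ℕ) :
    (colWord R T.config j).length = T.colLen j := by
  simp [T.colWord_config hR]

/-- The set of entries in the last column of a tableau as in `IsFrank S j T`. -/
def lastColumn (c : ℕ) (T : SkewTableau) : Finset ℕ :=
  (colWord (T.outer.colLen 0) T.config (c - 1)).toFinset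

theorem mem_lastColumn {c : ℕ} {T : SkewTableau} {x : ℕ} : x ∈ lastColumn c T ↔
    ∃ i < T.colLen (c - 1), T.entry (T.inner.colLen (c - 1) + i) (c - 1) = x := by
  simp [lastColumn, T.colWord_config le_rfl]

section Frank

variable {μ : YoungDiagram} {S : SemistandardYoungTableau μ} {j : Fin (μ.rowLen 0)}
  {T : SkewTableau}

theorem isStraight_ofStraight (S : SemistandardYoungTableau μ) :
    IsStraight μ (SkewTableau.ofStraight S).config :=
  SkewTableau.isStraight (T := SkewTableau.ofStraight S) rfl

theorem IsFrank.word_eq (h : IsFrank S j T) :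
    T.word = readingWord (T.outer.colLen 0) (μ.rowLen 0 - 1) T.config ++
      colWord (T.outer.colLen 0) T.config (μ.rowLen 0 - 1) := by
  have hpos : 0 < μ.rowLen 0 := (Nat.zero_le _).trans_lt j.2
  rw [T.word_eq (C := max (T.outer.rowLen 0) (μ.rowLen 0)) le_rfl (le_max_left _ _),
    readingWord_of_le (R := T.outer.colLen 0) (C := μ.rowLen 0) le_rfl (le_max_right _ _)]
  · conv_lhs => rw [← Nat.sub_add_cancel (show 1 ≤ μ.rowLen 0 from hpos), readingWord,
      List.range_succ, List.flatMap_append]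
    simp [readingWord]
  · intro r c hr
    refine if_neg fun hm => ?_
    have := lt_colLen_zero_of_mem hm.1
    omega
  · intro r c hc
    refine if_neg fun hm => ?_
    rw [YoungDiagram.mem_iff_lt_colLen, YoungDiagram.mem_iff_lt_colLen] at hm
    have := h.empty c hc
    rw [SkewTableau.colLen] at this
    omega

theorem IsFrank.sum_eq (h : IsFrank S j T) :
    ∑ k ∈ Finset.range (μ.rowLen 0 - 1), min (μ.colLen j) (T.colLen k) + μ.colLen j =
      ∑ k ∈ Finset.range (μ.rowLen 0), min (μ.colLen j) (μ.colLen k) := by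
  have hpos : 0 < μ.rowLen 0 := (Nat.zero_le _).trans_lt j.2
  have h₁ : ∑ k ∈ Finset.range (μ.rowLen 0), min (μ.colLen j) (T.colLen k) =
      ∑ k ∈ Finset.range (μ.rowLen 0), min (μ.colLen j) (μ.colLen k) := by
    obtain ⟨π, hπ⟩ := h.perm
    rw [Finset.sum_range, Finset.sum_range]
    simp only [hπ]
    exact Equiv.sum_comp π fun k : Fin (μ.rowLen 0) => min (μ.colLen j) (μ.colLen k)
  have h₂ := Finset.sum_range_succ (fun k => min (μ.colLen j) (T.colLen k)) (μ.rowLen 0 - 1)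
  rw [Nat.sub_add_cancel hpos, h.last, min_self, h₁] at h₂
  exact h₂.symm

/-- The maximal size of a union of `m` weakly increasing subsequences of the word of `T` followed by
`x - 1, …, 1, 0`, where `m` is the length of the last column of `T`. -/
theorem IsFrank.isGreatest (h : IsFrank S j T) (x : ℕ) :
    IsGreatest {N | ∃ t : Fin (μ.colLen j) → ℕ, Chains (T.word ++ (List.range x).reverse) 0 t N}
      (∑ k ∈ Finset.range (μ.rowLen 0), min (μ.colLen j) (μ.colLen k) +
        ((lastColumn (μ.rowLen 0) T).filter (· < x)).card) := by
  have hv := colWord_pairwise (R := T.outer.colLen 0) (j := μ.rowLen 0 - 1) T.isOrdered_config.col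
  have hlen : (colWord (T.outer.colLen 0) T.config (μ.rowLen 0 - 1)).length = μ.colLen j := by
    rw [T.length_colWord le_rfl, h.last]
  have hsum := h.sum_eq
  have hle : ∀ {t : Fin (μ.colLen j) → ℕ} {N : ℕ},
      Chains (readingWord (T.outer.colLen 0) (μ.rowLen 0 - 1) T.config) 0 t N →
      N ≤ ∑ k ∈ Finset.range (μ.rowLen 0 - 1), min (μ.colLen j) (T.colLen k) := by
    intro t N ht
    refine (ht.le_sum T.isOrdered_config).trans_eq (Finset.sum_congr rfl fun k _ => ?_)
    rw [T.length_colWord le_rfl]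
  constructor
  · obtain ⟨t, ht, -⟩ := (isStraight_ofStraight S).chains (R := μ.colLen 0) le_rfl (μ.rowLen 0)
      (μ.colLen j)
    obtain ⟨t', ht'⟩ := (h.jdt.knuth.chains 0 _).1 ⟨t, ht⟩
    rw [h.word_eq] at ht'
    obtain ⟨s, N₁, N₂, h₁, h₂, hN⟩ := ht'.exists_of_append
    have hN₁ := hle h₁
    have hN₂ := (h₂.le_min_length hv).trans (min_le_left _ _)
    have e₁ : N₁ = ∑ k ∈ Finset.range (μ.rowLen 0 - 1), min (μ.colLen j) (T.colLen k) := by omega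
    have e₂ : N₂ = μ.colLen j := by omega
    rw [e₂] at h₂
    refine ⟨t', ?_⟩
    have := h₁.append (h₂.append_range hv hlen x)
    rw [← List.append_assoc, ← h.word_eq] at this
    convert this using 1
    rw [lastColumn]
    omega
  · rintro N ⟨t, ht⟩
    rw [h.word_eq, List.append_assoc] at ht
    obtain ⟨s, N₁, N₂, h₁, h₂, rfl⟩ := ht.exists_of_append
    have hN₁ := hle h₁
    have hN₂ := h₂.le_of_append_range hv
    rw [lastColumn]
    omega

/-- All tableaux that serve to compute a column of the right key give the same result. -/
theorem IsFrank.lastColumn_eq {T' : SkewTableau} (h : IsFrank S j T) (h' : IsFrank S j T') :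
    lastColumn (μ.rowLen 0) T = lastColumn (μ.rowLen 0) T' := by
  refine eq_of_card_filter_lt fun x => ?_
  have hk : Knuth T.word T'.word := h.jdt.knuth.symm.trans h'.jdt.knuth
  have h₁ := h.isGreatest x
  have h₂ := h'.isGreatest x
  simp only [(hk.append_right _).chains] at h₁
  exact Nat.add_left_cancel (h₁.unique h₂)

end Frank

/-- Strictly increasing finite sequences with the same set of values are equal. -/
theorem eq_of_strictMono_of_values {m : ℕ} {a b : ℕ → ℕ}
    (ha : ∀ i i', i < i' → i' < m → a i < a i') (hb : ∀ i i', i < i' → i' < m → b i < b i')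
    (h : ∀ x, (∃ i < m, a i = x) ↔ ∃ i < m, b i = x) {i : ℕ} (hi : i < m) : a i = b i := by
  have hl : ((List.range m).map a) = (List.range m).map b := by
    have hpa : ((List.range m).map a).Pairwise (· < ·) := by
      rw [List.pairwise_map]
      exact (List.pairwise_lt_range).imp_of_mem fun {c d} _ hd hcd => ha c d hcd (by simpa using hd)
    have hpb : ((List.range m).map b).Pairwise (· < ·) := by
      rw [List.pairwise_map]
      exact (List.pairwise_lt_range).imp_of_mem fun {c d} _ hd hcd => hb c d hcd (by simpa using hd)
    refine List.Perm.eq_of_pairwise (le := (· < ·)) (fun x y _ _ h h' => by omega) hpa hpb ?_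
    refine (List.perm_ext_iff_of_nodup (hpa.imp fun h => h.ne) (hpb.imp fun h => h.ne)).2 ?_
    intro x
    simpa using h x
  exact (List.map_inj_left.1 hl) i (by simpa using hi)

/-- A semistandard tableau is the right key if its columns are last columns of appropriate skew
tableaux. -/
theorem IsRightKey.of_exists {μ : YoungDiagram} {S K : SemistandardYoungTableau μ}
    (h : ∀ j : Fin (μ.rowLen 0), ∃ T, IsFrank S j T ∧
      ∀ x, (∃ i < μ.colLen j, K i j = x) ↔ x ∈ lastColumn (μ.rowLen 0) T) : IsRightKey S K := by
  intro j
  obtain ⟨T₀, hT₀, hK⟩ := h j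
  refine ⟨⟨T₀, hT₀⟩, fun T hT i hi => ?_⟩
  have hin : T.inner.colLen (μ.rowLen 0 - 1) + μ.colLen j ≤ T.outer.colLen (μ.rowLen 0 - 1) := by
    have h₁ := hT.last
    have h₂ : 0 < μ.colLen j := by omega
    rw [SkewTableau.colLen] at h₁
    omega
  refine eq_of_strictMono_of_values (a := fun i => K i j)
    (b := fun i => T.entry (T.inner.colLen (μ.rowLen 0 - 1) + i) (μ.rowLen 0 - 1))
    (fun a b hab hb => K.col_strict hab (YoungDiagram.mem_iff_lt_colLen.2 hb))
    (fun a b hab hb => T.col_strict (by omega) ?_ ?_) (fun x => ?_) hi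
  · rw [YoungDiagram.mem_iff_lt_colLen]
    omega
  · rw [YoungDiagram.mem_iff_lt_colLen]
    omega
  · rw [hK, hT₀.lastColumn_eq hT, mem_lastColumn, hT.last]

/-! ### The configurations of the procedure -/

/-- If row `s` is empty in column `a`, the entry of row `r` in this column (if there is one) is
less than some entry of row `s` further to the left. -/
def Covered (F : Config) (r s a : ℕ) : Prop :=
  ∀ x, F r a = some x → F s a = none → ∃ b < a, ∃ y, F s b = some y ∧ x < y

/-- The properties of a configuration after the rows `0, …, P - 1` have been treated; `c` is the
number of columns. -/
structure IsSettled (c P : ℕ) (F : Config) : Prop where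
  ordered : IsOrdered F
  bound : ∀ r a, c ≤ a → F r a = none
  zero_col : ∀ r < P, (F r 0).isSome
  covered : ∀ r a, r + 1 < P → Covered F r (r + 1) a

/-- The properties of a configuration during the treatment of row `P - 1`, when the entry in row `r`
and column `k` is temporarily exposed. Compared to `IsSettled`, the relation between row `r` and the
row above is only known up to column `k`; to the right of it the row above is still related to the
row below row `r`, which has received the entries of row `r`. -/
structure IsExposing (c P : ℕ) (F : Config) (r k : ℕ) : Prop where
  ordered : IsOrdered F
  bound : ∀ r a, c ≤ a → F r a = none
  zero_col : ∀ r < P, (F r 0).isSome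
  row_lt : r < P
  isSome : (F r k).isSome
  last : ∀ b, k < b → F r b = none
  covered : ∀ t a, t + 1 < P → t + 1 ≠ r → Covered F t (t + 1) a
  covered_left : ∀ t, t + 1 = r → ∀ a ≤ k, Covered F t r a
  covered_right : ∀ t, t + 1 = r → r + 1 < P → ∀ a, k < a → Covered F t (r + 1) a

theorem leftmostGE_eq_some {c : ℕ} {F : Config} {r e j : ℕ} : leftmostGE c F r e = some j ↔
    j < c ∧ (∃ x, F r j = some x ∧ e ≤ x) ∧ ∀ a < j, ∀ x, F r a = some x → x < e := by
  rw [leftmostGE, List.find?_range_eq_some]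
  simp only [List.mem_range, Option.any_eq_true, decide_eq_true_eq, Bool.not_eq_true',
    Option.any_eq_false, decide_eq_false_iff_not, not_le]
  tauto

theorem leftmostGE_eq_none {c : ℕ} {F : Config} {r e : ℕ} : leftmostGE c F r e = none ↔
    ∀ a < c, ∀ x, F r a = some x → x < e := by
  rw [leftmostGE, List.find?_range_eq_none]
  simp only [Bool.not_eq_true', Option.any_eq_false, decide_eq_false_iff_not, not_le]

theorem entryLeftOf_spec {F : Config} {r j a : ℕ} (haj : a < j) (ha : (F r a).isSome) :
    a ≤ entryLeftOf F r j ∧ entryLeftOf F r j < j ∧ (F r (entryLeftOf F r j)).isSome ∧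
      ∀ b, entryLeftOf F r j < b → b < j → F r b = none := by
  have h := Nat.findGreatest_spec (P := fun k => k < j ∧ (F r k).isSome = true) haj.le ⟨haj, ha⟩
  refine ⟨Nat.le_findGreatest haj.le ⟨haj, ha⟩, h.1, h.2, fun b hb hbj => ?_⟩
  have := Nat.findGreatest_is_greatest hb hbj.le
  simpa [hbj] using this

section Step

variable {c P : ℕ} {F : Config} {r k j e : ℕ}

theorem IsExposing.le_of_row (h : IsExposing c P F r k) (he : F r k = some e) {a x : ℕ}
    (ha : F r a = some x) : a ≤ k ∧ x ≤ e := by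
  have hak : a ≤ k := by
    by_contra! hlt
    rw [h.last a hlt] at ha
    cases ha
  refine ⟨hak, ?_⟩
  rcases hak.eq_or_lt with rfl | hlt
  · rw [ha] at he
    simp at he
    omega
  · exact h.ordered.row hlt ha he

/-- The entries to be pushed down are to the right of the temporarily exposed entry. -/
theorem IsExposing.lt_leftmostGE (h : IsExposing c P F (r + 1) k) (he : F (r + 1) k = some e)
    (hj : leftmostGE c F r e = some j) : k < j := by
  obtain ⟨-, ⟨x, hx, hex⟩, -⟩ := leftmostGE_eq_some.1 hj
  by_contra! hjk
  rcases hy : F (r + 1) j with _ | y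
  · obtain ⟨b, -, y, hy, hxy⟩ := h.covered_left r rfl j hjk x hx hy
    have := (h.le_of_row he hy).2
    omega
  · have h₁ := h.ordered.col (Nat.lt_succ_self r) hx hy
    have h₂ := (h.le_of_row he hy).2
    omega

theorem pushDown_self (F : Config) (r j a : ℕ) :
    pushDown F r j r a = if j ≤ a then none else F r a := by
  by_cases h : j ≤ a <;> simp [pushDown, h]

theorem IsExposing.pushDown_succ (h : IsExposing c P F (r + 1) k) (hkj : k < j) (a : ℕ) :
    pushDown F r j (r + 1) a = if j ≤ a then F r a else F (r + 1) a := by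
  by_cases hja : j ≤ a
  · simp [pushDown, hja, h.last a (by omega)]
  · simp [pushDown, hja]

theorem pushDown_of_ne (F : Config) {r j t : ℕ} (h : t ≠ r) (h' : t ≠ r + 1) (a : ℕ) :
    pushDown F r j t a = F t a := by
  simp [pushDown, h, h']

/-- The step of the recursive subroutine. -/
theorem IsExposing.pushDown (h : IsExposing c P F (r + 1) k) (he : F (r + 1) k = some e)
    (hj : leftmostGE c F r e = some j) :
    IsExposing c P (pushDown F r j) r (entryLeftOf F r j) := by
  have hkj := h.lt_leftmostGE he hj
  obtain ⟨hjc, ⟨x₀, hx₀, hex₀⟩, hleft⟩ := leftmostGE_eq_some.1 hj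
  have hrP := h.row_lt
  obtain ⟨-, hk'j, hk', hgap⟩ := entryLeftOf_spec (F := F) (r := r) (j := j) (a := 0) (by omega)
    (h.zero_col r (by omega))
  set k' := entryLeftOf F r j
  have hG₁ := pushDown_self F r j
  have hG₂ := h.pushDown_succ hkj
  have hG₃ := fun {t} => pushDown_of_ne F (r := r) (j := j) (t := t)
  set G := RightKey.pushDown F r j
  have hlow : ∀ a < j, ∀ t, G t a = F t a := by
    intro a ha t
    rcases eq_or_ne t r with rfl | h₁
    · rw [hG₁, if_neg (by omega)]
    · rcases eq_or_ne t (r + 1) with rfl | h₂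
      · rw [hG₂, if_neg (by omega)]
      · exact hG₃ h₁ h₂ a
  have hkG : G (r + 1) k = some e := by rw [hlow k hkj, he]
  obtain ⟨e', he'⟩ := Option.isSome_iff_exists.1 hk'
  have hee' : e' < e := hleft _ hk'j _ he'
  refine ⟨⟨?_, ?_⟩, ?_, ?_, by omega, ?_, ?_, ?_, ?_, ?_⟩
  · intro t a b x y hab hx hy
    rcases eq_or_ne t r with rfl | h₁
    · rw [hG₁] at hx hy
      split_ifs at hx hy
      exact h.ordered.row hab hx hy
    · rcases eq_or_ne t (r + 1) with rfl | h₂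
      · rw [hG₂] at hx hy
        split_ifs at hx hy with h₃ h₄ h₄
        · exact h.ordered.row hab hx hy
        · omega
        · have h₅ := (h.le_of_row he hx).2
          rcases h₄.eq_or_lt with rfl | h₄
          · rw [hx₀] at hy
            simp at hy
            omega
          · have := h.ordered.row h₄ hx₀ hy
            omega
        · exact h.ordered.row hab hx hy
      · rw [hG₃ h₁ h₂] at hx hy
        exact h.ordered.row hab hx hy
  · intro t t' a x y ht hx hy
    rcases lt_or_ge a j with haj | haj
    · rw [hlow a haj] at hx hy
      exact h.ordered.col ht hx hy
    · -- in these columns the entry of row `r` is now in row `r + 1`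
      have key : ∀ t x, G t a = some x → t ≠ r ∧ F (if t = r + 1 then r else t) a = some x := by
        intro t x hx
        rcases eq_or_ne t r with rfl | h₁
        · rw [hG₁, if_pos haj] at hx
          cases hx
        · refine ⟨h₁, ?_⟩
          split_ifs with h₂
          · rwa [h₂, hG₂, if_pos haj] at hx
          · rwa [hG₃ h₁ h₂] at hx
      obtain ⟨h₁, hx⟩ := key t x hx
      obtain ⟨h₂, hy⟩ := key t' y hy
      refine h.ordered.col ?_ hx hy
      split_ifs <;> omega
  · intro t a hca
    rcases eq_or_ne t r with rfl | h₁
    · rw [hG₁, if_pos (by omega)]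
    · rcases eq_or_ne t (r + 1) with rfl | h₂
      · rw [hG₂, h.bound _ _ hca, h.bound _ _ hca, ite_self]
      · rw [hG₃ h₁ h₂, h.bound _ _ hca]
  · intro t ht
    rw [hlow 0 (by omega)]
    exact h.zero_col t ht
  · rw [hlow k' hk'j]
    exact hk'
  · intro b hb
    rw [hG₁]
    split_ifs with hjb
    · rfl
    · exact hgap b hb (by omega)
  · -- the other pairs of adjacent rows
    intro t a htP htr
    rcases eq_or_ne t r with rfl | h₁
    · intro x hx hn
      rw [hG₁] at hx
      split_ifs at hx with hja
      rw [hG₂, if_neg hja] at hn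
      rcases le_or_gt a k with hak | hak
      · obtain ⟨b, hb, y, hy, hxy⟩ := h.covered_left t rfl a hak x hx hn
        exact ⟨b, hb, y, by rwa [hlow b (by omega)], hxy⟩
      · exact ⟨k, hak, e, hkG, hleft a (by omega) x hx⟩
    · rcases eq_or_ne t (r + 1) with rfl | h₂
      · intro x hx hn
        rw [hG₃ (by omega) (by omega)] at hn
        have hrow : ∀ b, G (r + 1 + 1) b = F (r + 1 + 1) b := hG₃ (by omega) (by omega)
        simp only [hrow]
        rw [hG₂] at hx
        split_ifs at hx with hja
        · exact h.covered_right r rfl htP a (by omega) x hx hn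
        · exact h.covered (r + 1) a htP (by omega) x hx hn
      · intro x hx hn
        rw [hG₃ h₁ h₂] at hx
        have hrow : ∀ b, G (t + 1) b = F (t + 1) b := hG₃ htr (by omega)
        simp only [hrow] at hn ⊢
        exact h.covered t a htP (by omega) x hx hn
  · rintro t rfl a hak' x hx hn
    rw [hG₃ (by omega) (by omega)] at hx
    rw [hlow a (by omega)] at hn
    obtain ⟨b, hb, y, hy, hxy⟩ := h.covered t a (by omega) (by omega) x hx hn
    exact ⟨b, hb, y, by rwa [hlow b (by omega)], hxy⟩
  · rintro t rfl htP a hak' x hx hn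
    rw [hG₃ (by omega) (by omega)] at hx
    rw [hG₂] at hn
    rcases lt_or_ge a j with haj | haj
    · rw [if_neg (by omega)] at hn
      obtain ⟨b, hb, y, hy, hxy⟩ := h.covered t a (by omega) (by omega) x hx (hgap a hak' haj)
      rcases lt_or_ge k a with hka | hka
      · exact ⟨k, hka, e, hkG, hxy.trans (hleft b (by omega) y hy)⟩
      · -- the entry `y` of row `t + 1` is in turn related to row `t + 2`
        rcases hz : F (t + 1 + 1) b with _ | z
        · obtain ⟨b', hb', z, hz, hyz⟩ := h.covered_left (t + 1) rfl b (by omega) y hy hz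
          exact ⟨b', by omega, z, by rwa [hlow b' (by omega)], hxy.trans hyz⟩
        · have := h.ordered.col (Nat.lt_succ_self _) hy hz
          exact ⟨b, hb, z, by rwa [hlow b (by omega)], hxy.trans this⟩
    · rw [if_pos haj] at hn
      obtain ⟨b, hb, y, hy, hxy⟩ := h.covered t a (by omega) (by omega) x hx hn
      rcases lt_or_ge b j with hbj | hbj
      · have hja : j < a := by
          rcases haj.eq_or_lt with rfl | hlt
          · rw [hx₀] at hn
            cases hn
          · exact hlt
        refine ⟨j, hja, x₀, by rwa [hG₂, if_pos le_rfl], ?_⟩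
        have := h.ordered.row hbj hy hx₀
        omega
      · exact ⟨b, hb, y, by rwa [hG₂, if_pos hbj], hxy⟩

/-- The end of the recursive subroutine. -/
theorem IsExposing.isSettled (h : IsExposing c P F r k) (he : F r k = some e)
    (hn : ∀ t, t + 1 = r → leftmostGE c F t e = none) : IsSettled c P F := by
  refine ⟨h.ordered, h.bound, h.zero_col, fun t a ht => ?_⟩
  by_cases htr : t + 1 = r
  · subst htr
    rcases le_or_gt a k with hak | hak
    · exact h.covered_left t rfl a hak
    · intro x hx _
      have hac : a < c := by
        by_contra! hca
        rw [h.bound _ _ hca] at hx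
        cases hx
      exact ⟨k, hak, e, he, leftmostGE_eq_none.1 (hn t rfl) a hac x hx⟩
  · exact h.covered t a ht htr

end Step

/-- `x` is the rightmost entry of row `r`. -/
def IsRowEnd (F : Config) (r x : ℕ) : Prop :=
  ∃ a, F r a = some x ∧ ∀ b, a < b → F r b = none

theorem IsRowEnd.congr {F G : Config} {r s x : ℕ} (h : IsRowEnd F r x)
    (hFG : ∀ a, F r a = G s a) : IsRowEnd G s x := by
  obtain ⟨a, ha, hb⟩ := h
  exact ⟨a, by rw [← hFG, ha], fun b hab => by rw [← hFG, hb b hab]⟩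

theorem exists_le_iff {p : ℕ → Prop} {i : ℕ} : (∃ t ≤ i, p t) ↔ (∃ t < i, p t) ∨ p i := by
  simp only [Nat.le_iff_lt_or_eq, or_and_right, exists_or, exists_eq_left]

/-- The effect of the recursive subroutine started in row `r` with exposed value `e`: the exposed
value `φ` in the end is less than or equal to `e`, and it is inserted into the sequence of row ends
at some position `p`. -/
structure ExposeSpec (c P r k e : ℕ) (F G : Config) (φ : ℕ) : Prop where
  settled : IsSettled c P G
  below : ∀ t, r < t → ∀ a, G t a = F t a
  left : ∀ a ≤ k, G r a = F r a
  column : ∀ a x, (∃ t ≤ r, G t a = some x) ↔ ∃ t ≤ r, F t a = some x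
  value_le : φ ≤ e
  ends : ∃ p ≤ r, IsRowEnd G p φ ∧ (∀ t < p, ∀ a, G t a = F t a) ∧
    ∀ t, p ≤ t → t < r → ∀ x, IsRowEnd F t x → IsRowEnd G (t + 1) x

theorem IsExposing.exposeSpec_self {c P r k e : ℕ} {F : Config} (h : IsExposing c P F r k)
    (he : F r k = some e) (hn : ∀ t, t + 1 = r → leftmostGE c F t e = none) :
    ExposeSpec c P r k e F F e :=
  ⟨h.isSettled he hn, fun _ _ _ => rfl, fun _ _ => rfl, fun _ _ => Iff.rfl, le_rfl,
    r, le_rfl, ⟨k, he, h.last⟩, fun _ _ _ => rfl, fun t h₁ h₂ => by omega⟩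

theorem IsExposing.exposeSpec {c P r k e : ℕ} {F : Config} (h : IsExposing c P F r k)
    (he : F r k = some e) : ExposeSpec c P r k e F (expose c r k F).1 (expose c r k F).2 := by
  induction r generalizing F k e with
  | zero =>
    have : expose c 0 k F = (F, e) := by simp [expose, he]
    rw [this]
    exact h.exposeSpec_self he (by simp)
  | succ r ih =>
    rcases hj : leftmostGE c F r e with _ | j
    · have : expose c (r + 1) k F = (F, e) := by simp [expose, he, hj]
      rw [this]
      exact h.exposeSpec_self he (by
        intro t ht
        obtain rfl : t = r := by omega
        exact hj)
    · have hex : expose c (r + 1) k F = expose c r (entryLeftOf F r j) (RightKey.pushDown F r j) := by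
        rw [expose]
        simp [he, hj]
      rw [hex]
      have hG := h.pushDown he hj
      have hkj := h.lt_leftmostGE he hj
      obtain ⟨hjc, ⟨x₀, hx₀, hex₀⟩, hleft⟩ := leftmostGE_eq_some.1 hj
      have hG₁ := pushDown_self F r j
      have hG₂ := h.pushDown_succ hkj
      have hG₃ := fun {t} => pushDown_of_ne F (r := r) (j := j) (t := t)
      obtain ⟨-, hk'j, hk', -⟩ := entryLeftOf_spec (F := F) (r := r) (j := j) (a := 0) (by omega)
        (h.zero_col r (by have := h.row_lt; omega))
      set k' := entryLeftOf F r j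
      obtain ⟨e', he'⟩ := Option.isSome_iff_exists.1 hk'
      have hGk' : RightKey.pushDown F r j r k' = some e' := by rw [hG₁, if_neg (by omega), he']
      have hee' : e' < e := hleft _ hk'j _ he'
      have H := ih hG hGk'
      obtain ⟨p, hpr, hp₁, hp₂, hp₃⟩ := H.ends
      refine ⟨H.settled, ?_, ?_, ?_, H.value_le.trans hee'.le, p, by omega, hp₁, ?_, ?_⟩
      · intro t ht a
        rw [H.below t (by omega), hG₃ (by omega) (by omega)]
      · intro a hak
        rw [H.below _ (Nat.lt_succ_self r), hG₂, if_neg (by omega)]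
      · intro a x
        have hsucc : ∀ K : Config, (∃ t ≤ r + 1, K t a = some x) ↔
            (∃ t ≤ r, K t a = some x) ∨ K (r + 1) a = some x := fun K => by
          rw [exists_le_iff]
          simp only [Nat.lt_succ_iff]
        rw [hsucc, H.column, H.below _ (Nat.lt_succ_self r), ← hsucc]
        rcases lt_or_ge a j with haj | haj
        · have : ∀ t, RightKey.pushDown F r j t a = F t a := by
            intro t
            rcases eq_or_ne t r with rfl | h₁
            · rw [hG₁, if_neg (by omega)]
            · rcases eq_or_ne t (r + 1) with rfl | h₂
              · rw [hG₂, if_neg (by omega)]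
              · exact hG₃ h₁ h₂ a
          simp only [this]
        · constructor
          · rintro ⟨t, ht, hx⟩
            rcases eq_or_ne t r with rfl | h₁
            · rw [hG₁, if_pos haj] at hx
              cases hx
            · rcases eq_or_ne t (r + 1) with rfl | h₂
              · rw [hG₂, if_pos haj] at hx
                exact ⟨r, by omega, hx⟩
              · rw [hG₃ h₁ h₂] at hx
                exact ⟨t, ht, hx⟩
          · rintro ⟨t, ht, hx⟩
            rcases eq_or_ne t r with rfl | h₁
            · exact ⟨t + 1, le_rfl, by rwa [hG₂, if_pos haj]⟩
            · rcases eq_or_ne t (r + 1) with rfl | h₂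
              · rw [h.last a (by omega)] at hx
                cases hx
              · exact ⟨t, ht, by rwa [hG₃ h₁ h₂]⟩
      · intro t ht a
        rcases eq_or_ne t r with rfl | h₁
        · omega
        · rw [hp₂ t ht, hG₃ h₁ (by omega)]
      · intro t hpt htr x hx
        rcases eq_or_ne t r with rfl | h₁
        · -- the rightmost entry of this row has been pushed down
          obtain ⟨a, ha, hab⟩ := hx
          have hja : j ≤ a := by
            by_contra! hlt
            rw [hab j hlt] at hx₀
            cases hx₀
          refine ⟨a, ?_, fun b hb => ?_⟩
          · rw [H.below _ (Nat.lt_succ_self t), hG₂, if_pos hja, ha]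
          · rw [H.below _ (Nat.lt_succ_self t), hG₂, if_pos (by omega), hab b hb]
        · exact hp₃ t hpt (by omega) x (hx.congr fun a => (hG₃ h₁ (by omega) a).symm)

/-! ### Exposed values and row ends -/

theorem expose_zero {c k e : ℕ} {F : Config} (he : F 0 k = some e) : expose c 0 k F = (F, e) := by
  simp [expose, he]

theorem expose_of_none {c r k e : ℕ} {F : Config} (he : F (r + 1) k = some e)
    (h : leftmostGE c F r e = none) : expose c (r + 1) k F = (F, e) := by
  simp [expose, he, h]

theorem expose_of_some {c r k e j : ℕ} {F : Config} (he : F (r + 1) k = some e)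
    (h : leftmostGE c F r e = some j) :
    expose c (r + 1) k F = expose c r (entryLeftOf F r j) (pushDown F r j) := by
  rw [expose]
  simp [he, h]

/-- An entry less than `f` in the row above is a lower bound for the next exposed entry. -/
theorem IsExposing.exists_exposed_ge {c P r k a e f j : ℕ} {F : Config}
    (h : IsExposing c P F (r + 1) k) (hj : leftmostGE c F r f = some j) (ha : F r a = some e)
    (hef : e < f) : ∃ f' ≥ e, RightKey.pushDown F r j r (entryLeftOf F r j) = some f' := by
  obtain ⟨-, ⟨x, hx, hfx⟩, -⟩ := leftmostGE_eq_some.1 hj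
  have haj : a < j := by
    by_contra! hja
    rcases hja.eq_or_lt with rfl | hlt
    · rw [ha] at hx
      simp at hx
      omega
    · have := h.ordered.row hlt hx ha
      omega
  obtain ⟨hak, hkj, hk, -⟩ := entryLeftOf_spec (F := F) (r := r) haj (by simp [ha])
  obtain ⟨f', hf'⟩ := Option.isSome_iff_exists.1 hk
  refine ⟨f', ?_, by rw [pushDown_self, if_neg (by omega), hf']⟩
  rcases hak.eq_or_lt with heq | hlt
  · rw [← heq, ha] at hf'
    simp at hf'
    omega
  · exact h.ordered.row hlt ha hf'

/-- Comparison of two consecutive applications of the recursive subroutine: in the second one all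
exposed values are at least as large as those in the first one. -/
theorem IsExposing.expose_le {c P P' r k k' e f : ℕ} {F H : Config} (h : IsExposing c P F r k)
    (he : F r k = some e) (h' : IsExposing c P' H r k') (hf : H r k' = some f) (hef : e ≤ f)
    (hH : ∀ t < r, ∀ a, H t a = (expose c r k F).1 t a) :
    (expose c r k F).2 ≤ (expose c r k' H).2 := by
  induction r generalizing F H k k' e f with
  | zero =>
    rw [expose_zero he, expose_zero hf]
    exact hef
  | succ r ih =>
    rcases hj' : leftmostGE c H r f with _ | j'
    · rw [expose_of_none hf hj']
      exact (h.exposeSpec he).value_le.trans hef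
    · rcases hj : leftmostGE c F r e with _ | j
      · rw [expose_of_none he hj] at hH
        obtain ⟨hjc, ⟨x, hx, hfx⟩, -⟩ := leftmostGE_eq_some.1 hj'
        rw [hH r (Nat.lt_succ_self r)] at hx
        have := leftmostGE_eq_none.1 hj j' hjc x hx
        omega
      · rw [expose_of_some he hj] at hH ⊢
        rw [expose_of_some hf hj']
        have hF := h.pushDown he hj
        have hH' := h'.pushDown hf hj'
        obtain ⟨e', he'⟩ := Option.isSome_iff_exists.1 hF.isSome
        have hpos : ∃ a, F r a = some e' ∧ e' < e := by
          rw [pushDown_self] at he'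
          split_ifs at he' with hle
          exact ⟨_, he', (leftmostGE_eq_some.1 hj).2.2 _ (by omega) _ he'⟩
        have hee' : e' < e := hpos.choose_spec.2
        have hHe : H r (entryLeftOf F r j) = some e' := by
          rw [hH r (Nat.lt_succ_self r), (hF.exposeSpec he').left _ le_rfl, he']
        obtain ⟨f', hf', hf'H⟩ := h'.exists_exposed_ge hj' hHe (by omega)
        refine ih hF he' hH' hf'H hf' fun t ht a => ?_
        rw [pushDown_of_ne _ (by omega) (by omega), hH t (by omega)]

/-- The last entry of row `r` in the columns to the left of column `k`. -/
def lastBefore (F : Config) (r : ℕ) : ℕ → ℕ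
  | 0 => 0
  | k + 1 => (F r k).getD (lastBefore F r k)

theorem exists_lastBefore {F : Config} {r k : ℕ} (h : (F r 0).isSome) (hk : 0 < k) :
    ∃ a < k, F r a = some (lastBefore F r k) ∧ ∀ b, a < b → b < k → F r b = none := by
  induction k with
  | zero => omega
  | succ k ih =>
    rcases hF : F r k with _ | x
    · have hk' : 0 < k := by
        rcases Nat.eq_zero_or_pos k with rfl | h'
        · simp [hF] at h
        · exact h'
      obtain ⟨a, hak, ha, hb⟩ := ih hk'
      refine ⟨a, by omega, by simp [lastBefore, hF, ha], fun b hab hbk => ?_⟩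
      rcases eq_or_ne b k with rfl | hne
      · exact hF
      · exact hb b hab (by omega)
    · exact ⟨k, by omega, by simp [lastBefore, hF], fun b hab hbk => by omega⟩

theorem IsOrdered.le_lastBefore {F : Config} (hF : IsOrdered F) {r k a x : ℕ} (hak : a < k)
    (ha : F r a = some x) : x ≤ lastBefore F r k := by
  induction k with
  | zero => omega
  | succ k ih =>
    rcases hFk : F r k with _ | y
    · have hne : a ≠ k := by
        rintro rfl
        simp [ha] at hFk
      simpa [lastBefore, hFk] using ih (by omega)
    · rcases (Nat.lt_succ_iff.1 hak).eq_or_lt with rfl | hlt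
      · simp [lastBefore, ha]
      · simpa [lastBefore, hFk] using hF.row hlt ha hFk

theorem IsRowEnd.lastBefore_eq {c : ℕ} {F : Config} {r x : ℕ} (hF : ∀ a, c ≤ a → F r a = none)
    (h : IsRowEnd F r x) : lastBefore F r c = x := by
  obtain ⟨a, ha, hb⟩ := h
  have hac : a < c := by
    by_contra! hca
    simp [hF a hca] at ha
  have : ∀ k, a < k → lastBefore F r k = x := by
    intro k
    induction k with
    | zero => omega
    | succ k ih =>
      intro hak
      rcases (Nat.lt_succ_iff.1 hak).eq_or_lt with rfl | hlt
      · simp [lastBefore, ha]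
      · simp [lastBefore, hb k hlt, ih hlt]
  exact this c hac

section Settled

variable {c P : ℕ} {F : Config}

theorem IsSettled.lastBefore_lt_succ (h : IsSettled c P F) {r k : ℕ} (hr : r + 1 < P)
    (hk : 0 < k) : lastBefore F r k < lastBefore F (r + 1) k := by
  induction k with
  | zero => omega
  | succ k ih =>
    rcases Nat.eq_zero_or_pos k with rfl | hk
    · obtain ⟨x, hx⟩ := Option.isSome_iff_exists.1 (h.zero_col r (by omega))
      obtain ⟨y, hy⟩ := Option.isSome_iff_exists.1 (h.zero_col (r + 1) hr)
      simpa [lastBefore, hx, hy] using h.ordered.col (Nat.lt_succ_self r) hx hy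
    · have ih := ih hk
      rcases hx : F r k with _ | x <;> rcases hy : F (r + 1) k with _ | y
      · simpa [lastBefore, hx, hy] using ih
      · obtain ⟨a, hak, ha, -⟩ := exists_lastBefore (h.zero_col (r + 1) hr) hk
        have := h.ordered.row hak ha hy
        simp only [lastBefore, hx, hy, Option.getD_none, Option.getD_some]
        omega
      · obtain ⟨b, hbk, y, hb, hxy⟩ := h.covered r k hr x hx hy
        have := h.ordered.le_lastBefore hbk hb
        simp only [lastBefore, hx, hy, Option.getD_none, Option.getD_some]
        omega
      · simpa [lastBefore, hx, hy] using h.ordered.col (Nat.lt_succ_self r) hx hy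

/-- The last entries of the rows, up to any given column, increase from the top to the bottom. -/
theorem IsSettled.lastBefore_lt (h : IsSettled c P F) {r r' k : ℕ} (hr : r < r') (hr' : r' < P)
    (hk : 0 < k) : lastBefore F r k < lastBefore F r' k := by
  induction r', hr using Nat.le_induction with
  | base => exact h.lastBefore_lt_succ hr' hk
  | succ s hs ih => exact (ih (by omega)).trans (h.lastBefore_lt_succ hr' hk)

theorem IsSettled.isRowEnd (h : IsSettled c P F) (hc : 0 < c) {r : ℕ} (hr : r < P) :
    IsRowEnd F r (lastBefore F r c) := by
  obtain ⟨a, hac, ha, hb⟩ := exists_lastBefore (h.zero_col r hr) hc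
  refine ⟨a, ha, fun b hab => ?_⟩
  rcases lt_or_ge b c with hbc | hbc
  · exact hb b hab hbc
  · exact h.bound r b hbc

end Settled

section Stage

variable {μ : YoungDiagram} (S : SemistandardYoungTableau μ)

theorem initialConfig_eq_some {i j x : ℕ} :
    initialConfig S i j = some x ↔ (i, j) ∈ μ ∧ S i j = x := by
  simp [initialConfig]

theorem initialConfig_isOrdered : IsOrdered (initialConfig S) := by
  constructor
  · intro r a b x y hab hx hy
    rw [initialConfig_eq_some] at hx hy
    rw [← hx.2, ← hy.2]
    exact S.row_weak hab hy.1
  · intro r r' a x y hr hx hy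
    rw [initialConfig_eq_some] at hx hy
    rw [← hx.2, ← hy.2]
    exact S.col_strict hr hy.1

theorem initialConfig_bound (r a : ℕ) (h : μ.rowLen 0 ≤ a) : initialConfig S r a = none := by
  refine if_neg fun hm => ?_
  have := lt_rowLen_zero_of_mem hm
  omega

theorem mem_of_lt_colLen_zero {r : ℕ} (h : r < μ.colLen 0) : (r, 0) ∈ μ :=
  YoungDiagram.mem_iff_lt_colLen.2 h

theorem rowLen_pos {r : ℕ} (h : r < μ.colLen 0) : 0 < μ.rowLen r :=
  YoungDiagram.mem_iff_lt_rowLen.1 (mem_of_lt_colLen_zero h)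

theorem initialConfig_zero_col {r : ℕ} (h : r < μ.colLen 0) : (initialConfig S r 0).isSome := by
  simp [initialConfig, mem_of_lt_colLen_zero h]

/-- The configuration before row `i` is treated. -/
def previousConfig : ℕ → Config
  | 0 => initialConfig S
  | i + 1 => (stage S i).1

/-- The rightmost entry of row `r` of the tableau is in column `μ.rowLen r - 1`. -/
theorem initialConfig_last {r : ℕ} (h : r < μ.colLen 0) :
    initialConfig S r (μ.rowLen r - 1) = some (S r (μ.rowLen r - 1)) ∧
      ∀ b, μ.rowLen r - 1 < b → initialConfig S r b = none := by
  have := rowLen_pos h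
  constructor
  · rw [initialConfig_eq_some, YoungDiagram.mem_iff_lt_rowLen]
    exact ⟨by omega, rfl⟩
  · intro b hb
    refine if_neg fun hm => ?_
    rw [YoungDiagram.mem_iff_lt_rowLen] at hm
    omega

theorem entryLeftOf_initialConfig {F : Config} {r : ℕ} (h : r < μ.colLen 0)
    (hF : ∀ a, F r a = initialConfig S r a) :
    entryLeftOf F r (μ.rowLen 0) = μ.rowLen r - 1 := by
  have hpos := rowLen_pos h
  have hle := μ.rowLen_anti 0 r (Nat.zero_le r)
  obtain ⟨h₁, h₂, h₃, -⟩ := entryLeftOf_spec (F := F) (r := r) (j := μ.rowLen 0)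
    (a := μ.rowLen r - 1) (by omega) (by rw [hF, (initialConfig_last S h).1]; rfl)
  refine le_antisymm ?_ h₁
  by_contra! hlt
  rw [hF, (initialConfig_last S h).2 _ hlt] at h₃
  cases h₃

/-- Each configuration of the procedure arises from the previous one by the recursive subroutine. -/
theorem stage_spec {i : ℕ} (hi : i < μ.colLen 0) :
    stage S i = expose (μ.rowLen 0) i (μ.rowLen i - 1) (previousConfig S i) ∧
      IsExposing (μ.rowLen 0) (i + 1) (previousConfig S i) i (μ.rowLen i - 1) ∧
      previousConfig S i i (μ.rowLen i - 1) = some (S i (μ.rowLen i - 1)) ∧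
      (∀ t, i ≤ t → ∀ a, previousConfig S i t a = initialConfig S t a) ∧
      ∀ a x, (∃ t < i, previousConfig S i t a = some x) ↔
        ∃ t < i, initialConfig S t a = some x := by
  induction i with
  | zero =>
    refine ⟨?_, ⟨initialConfig_isOrdered S, initialConfig_bound S,
      fun r hr => initialConfig_zero_col S (by omega), by omega, ?_, (initialConfig_last S hi).2,
      fun t a ht => by omega, fun t ht => by omega, fun t ht => by omega⟩,
      (initialConfig_last S hi).1, fun _ _ _ => rfl, fun a x => by simp⟩
    · rw [previousConfig, expose_zero (initialConfig_last S hi).1]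
      rfl
    · rw [previousConfig, (initialConfig_last S hi).1]
      rfl
  | succ i ih =>
    obtain ⟨hst, hex, he, hbelow, hcol⟩ := ih (by omega)
    have spec := hex.exposeSpec he
    rw [← hst] at spec
    have hinit : ∀ t, i + 1 ≤ t → ∀ a, (stage S i).1 t a = initialConfig S t a := by
      intro t ht a
      rw [spec.below t (by omega), hbelow t (by omega)]
    have hlast := initialConfig_last S hi
    have hk := entryLeftOf_initialConfig S hi (hinit (i + 1) le_rfl)
    refine ⟨?_, ⟨spec.settled.ordered, spec.settled.bound, ?_, by omega, ?_, ?_, ?_, ?_, ?_⟩, ?_,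
      hinit, ?_⟩
    · rw [stage, hk]
      rfl
    · intro r hr
      rcases Nat.lt_succ_iff_lt_or_eq.1 hr with hr | rfl
      · exact spec.settled.zero_col r hr
      · rw [previousConfig, hinit _ le_rfl]
        exact initialConfig_zero_col S hi
    · rw [previousConfig, hinit _ le_rfl, hlast.1]
      rfl
    · intro b hb
      rw [previousConfig, hinit _ le_rfl, hlast.2 b hb]
    · exact fun t a ht htne => spec.settled.covered t a (by omega)
    · intro t ht a ha x hx hn
      rw [previousConfig, hinit _ le_rfl] at hn
      have hmem : (i + 1, a) ∈ μ := by
        have := rowLen_pos hi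
        rw [YoungDiagram.mem_iff_lt_rowLen]
        omega
      simp [initialConfig, hmem] at hn
    · intro t ht hlt
      omega
    · rw [previousConfig, hinit _ le_rfl, hlast.1]
    · intro a x
      simp only [Nat.lt_succ_iff, previousConfig]
      rw [spec.column, exists_le_iff, hcol, hbelow i le_rfl, ← exists_le_iff]

theorem stage_exposeSpec {i : ℕ} (hi : i < μ.colLen 0) :
    ExposeSpec (μ.rowLen 0) (i + 1) i (μ.rowLen i - 1) (S i (μ.rowLen i - 1))
      (previousConfig S i) (stage S i).1 (stage S i).2 := by
  obtain ⟨hst, hex, he, -⟩ := stage_spec S hi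
  rw [hst]
  exact hex.exposeSpec he

theorem stage_isSettled {i : ℕ} (hi : i < μ.colLen 0) :
    IsSettled (μ.rowLen 0) (i + 1) (stage S i).1 :=
  (stage_exposeSpec S hi).settled

/-- The procedure moves entries only within their columns. -/
theorem stage_column {i : ℕ} (hi : i < μ.colLen 0) (a x : ℕ) :
    (∃ t ≤ i, (stage S i).1 t a = some x) ↔ ∃ t ≤ i, initialConfig S t a = some x := by
  obtain ⟨-, -, -, hbelow, hcol⟩ := stage_spec S hi
  rw [(stage_exposeSpec S hi).column, exists_le_iff, hcol, hbelow i le_rfl, ← exists_le_iff]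

/-- The rightmost entry of row `r` after the treatment of row `i`. -/
def stageEnd (i r : ℕ) : ℕ := lastBefore (stage S i).1 r (μ.rowLen 0)

theorem rowLen_zero_pos {i : ℕ} (hi : i < μ.colLen 0) : 0 < μ.rowLen 0 :=
  rowLen_pos (by omega)

theorem stageEnd_lt {i r r' : ℕ} (hi : i < μ.colLen 0) (hr : r < r') (hr' : r' ≤ i) :
    stageEnd S i r < stageEnd S i r' :=
  (stage_isSettled S hi).lastBefore_lt hr (by omega) (rowLen_zero_pos hi)

theorem stageEnd_zero (h : 0 < μ.colLen 0) : stageEnd S 0 0 = (stage S 0).2 := by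
  refine IsRowEnd.lastBefore_eq (fun a ha => initialConfig_bound S 0 a ha) ?_
  exact ⟨_, (initialConfig_last S h).1, (initialConfig_last S h).2⟩

/-- The exposed value is inserted into the sequence of row ends. -/
theorem stageEnd_succ {i : ℕ} (hi : i + 1 < μ.colLen 0) :
    ∃ p ≤ i + 1, stageEnd S (i + 1) p = (stage S (i + 1)).2 ∧
      (∀ t < p, stageEnd S (i + 1) t = stageEnd S i t) ∧
      ∀ t, p ≤ t → t ≤ i → stageEnd S (i + 1) (t + 1) = stageEnd S i t := by
  have spec := stage_exposeSpec S hi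
  have hprev := stage_isSettled S (i := i) (by omega)
  have hc := rowLen_zero_pos hi
  obtain ⟨p, hp, h₁, h₂, h₃⟩ := spec.ends
  refine ⟨p, hp, h₁.lastBefore_eq (spec.settled.bound p), fun t ht => ?_, fun t hpt hti => ?_⟩
  · exact ((hprev.isRowEnd hc (by omega)).congr fun a => (h₂ t ht a).symm).lastBefore_eq
      (spec.settled.bound t)
  · exact (h₃ t hpt (by omega) _ (hprev.isRowEnd hc (by omega))).lastBefore_eq
      (spec.settled.bound _)

theorem stageEnd_succ_le {i r : ℕ} (hi : i + 1 < μ.colLen 0) (hr : r ≤ i) :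
    stageEnd S (i + 1) r ≤ stageEnd S i r := by
  obtain ⟨p, hp, -, h₂, h₃⟩ := stageEnd_succ S hi
  rcases lt_or_ge r p with h | h
  · exact (h₂ r h).le
  · rw [← h₃ r h hr]
    exact (stageEnd_lt S hi (Nat.lt_succ_self r) (by omega)).le

theorem stageEnd_anti {i i' r : ℕ} (hii' : i ≤ i') (hi' : i' < μ.colLen 0) (hr : r ≤ i) :
    stageEnd S i' r ≤ stageEnd S i r := by
  induction i', hii' using Nat.le_induction with
  | base => exact le_rfl
  | succ k hk ih => exact (stageEnd_succ_le S hi' (by omega)).trans (ih (by omega))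

/-- The row ends after the treatment of row `i` are the values exposed so far. -/
theorem exists_stageEnd_iff {i : ℕ} (hi : i < μ.colLen 0) (x : ℕ) :
    (∃ r ≤ i, stageEnd S i r = x) ↔ ∃ t ≤ i, (stage S t).2 = x := by
  induction i with
  | zero => simp [stageEnd_zero S hi]
  | succ i ih =>
    have ih := ih (by omega)
    obtain ⟨p, hp, h₁, h₂, h₃⟩ := stageEnd_succ S hi
    constructor
    · rintro ⟨r, hr, hx⟩
      rcases lt_trichotomy r p with hlt | rfl | hlt
      · obtain ⟨t, ht, h⟩ := ih.1 ⟨r, by omega, (h₂ r hlt).symm.trans hx⟩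
        exact ⟨t, by omega, h⟩
      · exact ⟨i + 1, le_rfl, h₁.symm.trans hx⟩
      · obtain ⟨r, rfl⟩ : ∃ s, r = s + 1 := ⟨r - 1, by omega⟩
        obtain ⟨t, ht, h⟩ := ih.1 ⟨r, by omega, (h₃ r (by omega) (by omega)).symm.trans hx⟩
        exact ⟨t, by omega, h⟩
    · rintro ⟨t, ht, hx⟩
      rcases ht.eq_or_lt with rfl | ht
      · exact ⟨p, hp, h₁.trans hx⟩
      · obtain ⟨r, hr, h⟩ := ih.2 ⟨t, by omega, hx⟩
        rcases lt_or_ge r p with hlt | hge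
        · exact ⟨r, by omega, by rw [h₂ r hlt, h]⟩
        · exact ⟨r + 1, by omega, by rw [h₃ r hge hr, h]⟩

/-- The values exposed in different steps are different. -/
theorem stage_snd_ne {i i' : ℕ} (hii' : i < i') (hi' : i' < μ.colLen 0) :
    (stage S i).2 ≠ (stage S i').2 := by
  obtain ⟨k, rfl⟩ : ∃ k, i' = k + 1 := ⟨i' - 1, by omega⟩
  intro heq
  obtain ⟨p, hp, h₁, h₂, h₃⟩ := stageEnd_succ S hi'
  obtain ⟨r, hr, h⟩ := (exists_stageEnd_iff S (i := k) (by omega) _).2 ⟨i, by omega, heq⟩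
  rcases lt_or_ge r p with hlt | hge
  · have := stageEnd_lt S hi' hlt hp
    have := h₂ r hlt
    omega
  · have := stageEnd_lt S hi' (show p < r + 1 by omega) (by omega)
    have := h₃ r hge hr
    omega

/-- The exposed values are entries of the tableau. -/
theorem exists_stage_snd {i : ℕ} (hi : i < μ.colLen 0) :
    ∃ r c, (r, c) ∈ μ ∧ (stage S i).2 = S r c := by
  obtain ⟨p, hp, ⟨a, ha, -⟩, -⟩ := (stage_exposeSpec S hi).ends
  obtain ⟨t, -, h⟩ := (stage_column S hi a _).1 ⟨p, hp, ha⟩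
  rw [initialConfig_eq_some] at h
  exact ⟨t, a, h.1, h.2.symm⟩

/-- The values exposed for adjacent rows of the same length are increasing. -/
theorem stage_snd_lt {i : ℕ} (hi : i + 1 < μ.colLen 0) (h : μ.rowLen i = μ.rowLen (i + 1)) :
    (stage S i).2 < (stage S (i + 1)).2 := by
  refine lt_of_le_of_ne ?_ (stage_snd_ne S (Nat.lt_succ_self i) hi)
  obtain ⟨hst, hex, he, -, -⟩ := stage_spec S (i := i) (by omega)
  obtain ⟨hst', hex', he', -, -⟩ := stage_spec S hi
  have spec := stage_exposeSpec S (i := i) (by omega)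
  have hlt : S i (μ.rowLen i - 1) < S (i + 1) (μ.rowLen (i + 1) - 1) := by
    rw [h]
    refine S.col_strict (Nat.lt_succ_self i) (YoungDiagram.mem_iff_lt_rowLen.2 ?_)
    have := rowLen_pos hi
    omega
  rcases hj : leftmostGE (μ.rowLen 0) (previousConfig S (i + 1)) i
    (S (i + 1) (μ.rowLen (i + 1) - 1)) with _ | j
  · rw [hst', expose_of_none he' hj]
    exact spec.value_le.trans hlt.le
  · have hprev : previousConfig S (i + 1) i (μ.rowLen i - 1) = some (S i (μ.rowLen i - 1)) := by
      rw [previousConfig, spec.left _ le_rfl, he]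
    obtain ⟨f, hf, hfe⟩ := hex'.exists_exposed_ge hj hprev hlt
    rw [hst', expose_of_some he' hj]
    rw [hst]
    refine hex.expose_le he (hex'.pushDown he' hj) hfe hf fun t ht a => ?_
    rw [pushDown_of_ne _ (by omega) (by omega), previousConfig, hst]

end Stage

/-! ### Skew tableaux with prescribed columns -/

/-- The Young diagram with the columns of the lengths `L 0 ≥ L 1 ≥ ⋯`, where `L c = 0`. -/
def diagramOfColLens (c : ℕ) (L : ℕ → ℕ) (hL : Antitone L) : YoungDiagram where
  cells := (Finset.range (L 0) ×ˢ Finset.range c).filter fun p => p.1 < L p.2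
  isLowerSet := by
    rintro ⟨i', j'⟩ ⟨i, j⟩ ⟨hi, hj⟩ h
    simp only [Finset.coe_filter, Finset.mem_product, Finset.mem_range, Set.mem_ofPred_eq] at h ⊢
    simp only at hi hj
    have := hL hj
    omega

theorem mem_diagramOfColLens {c : ℕ} {L : ℕ → ℕ} {hL : Antitone L} (hc : L c = 0) {i j : ℕ} :
    (i, j) ∈ diagramOfColLens c L hL ↔ i < L j := by
  rw [← YoungDiagram.mem_cells]
  simp only [diagramOfColLens, Finset.mem_filter, Finset.mem_product, Finset.mem_range]
  have h₁ := hL (Nat.zero_le j)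
  rcases lt_or_ge j c with h₂ | h₂
  · omega
  · have := hL h₂
    omega

theorem colLen_diagramOfColLens {c : ℕ} {L : ℕ → ℕ} {hL : Antitone L} (hc : L c = 0) (j : ℕ) :
    (diagramOfColLens c L hL).colLen j = L j := by
  refine eq_of_forall_lt_iff fun i => ?_
  rw [← YoungDiagram.mem_iff_lt_colLen, mem_diagramOfColLens hc]

section OfColumns

variable {c : ℕ} {u : ℕ → List ℕ}

/-- The total length of the words `u k, …, u (c - 1)`. -/
def tailLength (c : ℕ) (u : ℕ → List ℕ) (k : ℕ) : ℕ := ∑ i ∈ Finset.Ico k c, (u i).length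

theorem tailLength_antitone (c : ℕ) (u : ℕ → List ℕ) : Antitone (tailLength c u) :=
  fun _ _ h => Finset.sum_le_sum_of_subset (Finset.Ico_subset_Ico_left h)

theorem tailLength_succ_antitone (c : ℕ) (u : ℕ → List ℕ) :
    Antitone fun k => tailLength c u (k + 1) :=
  fun _ _ h => tailLength_antitone c u (Nat.succ_le_succ h)

theorem tailLength_eq_zero {k : ℕ} (hk : c ≤ k) : tailLength c u k = 0 := by
  simp [tailLength, Finset.Ico_eq_empty_of_le hk]

theorem tailLength_of_lt {k : ℕ} (hk : k < c) :
    tailLength c u k = (u k).length + tailLength c u (k + 1) :=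
  Finset.sum_eq_sum_Ico_succ_bot hk _

theorem mem_diagram_tailLength {i j : ℕ} :
    (i, j) ∈ diagramOfColLens c (tailLength c u) (tailLength_antitone c u) ↔
      i < tailLength c u j :=
  mem_diagramOfColLens (tailLength_eq_zero le_rfl)

theorem mem_diagram_tailLength_succ {i j : ℕ} :
    (i, j) ∈ diagramOfColLens c (fun k => tailLength c u (k + 1)) (tailLength_succ_antitone c u) ↔
      i < tailLength c u (j + 1) := by
  have h : tailLength c u (c + 1) = 0 := tailLength_eq_zero (Nat.le_succ c)
  exact mem_diagramOfColLens (L := fun k => tailLength c u (k + 1)) h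

/-- The skew tableau with given columns, read from the bottom to the top. Each column is placed
strictly below the next one, so that there is no condition on the rows. -/
def skewTableauOfColumns (c : ℕ) (u : ℕ → List ℕ) (hu : ∀ k < c, (u k).Pairwise (· > ·)) :
    SkewTableau where
  inner := diagramOfColLens c (fun k => tailLength c u (k + 1)) (tailLength_succ_antitone c u)
  outer := diagramOfColLens c (tailLength c u) (tailLength_antitone c u)
  inner_le_outer := by
    rintro ⟨i, j⟩ h
    exact mem_diagram_tailLength.2 ((mem_diagram_tailLength_succ.1 h).trans_le
      (tailLength_antitone c u (Nat.le_succ j)))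
  entry i j := if tailLength c u (j + 1) ≤ i ∧ i < tailLength c u j then
    (u j).reverse.getD (i - tailLength c u (j + 1)) 0 else 0
  row_weak := by
    intro i j₁ j₂ hj h₁ h₂
    rw [mem_diagram_tailLength_succ] at h₁
    rw [mem_diagram_tailLength] at h₂
    have : tailLength c u j₂ ≤ tailLength c u (j₁ + 1) := tailLength_antitone c u hj
    omega
  col_strict := by
    intro i₁ i₂ j hi h₁ h₂
    rw [mem_diagram_tailLength_succ] at h₁
    rw [mem_diagram_tailLength] at h₂
    have hjc : j < c := by
      by_contra! hcj
      have := tailLength_eq_zero (u := u) hcj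
      omega
    have hlen := tailLength_of_lt (u := u) hjc
    rw [if_pos (by omega), if_pos (by omega),
      List.getD_eq_getElem _ _ (by rw [List.length_reverse]; omega),
      List.getD_eq_getElem _ _ (by rw [List.length_reverse]; omega)]
    have hp := hu j hjc
    rw [← List.reverse_reverse (u j), List.pairwise_reverse] at hp
    exact List.pairwise_iff_getElem.1 hp _ _ _ _ (by omega)
  zeros := by
    intro i j h
    rw [mem_diagram_tailLength_succ, mem_diagram_tailLength] at h
    exact if_neg (by omega)

variable (hu : ∀ k < c, (u k).Pairwise (· > ·))

theorem inner_colLen_skewTableauOfColumns (k : ℕ) :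
    (skewTableauOfColumns c u hu).inner.colLen k = tailLength c u (k + 1) := by
  have h : tailLength c u (c + 1) = 0 := tailLength_eq_zero (Nat.le_succ c)
  exact colLen_diagramOfColLens (L := fun k => tailLength c u (k + 1))
    (hL := tailLength_succ_antitone c u) h k

theorem outer_colLen_skewTableauOfColumns (k : ℕ) :
    (skewTableauOfColumns c u hu).outer.colLen k = tailLength c u k :=
  colLen_diagramOfColLens (hL := tailLength_antitone c u) (tailLength_eq_zero le_rfl) k

theorem colLen_skewTableauOfColumns {k : ℕ} (hk : k < c) :
    (skewTableauOfColumns c u hu).colLen k = (u k).length := by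
  rw [SkewTableau.colLen, inner_colLen_skewTableauOfColumns, outer_colLen_skewTableauOfColumns,
    tailLength_of_lt hk, Nat.add_sub_cancel]

theorem colLen_skewTableauOfColumns_of_le {k : ℕ} (hk : c ≤ k) :
    (skewTableauOfColumns c u hu).colLen k = 0 := by
  rw [SkewTableau.colLen, outer_colLen_skewTableauOfColumns, tailLength_eq_zero hk, Nat.zero_sub]

theorem colWord_skewTableauOfColumns {k : ℕ} (hk : k < c) :
    colWord ((skewTableauOfColumns c u hu).outer.colLen 0) (skewTableauOfColumns c u hu).config k =
      u k := by
  rw [SkewTableau.colWord_config _ le_rfl, colLen_skewTableauOfColumns hu hk, List.reverse_eq_iff]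
  refine List.ext_getElem (by simp) fun i h₁ h₂ => ?_
  have hi : i < (u k).length := by simpa using h₁
  have hlen := tailLength_of_lt (u := u) hk
  rw [List.getElem_map, List.getElem_range, inner_colLen_skewTableauOfColumns]
  change (if tailLength c u (k + 1) ≤ tailLength c u (k + 1) + i ∧
    tailLength c u (k + 1) + i < tailLength c u k then
      (u k).reverse.getD (tailLength c u (k + 1) + i - tailLength c u (k + 1)) 0 else 0) = _
  rw [if_pos (by omega), Nat.add_sub_cancel_left, List.getD_eq_getElem]

theorem word_skewTableauOfColumns :
    (skewTableauOfColumns c u hu).word = (List.range c).flatMap u := by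
  have hC : (skewTableauOfColumns c u hu).outer.rowLen 0 ≤ c := by
    by_contra! hlt
    have h := mem_diagram_tailLength.1 (YoungDiagram.mem_iff_lt_rowLen.2 hlt)
    rw [tailLength_eq_zero le_rfl] at h
    exact lt_irrefl _ h
  rw [SkewTableau.word_eq _ le_rfl hC, readingWord]
  exact List.flatMap_congr fun k hk => colWord_skewTableauOfColumns hu (List.mem_range.1 hk)

end OfColumns

/-! ### The right key in terms of the procedure -/

section RightKeyOfProcedure

variable {μ : YoungDiagram} (S : SemistandardYoungTableau μ)

theorem config_ofStraight : (SkewTableau.ofStraight S).config = initialConfig S := by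
  ext i j : 2
  simp [SkewTableau.config, SkewTableau.ofStraight, initialConfig]

theorem eq_of_pairwise_gt {l l' : List ℕ} (h : l.Pairwise (· > ·)) (h' : l'.Pairwise (· > ·))
    (hl : ∀ x, x ∈ l ↔ x ∈ l') : l = l' :=
  List.Perm.eq_of_pairwise (le := (· > ·)) (fun x y _ _ h h' => by omega) h h'
    ((List.perm_ext_iff_of_nodup (h.imp fun h => h.ne') (h'.imp fun h => h.ne')).2 hl)

/-- The columns with at most `i + 1` boxes consist of the same entries before and after the treatment
of row `i`. -/
theorem colWord_stage {i k : ℕ} (hi : i < μ.colLen 0) (hk : μ.colLen k ≤ i + 1) :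
    colWord (i + 1) (stage S i).1 k = colWord (μ.colLen 0) (initialConfig S) k := by
  refine eq_of_pairwise_gt (colWord_pairwise (stage_isSettled S hi).ordered.col)
    (colWord_pairwise (initialConfig_isOrdered S).col) fun x => ?_
  rw [mem_colWord, mem_colWord]
  simp only [Nat.lt_succ_iff]
  rw [stage_column S hi]
  constructor
  · rintro ⟨t, ht, hx⟩
    exact ⟨t, by omega, hx⟩
  · rintro ⟨t, ht, hx⟩
    refine ⟨t, ?_, hx⟩
    have := YoungDiagram.mem_iff_lt_colLen.1 ((initialConfig_eq_some S).1 hx).1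
    omega

theorem length_colWord_initialConfig (k : ℕ) :
    (colWord (μ.colLen 0) (initialConfig S) k).length = μ.colLen k := by
  have := isStraight_ofStraight S
  rw [config_ofStraight] at this
  exact this.colWord_length le_rfl k

theorem length_filterMap_map {l : List ℕ} (a : ℕ → ℕ) (b : ℕ → Option ℕ) :
    (l.filterMap fun r => (b r).map fun _ => a r).length = (l.filterMap b).length := by
  induction l with
  | nil => rfl
  | cons r l ih => rcases hr : b r with _ | x <;> simp [hr, ih]

theorem filterMap_isSome_of_length {l : List ℕ} {b : ℕ → Option ℕ}
    (h : (l.filterMap b).length = l.length) : ∀ r ∈ l, (b r).isSome := by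
  induction l with
  | nil => simp
  | cons r l ih =>
    have hle := List.length_filterMap_le b l
    rcases hr : b r with _ | x
    · simp [hr] at h
      omega
    · rw [List.filterMap_cons_some hr, List.length_cons, List.length_cons,
        Nat.add_right_cancel_iff] at h
      intro t ht
      rcases List.mem_cons.1 ht with rfl | ht
      · simp [hr]
      · exact ih h t ht

/-- The words of the columns while the column `j`, with `m` boxes, is moved to the right: it has
reached the column `d`. Here `F` is the configuration after the treatment of the first `m` rows. -/
def movedColumns (F : Config) (j m d k : ℕ) : List ℕ :=
  if k < j then colWord (μ.colLen 0) (initialConfig S) k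
  else if k < d then (List.range m).reverse.filterMap fun r =>
    (F r (k + 1)).map fun _ => lastBefore F r (k + 1)
  else if k = d then (List.range m).reverse.map fun r => lastBefore F r (d + 1)
  else colWord m F k

theorem movedColumns_pairwise {j m d : ℕ} (hm : 0 < m) (hm' : m ≤ μ.colLen 0) (k : ℕ) :
    (movedColumns S (stage S (m - 1)).1 j m d k).Pairwise (· > ·) := by
  have hset := stage_isSettled S (i := m - 1) (by omega)
  rw [Nat.sub_add_cancel hm] at hset
  have hlast : ∀ k, ((List.range m).reverse.map fun r =>
      lastBefore (stage S (m - 1)).1 r (k + 1)).Pairwise (· > ·) := by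
    intro k
    rw [List.pairwise_map, List.pairwise_reverse]
    exact (List.pairwise_lt_range).imp_of_mem fun {a b} _ hb hab =>
      hset.lastBefore_lt hab (List.mem_range.1 hb) (Nat.succ_pos k)
  rw [movedColumns]
  split_ifs
  · exact colWord_pairwise (initialConfig_isOrdered S).col
  · refine (hlast k).sublist ?_
    generalize (List.range m).reverse = l
    induction l with
    | nil => simp
    | cons r l ih =>
      rcases hr : (stage S (m - 1)).1 r (k + 1) with _ | z
      · simpa [hr] using ih.cons _
      · simpa [hr] using ih
  · exact hlast d
  · exact colWord_pairwise hset.ordered.col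

theorem movedColumns_knuth {j m d : ℕ} (hm : 0 < m) (hm' : m = μ.colLen j) (hjd : j ≤ d)
    (hd : d < μ.rowLen 0) : Knuth (SkewTableau.ofStraight S).word
      ((List.range (μ.rowLen 0)).flatMap (movedColumns S (stage S (m - 1)).1 j m d)) := by
  have hm0 : m ≤ μ.colLen 0 := hm' ▸ μ.colLen_anti 0 j (Nat.zero_le j)
  have hset := stage_isSettled S (i := m - 1) (by omega)
  rw [Nat.sub_add_cancel hm] at hset
  have hcol : ∀ k, j ≤ k → colWord m (stage S (m - 1)).1 k =
      colWord (μ.colLen 0) (initialConfig S) k := fun k hk => by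
    have := μ.colLen_anti j k hk
    have h := colWord_stage S (i := m - 1) (k := k) (by omega) (by omega)
    rwa [Nat.sub_add_cancel hm] at h
  induction d, hjd using Nat.le_induction with
  | base =>
    refine .of_eq ?_
    rw [SkewTableau.word, config_ofStraight]
    refine List.flatMap_congr fun k _ => ?_
    change colWord (μ.colLen 0) (initialConfig S) k = _
    rw [movedColumns]
    split_ifs with h₁ h₂
    · rfl
    · subst h₂
      rw [← hcol k le_rfl]
      have hsome : ∀ r ∈ (List.range m).reverse, ((stage S (m - 1)).1 r k).isSome := by
        refine filterMap_isSome_of_length ?_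
        have := length_colWord_initialConfig S k
        rw [← hcol k le_rfl, colWord, ← hm'] at this
        simpa using this
      rw [colWord, ← List.filterMap_eq_map]
      refine List.filterMap_congr fun r hr => ?_
      obtain ⟨x, hx⟩ := Option.isSome_iff_exists.1 (hsome r hr)
      simp [lastBefore, hx]
    · rw [hcol k (by omega)]
  | succ d hd' ih =>
    refine (ih (by omega)).trans (Knuth.flatMap_of_adjacent hd ?_ ?_)
    · have hlast : ∀ k, ((List.range m).reverse.map fun r =>
          lastBefore (stage S (m - 1)).1 r (k + 1)).Pairwise (· > ·) := by
        intro k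
        rw [List.pairwise_map, List.pairwise_reverse]
        exact (List.pairwise_lt_range).imp_of_mem fun {a b} _ hb hab =>
          hset.lastBefore_lt hab (List.mem_range.1 hb) (Nat.succ_pos k)
      have key := Knuth.exchange_columns (List.range m).reverse
        (fun r => lastBefore (stage S (m - 1)).1 r (d + 1)) (fun r => (stage S (m - 1)).1 r (d + 1))
        (hlast d) (hlast (d + 1)) (by
          intro r hr x hx
          have hr : r < m := by simpa using hr
          obtain ⟨a, hak, ha, -⟩ := exists_lastBefore (hset.zero_col r hr) (Nat.succ_pos d)
          exact hset.ordered.row hak ha hx)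
      have e₁ : movedColumns S (stage S (m - 1)).1 j m d d = (List.range m).reverse.map fun r =>
          lastBefore (stage S (m - 1)).1 r (d + 1) := by
        rw [movedColumns, if_neg (by omega), if_neg (by omega), if_pos rfl]
      have e₂ : movedColumns S (stage S (m - 1)).1 j m d (d + 1) =
          colWord m (stage S (m - 1)).1 (d + 1) := by
        rw [movedColumns, if_neg (by omega), if_neg (by omega), if_neg (by omega)]
      have e₃ : movedColumns S (stage S (m - 1)).1 j m (d + 1) d =
          (List.range m).reverse.filterMap fun r => ((stage S (m - 1)).1 r (d + 1)).map fun _ =>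
            lastBefore (stage S (m - 1)).1 r (d + 1) := by
        rw [movedColumns, if_neg (by omega), if_pos (by omega)]
      have e₄ : movedColumns S (stage S (m - 1)).1 j m (d + 1) (d + 1) =
          (List.range m).reverse.map fun r => lastBefore (stage S (m - 1)).1 r (d + 1 + 1) := by
        rw [movedColumns, if_neg (by omega), if_neg (by omega), if_pos rfl]
      rw [e₁, e₂, e₃, e₄]
      exact key
    · intro k hk hk'
      simp only [movedColumns]
      split_ifs <;> first | rfl | omega

/-- The skew tableaux needed to compute the right key exist, and the entries of the last column are
the row ends after the treatment of the appropriate row. -/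
theorem exists_isFrank (j : Fin (μ.rowLen 0)) : ∃ T, IsFrank S j T ∧
    ∀ x, (∃ i < μ.colLen j, stageEnd S (μ.colLen j - 1) i = x) ↔
      x ∈ lastColumn (μ.rowLen 0) T := by
  obtain ⟨j, hj⟩ := j
  simp only
  have hm : 0 < μ.colLen j :=
    YoungDiagram.mem_iff_lt_colLen.1 (YoungDiagram.mem_iff_lt_rowLen.2 hj)
  have hm0 : μ.colLen j ≤ μ.colLen 0 := μ.colLen_anti 0 j (Nat.zero_le j)
  set m := μ.colLen j with hmdef
  have hcol : ∀ k, j ≤ k → colWord m (stage S (m - 1)).1 k =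
      colWord (μ.colLen 0) (initialConfig S) k := fun k hk => by
    have := μ.colLen_anti j k hk
    have h := colWord_stage S (i := m - 1) (k := k) (by omega) (by omega)
    rwa [Nat.sub_add_cancel hm] at h
  have hu : ∀ k < μ.rowLen 0,
      (movedColumns S (stage S (m - 1)).1 j m (μ.rowLen 0 - 1) k).Pairwise (· > ·) :=
    fun k _ => movedColumns_pairwise S hm hm0 k
  have elast : movedColumns S (stage S (m - 1)).1 j m (μ.rowLen 0 - 1) (μ.rowLen 0 - 1) =
      (List.range m).reverse.map fun r => stageEnd S (m - 1) r := by
    rw [movedColumns, if_neg (by omega), if_neg (by omega), if_pos rfl,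
      Nat.sub_add_cancel (by omega)]
    rfl
  -- the columns after column `j` are moved one step to the left
  let f : Fin (μ.rowLen 0) → Fin (μ.rowLen 0) := fun k =>
    if (k : ℕ) < j then k else if h : (k : ℕ) + 1 < μ.rowLen 0 then ⟨k + 1, h⟩ else ⟨j, hj⟩
  have hf : Function.Injective f := by
    intro a b hab
    simp only [f] at hab
    have ha := a.2
    have hb := b.2
    split_ifs at hab <;> simp only [Fin.ext_iff] at hab ⊢ <;> omega
  refine ⟨skewTableauOfColumns (μ.rowLen 0) _ hu, ⟨JeuDeTaquin.of_knuth rfl ?_, ⟨Equiv.ofBijective f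
    (Finite.injective_iff_bijective.1 hf), fun k => ?_⟩,
    fun k hk => colLen_skewTableauOfColumns_of_le hu hk, ?_⟩, fun x => ?_⟩
  · rw [word_skewTableauOfColumns]
    exact movedColumns_knuth S hm rfl (by omega) (by omega)
  · rw [colLen_skewTableauOfColumns hu k.2, Equiv.ofBijective_apply]
    simp only [f]
    split_ifs with h₁ h₂
    · rw [movedColumns, if_pos h₁, length_colWord_initialConfig]
    · rw [movedColumns, if_neg h₁, if_pos (by omega), length_filterMap_map]
      have := hcol (k + 1) (by omega)
      rw [colWord] at this
      rw [this, length_colWord_initialConfig]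
    · have : (k : ℕ) = μ.rowLen 0 - 1 := by
        have := k.2
        omega
      rw [this, elast]
      simp [hmdef]
  · rw [colLen_skewTableauOfColumns hu (by omega), elast]
    simp [hmdef]
  · rw [lastColumn, colWord_skewTableauOfColumns hu (by omega), elast]
    simp

/-- The key tableau given by the row ends of the configurations of the procedure. -/
def procedureKey : SemistandardYoungTableau μ where
  entry i j := if (i, j) ∈ μ then stageEnd S (μ.colLen j - 1) i else 0
  row_weak' := by
    intro i j₁ j₂ hj h₂
    have h₁ : (i, j₁) ∈ μ := μ.up_left_mem le_rfl hj.le h₂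
    rw [if_pos h₁, if_pos h₂]
    have h₃ := μ.colLen_anti j₁ j₂ hj.le
    have h₄ := μ.colLen_anti 0 j₁ (Nat.zero_le _)
    rw [YoungDiagram.mem_iff_lt_colLen] at h₁ h₂
    exact stageEnd_anti S (by omega) (by omega) (by omega)
  col_strict' := by
    intro i₁ i₂ j hi h₂
    have h₁ : (i₁, j) ∈ μ := μ.up_left_mem hi.le le_rfl h₂
    rw [if_pos h₁, if_pos h₂]
    have h₄ := μ.colLen_anti 0 j (Nat.zero_le _)
    rw [YoungDiagram.mem_iff_lt_colLen] at h₂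
    exact stageEnd_lt S (by omega) hi (by omega)
  zeros' := fun h => if_neg h

theorem procedureKey_apply {i j : ℕ} (h : i < μ.colLen j) :
    procedureKey S i j = stageEnd S (μ.colLen j - 1) i :=
  if_pos (YoungDiagram.mem_iff_lt_colLen.2 h)

theorem isRightKey_procedureKey : IsRightKey S (procedureKey S) := by
  refine IsRightKey.of_exists fun j => ?_
  obtain ⟨T, hT, h⟩ := exists_isFrank S j
  refine ⟨T, hT, fun x => ?_⟩
  rw [← h]
  refine exists_congr fun i => and_congr_right fun hi => ?_
  rw [procedureKey_apply S hi]

/-- A column of the key with `m` boxes consists of the first `m` exposed values. -/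
theorem exists_procedureKey_iff {j : ℕ} (hj : j < μ.rowLen 0) (x : ℕ) :
    (∃ i < μ.colLen j, procedureKey S i j = x) ↔ ∃ t < μ.colLen j, (stage S t).2 = x := by
  have hm : 0 < μ.colLen j :=
    YoungDiagram.mem_iff_lt_colLen.1 (YoungDiagram.mem_iff_lt_rowLen.2 hj)
  have hm0 : μ.colLen j ≤ μ.colLen 0 := μ.colLen_anti 0 j (Nat.zero_le j)
  have h := exists_stageEnd_iff S (i := μ.colLen j - 1) (by omega) x
  have hlt : ∀ t, t ≤ μ.colLen j - 1 ↔ t < μ.colLen j := fun t => by omega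
  simp only [hlt] at h
  rw [← h]
  refine exists_congr fun i => and_congr_right fun hi => ?_
  rw [procedureKey_apply S hi]

end RightKeyOfProcedure

/-! ### The permutation -/

section Word

variable {n : ℕ} {μ : YoungDiagram} (S : SemistandardYoungTableau μ)

theorem length_exposedValues : (exposedValues S).length = μ.colLen 0 := by
  simp [exposedValues]

theorem mem_exposedValues {x : ℕ} :
    x ∈ exposedValues S ↔ ∃ t < μ.colLen 0, (stage S t).2 = x := by
  simp [exposedValues]

theorem exposedValues_nodup : (exposedValues S).Nodup := by
  rw [exposedValues, List.nodup_map_iff_inj_on List.nodup_range]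
  intro i hi j hj h
  rw [List.mem_range] at hi hj
  rcases lt_trichotomy i j with hlt | heq | hlt
  · exact absurd h (stage_snd_ne S hlt hj)
  · exact heq
  · exact absurd h.symm (stage_snd_ne S hlt hi)

theorem procedureWord_perm (hS : ∀ i j : ℕ, (i, j) ∈ μ → S i j < n) :
    (procedureWord n S).Perm (List.range n) := by
  refine (List.perm_ext_iff_of_nodup ?_ List.nodup_range).2 fun x => ?_
  · refine (exposedValues_nodup S).append (List.nodup_range.filter _) ?_
    intro x hx hx'
    simp only [List.mem_filter, decide_eq_true_eq] at hx'
    exact hx'.2 hx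
  · rw [procedureWord, List.mem_append, List.mem_filter, List.mem_range, decide_eq_true_eq]
    constructor
    · rintro (hx | hx)
      · obtain ⟨t, ht, rfl⟩ := (mem_exposedValues S).1 hx
        obtain ⟨r, c, hrc, h⟩ := exists_stage_snd S ht
        rw [h]
        exact hS r c hrc
      · exact hx.1
    · intro hx
      by_cases h : x ∈ exposedValues S
      · exact .inl h
      · exact .inr ⟨hx, h⟩

theorem exists_perm_of_perm_range {l : List ℕ} (h : l.Perm (List.range n)) :
    ∃ φ : Equiv.Perm (Fin n), List.ofFn (fun i : Fin n => (φ i : ℕ)) = l := by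
  have hlen : l.length = n := by simpa using h.length_eq
  have hlt : ∀ (i : ℕ) (hi : i < l.length), l[i] < n := fun i hi =>
    List.mem_range.1 (h.subset (List.getElem_mem hi))
  have hnd : l.Nodup := h.nodup_iff.2 List.nodup_range
  let f : Fin n → Fin n := fun i => ⟨l[(i : ℕ)]'(by omega), hlt i (by omega)⟩
  have hf : Function.Injective f := by
    intro a b hab
    simp only [f, Fin.mk.injEq] at hab
    exact Fin.ext ((hnd.getElem_inj_iff).1 hab)
  refine ⟨Equiv.ofBijective f (Finite.injective_iff_bijective.1 hf), ?_⟩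
  refine List.ext_getElem (by simp [hlen]) fun i h₁ h₂ => ?_
  simp [f]

theorem getElem_procedureWord {i : ℕ} (hi : i < μ.colLen 0) :
    (procedureWord n S)[i]? = some (stage S i).2 := by
  rw [procedureWord, List.getElem?_append_left (by rwa [length_exposedValues])]
  simp [exposedValues, hi]

variable {φ : Equiv.Perm (Fin n)}
  (hφ : List.ofFn (fun i : Fin n => (φ i : ℕ)) = procedureWord n S)

include hφ

theorem getElem_procedureWord_eq (k : Fin n) : (procedureWord n S)[(k : ℕ)]? = some (φ k : ℕ) := by
  rw [← hφ]
  simp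

theorem apply_eq_stage {k : Fin n} (hk : (k : ℕ) < μ.colLen 0) : (φ k : ℕ) = (stage S k).2 := by
  have h := getElem_procedureWord_eq S hφ k
  rw [getElem_procedureWord S hk] at h
  exact (Option.some.inj h).symm

theorem colLen_zero_le : μ.colLen 0 ≤ n := by
  have h : n = (procedureWord n S).length := by simp [← hφ]
  rw [h, procedureWord, List.length_append, length_exposedValues]
  omega

/-- The permutation is increasing on the sets of rows with the same length. -/
theorem apply_lt_apply {a b : Fin n} (hab : a < b) (h : μ.rowLen a = μ.rowLen b) : φ a < φ b := by
  rw [Fin.lt_def] at hab ⊢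
  rcases lt_or_ge (b : ℕ) (μ.colLen 0) with hb | hb
  · rw [apply_eq_stage S hφ hb, apply_eq_stage S hφ (hab.trans hb)]
    have key : ∀ d, (a : ℕ) + d < b → (stage S a).2 < (stage S (a + d + 1)).2 := by
      intro d
      induction d with
      | zero =>
        intro hd
        refine stage_snd_lt S (by omega) ?_
        have h₁ := μ.rowLen_anti a (a + 1) (by omega)
        have h₂ := μ.rowLen_anti (a + 1) b (by omega)
        omega
      | succ d ih =>
        intro hd
        refine (ih (by omega)).trans (stage_snd_lt S (by omega) ?_)
        have h₁ := μ.rowLen_anti a (a + d + 1) (by omega)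
        have h₂ := μ.rowLen_anti (a + d + 1) (a + d + 1 + 1) (by omega)
        have h₃ := μ.rowLen_anti (a + d + 1 + 1) b (by omega)
        omega
    have := key (b - a - 1) (by omega)
    rwa [show (a : ℕ) + (b - a - 1) + 1 = b by omega] at this
  · have h0 : ∀ r, μ.colLen 0 ≤ r ↔ μ.rowLen r = 0 := fun r => by
      have h := @YoungDiagram.mem_iff_lt_colLen μ r 0
      rw [YoungDiagram.mem_iff_lt_rowLen] at h
      omega
    have ha : μ.colLen 0 ≤ a := by
      rw [h0, h, ← h0]
      exact hb
    have key : ∀ k : Fin n, μ.colLen 0 ≤ k →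
        ((List.range n).filter fun x => decide (x ∉ exposedValues S))[(k : ℕ) - μ.colLen 0]? =
          some (φ k : ℕ) := fun k hk => by
      have h := getElem_procedureWord_eq S hφ k
      rwa [procedureWord, List.getElem?_append_right (by rwa [length_exposedValues]),
        length_exposedValues] at h
    obtain ⟨ha', ea⟩ := List.getElem?_eq_some_iff.1 (key a ha)
    obtain ⟨hb', eb⟩ := List.getElem?_eq_some_iff.1 (key b hb)
    rw [← ea, ← eb]
    exact List.pairwise_iff_getElem.1 ((List.pairwise_lt_range (n := n)).filter _) _ _ _ _
      (by omega)

theorem isKeyTableauOf_procedureKey : IsKeyTableauOf φ (procedureKey S) := by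
  intro j hj x
  rw [exists_procedureKey_iff S hj]
  have hm0 : μ.colLen j ≤ μ.colLen 0 := μ.colLen_anti 0 j (Nat.zero_le j)
  have hn := colLen_zero_le S hφ
  constructor
  · rintro ⟨t, ht, rfl⟩
    exact ⟨⟨t, by omega⟩, ht, apply_eq_stage S hφ (by simp only; omega)⟩
  · rintro ⟨k, hk, rfl⟩
    exact ⟨k, hk, (apply_eq_stage S hφ (by omega)).symm⟩

end Word

/-! ### Cosets and the Bruhat order -/

section Coset

variable {n : ℕ} {μ : YoungDiagram} {φ : Equiv.Perm (Fin n)}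

theorem mem_partitionStabilizer {τ : Equiv.Perm (Fin n)} :
    τ ∈ partitionStabilizer n μ ↔ ∀ i : Fin n, μ.rowLen (τ i) = μ.rowLen i := by
  have h : τ ∈ partitionStabilizer n μ ↔
      (fun i : Fin n => μ.rowLen (τ⁻¹ i)) = fun i : Fin n => μ.rowLen i := Iff.rfl
  rw [h, funext_iff]
  constructor
  · intro h i
    simpa using (h (τ i)).symm
  · intro h i
    simpa using (h (τ⁻¹ i)).symm

theorem mem_coset {σ : Equiv.Perm (Fin n)} :
    σ ∈ φ • (partitionStabilizer n μ : Set (Equiv.Perm (Fin n))) ↔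
      ∀ i : Fin n, μ.rowLen (φ⁻¹ (σ i)) = μ.rowLen i := by
  rw [Set.mem_smul_set_iff_inv_smul_mem, smul_eq_mul, SetLike.mem_coe, mem_partitionStabilizer]
  rfl

/-- Permutations determine the same key if and only if they lie in the same coset. -/
theorem IsKeyTableauOf.iff_mem_coset {K : SemistandardYoungTableau μ} (h : IsKeyTableauOf φ K)
    (σ : Equiv.Perm (Fin n)) : IsKeyTableauOf σ K ↔
      σ ∈ φ • (partitionStabilizer n μ : Set (Equiv.Perm (Fin n))) := by
  have hmem : ∀ {i j}, i < μ.colLen j ↔ j < μ.rowLen i := fun {i j} => by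
    rw [← YoungDiagram.mem_iff_lt_colLen, YoungDiagram.mem_iff_lt_rowLen]
  have key : IsKeyTableauOf σ K ↔ ∀ j < μ.rowLen 0, ∀ k : Fin n,
      (φ⁻¹ (σ k) : ℕ) < μ.colLen j ↔ (k : ℕ) < μ.colLen j := by
    have h₁ : ∀ (ρ : Equiv.Perm (Fin n)) (j : ℕ) (y : Fin n),
        (∃ k : Fin n, (k : ℕ) < μ.colLen j ∧ (ρ k : ℕ) = y) ↔
          ((ρ⁻¹ y : Fin n) : ℕ) < μ.colLen j := by
      intro ρ j y
      constructor
      · rintro ⟨k, hk, hy⟩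
        rw [← Fin.ext hy]
        simpa using hk
      · intro hy
        exact ⟨ρ⁻¹ y, hy, by simp⟩
    constructor
    · intro hσ j hj k
      have := (hσ j hj (σ k)).symm.trans (h j hj (σ k))
      rw [h₁, h₁] at this
      simpa using this.symm
    · intro hσ j hj x
      rw [h j hj x]
      by_cases hx : x < n
      · have e₁ := h₁ φ j ⟨x, hx⟩
        have e₂ := h₁ σ j ⟨x, hx⟩
        have e₃ := hσ j hj (σ⁻¹ ⟨x, hx⟩)
        rw [show σ (σ⁻¹ ⟨x, hx⟩) = ⟨x, hx⟩ from σ.apply_symm_apply _] at e₃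
        rw [e₁, e₂, e₃]
      · constructor <;>
        · rintro ⟨k, -, rfl⟩
          exact absurd (Fin.is_lt _) hx
  rw [key, mem_coset]
  constructor
  · intro hσ k
    refine eq_of_forall_lt_iff fun j => ?_
    rw [← hmem, ← hmem]
    rcases lt_or_ge j (μ.rowLen 0) with hj | hj
    · exact hσ j hj k
    · have h₁ := μ.rowLen_anti 0 (φ⁻¹ (σ k) : Fin n) (Nat.zero_le _)
      have h₂ := μ.rowLen_anti 0 k (Nat.zero_le _)
      rw [hmem, hmem]
      omega
  · intro hσ j _ k
    rw [hmem, hmem, hσ]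

theorem toLex_lt_mul_swap {u : Equiv.Perm (Fin n)} {a b : Fin n} (hab : a < b) (h : u a < u b) :
    toLex (u : Fin n → Fin n) < toLex (⇑(u * Equiv.swap a b)) := by
  refine ⟨a, fun j hj => ?_, ?_⟩
  · have hj' : j ≠ b := (hj.trans hab).ne
    simp [Equiv.swap_apply_of_ne_of_ne hj.ne hj']
  · simpa using h

/-- The Bruhat order is contained in the lexicographic order of the one-line notations. -/
theorem BruhatLE.toLex_le {u v : Equiv.Perm (Fin n)} (h : BruhatLE u v) :
    toLex (u : Fin n → Fin n) ≤ toLex (v : Fin n → Fin n) := by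
  induction h with
  | refl => exact le_rfl
  | tail _ hst ih =>
    obtain ⟨a, b, hab, hlt, rfl⟩ := hst
    exact ih.trans (toLex_lt_mul_swap hab hlt).le

theorem BruhatLE.antisymm {u v : Equiv.Perm (Fin n)} (h : BruhatLE u v) (h' : BruhatLE v u) :
    u = v :=
  DFunLike.coe_injective (toLex_inj.1 (h.toLex_le.antisymm h'.toLex_le))

variable (hφ : ∀ a b : Fin n, a < b → μ.rowLen a = μ.rowLen b → φ a < φ b)

include hφ

/-- The only element of the coset that is increasing on the sets of rows with the same length. -/
theorem eq_of_mem_coset {σ : Equiv.Perm (Fin n)}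
    (hσ : σ ∈ φ • (partitionStabilizer n μ : Set (Equiv.Perm (Fin n))))
    (hinc : ∀ a b : Fin n, a < b → μ.rowLen a = μ.rowLen b → σ a < σ b) : σ = φ := by
  rw [mem_coset] at hσ
  have hmono : StrictMono (φ⁻¹ * σ : Equiv.Perm (Fin n)) := by
    intro a b hab
    rw [Equiv.Perm.mul_apply, Equiv.Perm.mul_apply]
    by_contra! hle
    have hne : φ⁻¹ (σ b) ≠ φ⁻¹ (σ a) := fun h =>
      hab.ne (σ.injective (φ⁻¹.injective h)).symm
    have hlt : φ⁻¹ (σ b) < φ⁻¹ (σ a) := lt_of_le_of_ne hle hne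
    have h₁ := μ.rowLen_anti (φ⁻¹ (σ b) : Fin n) (φ⁻¹ (σ a) : Fin n) hle
    have h₂ := μ.rowLen_anti a b (Fin.le_def.1 hab.le)
    rw [hσ, hσ] at h₁
    have heq : μ.rowLen a = μ.rowLen b := le_antisymm h₁ h₂
    have h₃ := hφ _ _ hlt (by rw [hσ, hσ, heq])
    rw [show ∀ y, φ (φ⁻¹ y) = y from φ.apply_symm_apply,
      show ∀ y, φ (φ⁻¹ y) = y from φ.apply_symm_apply] at h₃
    exact lt_asymm h₃ (hinc a b hab heq)
  have hid : (φ⁻¹ * σ : Equiv.Perm (Fin n)) = 1 := by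
    ext i
    have h₁ : i ≤ (φ⁻¹ * σ : Equiv.Perm (Fin n)) i := hmono.le_apply
    have h₂ : (φ⁻¹ * σ : Equiv.Perm (Fin n)) i ≤ i := hmono.apply_le
    exact congrArg Fin.val (le_antisymm h₂ h₁)
  exact (inv_mul_eq_one.1 hid).symm

/-- A permutation of the coset is sorted by exchanging values at positions of the same row length. -/
theorem bruhatLE_of_mem_coset {σ : Equiv.Perm (Fin n)}
    (hσ : σ ∈ φ • (partitionStabilizer n μ : Set (Equiv.Perm (Fin n)))) : BruhatLE φ σ := by
  induction hx : toLex (σ : Fin n → Fin n) using WellFoundedLT.induction generalizing σ with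
  | ind x ih =>
    subst hx
    by_cases hinc : ∀ a b : Fin n, a < b → μ.rowLen a = μ.rowLen b → σ a < σ b
    · rw [eq_of_mem_coset hφ hσ hinc]
      exact .refl
    · push Not at hinc
      obtain ⟨a, b, hab, heq, hle⟩ := hinc
      have hlt : σ b < σ a := lt_of_le_of_ne hle fun h => hab.ne (σ.injective h).symm
      have hinv : σ = σ * Equiv.swap a b * Equiv.swap a b := by
        rw [mul_assoc, Equiv.swap_mul_self, mul_one]
      have hlt' : (σ * Equiv.swap a b) a < (σ * Equiv.swap a b) b := by simpa using hlt
      have hlex := toLex_lt_mul_swap hab hlt'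
      rw [← hinv] at hlex
      refine .tail (ih _ hlex (σ := σ * Equiv.swap a b) ?_ rfl) ⟨a, b, hab, hlt', hinv⟩
      rw [mem_coset] at hσ ⊢
      intro i
      rw [Equiv.Perm.mul_apply, hσ]
      rcases eq_or_ne i a with rfl | ha
      · rw [Equiv.swap_apply_left, heq]
      · rcases eq_or_ne i b with rfl | hb
        · rw [Equiv.swap_apply_right, heq]
        · rw [Equiv.swap_apply_of_ne_of_ne ha hb]

end Coset

end RightKey

/-- The procedure applied to a semistandard tableau `S` with entries in `{0, …, n - 1}` produces the
one-line notation of a permutation `φ`; the right key of `S` is the coset `φ S_μ` (that is, the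
permutations that determine the right key of `S` are exactly the elements of this coset); and `φ` is
the least element, and the only minimal element, of this coset in the Bruhat order. -/
theorem theorem3p1 (n : ℕ) (μ : YoungDiagram) (S : SemistandardYoungTableau μ)
    (hS : ∀ i j : ℕ, (i, j) ∈ μ → S i j < n) :
    ∃ φ : Equiv.Perm (Fin n),
      List.ofFn (fun i : Fin n => (φ i : ℕ)) = RightKey.procedureWord n S ∧
      (∃ K : SemistandardYoungTableau μ, RightKey.IsRightKey S K ∧
        ∀ σ : Equiv.Perm (Fin n), RightKey.IsKeyTableauOf σ K ↔
          σ ∈ φ • (RightKey.partitionStabilizer n μ : Set (Equiv.Perm (Fin n)))) ∧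
      (∀ σ ∈ φ • (RightKey.partitionStabilizer n μ : Set (Equiv.Perm (Fin n))),
        RightKey.BruhatLE φ σ) ∧
      (∀ σ ∈ φ • (RightKey.partitionStabilizer n μ : Set (Equiv.Perm (Fin n))),
        (∀ τ ∈ φ • (RightKey.partitionStabilizer n μ : Set (Equiv.Perm (Fin n))),
          RightKey.BruhatLE τ σ → τ = σ) ↔ σ = φ) := by
  obtain ⟨φ, hφ⟩ := RightKey.exists_perm_of_perm_range (RightKey.procedureWord_perm S hS)
  have hinc : ∀ a b : Fin n, a < b → μ.rowLen a = μ.rowLen b → φ a < φ b :=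
    fun a b hab h => RightKey.apply_lt_apply S hφ hab h
  have hle : ∀ σ ∈ φ • (RightKey.partitionStabilizer n μ : Set (Equiv.Perm (Fin n))),
      RightKey.BruhatLE φ σ := fun σ hσ => RightKey.bruhatLE_of_mem_coset hinc hσ
  have hmem : φ ∈ φ • (RightKey.partitionStabilizer n μ : Set (Equiv.Perm (Fin n))) := by
    rw [RightKey.mem_coset]
    simp
  refine ⟨φ, hφ, ⟨RightKey.procedureKey S, RightKey.isRightKey_procedureKey S,
    (RightKey.isKeyTableauOf_procedureKey S hφ).iff_mem_coset⟩, hle, fun σ hσ => ⟨fun h => ?_, ?_⟩⟩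
  · exact (h φ hmem (hle σ hσ)).symm
  · rintro rfl τ hτ h
    exact h.antisymm (hle τ hτ)
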